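/- **Setting.** Let $n\ge 1$, let $P_1\in\mathbb{C}^{n\times n}$ be Hermitian and invertible, let $P_0\in\mathbb{C}^{n\times n}$ be arbitrary, and let $\mathcal{H}\colon[0,\infty)\to\mathbb{R}^{n\times n}$ be continuously differentiable with Hermitian (i.e. symmetric) positive definite values. Let $\Delta,S\colon[0,\infty)\to\mathbb{C}^{n\times n}$ be continuously differentiable, with $\Delta(\xi)$ diagonal, $S(\xi)$ invertible and $P_1\mathcal{H}(\xi)=S(\xi)^{-1}\Delta(\xi)S(\xi)$ for all $\xi\ge 0$. Let $n_-\ge 1$ be the number of negative eigenvalues of $P_1$ (counted with multiplicity) and let $Z^-(0)$ be the span of the eigenvectors of $P_1\mathcal{H}(0)$ belonging to negative eigenvalues. Let $W_B\in\mathbb{C}^{n_-\times n}$, and let $U_2\in\mathbb{C}^{n_-\times n_-}$ be the matrix formed by those columns of $W_B\mathcal{H}(0)S(0)^{-1}$ whose index $j$ satisfies $\Delta_{jj}(0)<0$ (in any fixed order; these are the last $n_-$ columns if the positive diagonal entries of $\Delta$ are listed first). For a continuous $w\colon[0,\infty)\to\mathbb{C}^{n\times n}$ with positive definite Hermitian values,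 let $L^2_w(0,\infty)$ be the space of (classes of) measurable $x\colon(0,\infty)\to\mathbb{C}^n$ with $\|x\|^2=\int_0^\infty x(\xi)^\star w(\xi)x(\xi)\,d\xi<\infty$. Put $|\Delta|=(\Delta^\star\Delta)^{1/2}$ and assume that * (a) $\Delta$ is bounded; * (b) $x\mapsto Sx$ is an isomorphism of Banach spaces $L^2_{\mathcal{H}}(0,\infty)\to L^2_{|\Delta|}(0,\infty)$; * (c) $g\mapsto S(S^{-1})'\Delta g$ is a bounded operator on $L^2_{|\Delta|}(0,\infty)$; * (d) $x\mapsto S'P_1\mathcal{H}x$ is well defined as a map $L^2_{\mathcal{H}}(0,\infty)\to L^2_{|\Delta|}(0,\infty)$; * (e) $\operatorname{rank}W_B=n_-$; * multiplication by $\mathcal{H}$ is a bounded operator on $L^2_{\mathcal{H}}(0,\infty)$. Consider in $L^2_{\mathcal{H}}(0,\infty)$ the operator $$A_{\mathcal{H}}x=P_1(\mathcal{H}x)'+P_0\mathcal{H}x,$$ $$D(A_{\mathcal{H}})=\{x\in L^2_{\mathcal{H}}(0,\infty):\ \mathcal{H}x\in AC_{loc}[0,\infty),\ P_1(\mathcal{H}x)'+P_0\mathcal{H}x\in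 L^2_{\mathcal{H}}(0,\infty),\ W_B(\mathcal{H}x)(0)=0\}.$$ **Corollary.** The following are equivalent: 1. $A_{\mathcal{H}}$ generates a $C_0$-semigroup on $L^2_{\mathcal{H}}(0,\infty)$; 2. $U_2$ is invertible; 3. $W_B\mathcal{H}(0)Z^-(0)=\mathbb{C}^{n_-}$. Moreover, let $$D=\{x\in L^2_{\mathcal{H}}(0,\infty):\ \mathcal{H}x\in AC_{loc}[0,\infty),\ (\mathcal{H}x)'\in L^2_{\mathcal{H}}(0,\infty),\ W_B(\mathcal{H}x)(0)=0\}.$$ If $P_1(\mathcal{H}x)'+P_0\mathcal{H}x\in L^2_{\mathcal{H}}(0,\infty)$ for every $x\in D$, then the operator $x\mapsto P_1(\mathcal{H}x)'+P_0\mathcal{H}x$ with domain $D$ also generates a $C_0$-semigroup on $L^2_{\mathcal{H}}(0,\infty)$ if and only if 2 (equivalently 3) holds. -/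

import Mathlib

open MeasureTheory Set Filter Topology Matrix
open scoped NNReal ComplexOrder

noncomputable section

namespace PortHam

/-- Lebesgue measure on the half-line `(0,∞)`. -/
abbrev halfLine : Measure ℝ := volume.restrict (Ioi (0 : ℝ))

theorem ae_halfLine_pos : ∀ᵐ ξ ∂halfLine, (0 : ℝ) < ξ :=
  ae_restrict_mem measurableSet_Ioi

/-- A continuous matrix weight on `[0,∞)` with positive definite Hermitian values
(the values of `toFun` at negative arguments are irrelevant). -/
structure Weight (n : ℕ) where
  toFun : ℝ → Matrix (Fin n) (Fin n) ℂ
  continuousOn : ∀ i j, ContinuousOn (fun ξ => toFun ξ i j) (Ici 0)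
  posDef : ∀ ξ, 0 ≤ ξ → (toFun ξ).PosDef

variable {n : ℕ}

/-! ### The weighted space -/

/-- The pointwise sesquilinear form `x(ξ)^⋆ W(ξ) y(ξ)`. -/
def Weight.form (w : Weight n) (x y : ℝ → Fin n → ℂ) (ξ : ℝ) : ℂ :=
  star (x ξ) ⬝ᵥ (w.toFun ξ *ᵥ y ξ)

theorem Weight.form_self_nonneg (w : Weight n) (x : ℝ → Fin n → ℂ) {ξ : ℝ} (hξ : 0 ≤ ξ) :
    0 ≤ w.form x x ξ :=
  (w.posDef ξ hξ).posSemidef.dotProduct_mulVec_nonneg _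

theorem Weight.aestronglyMeasurable_form (w : Weight n) {x y : ℝ → Fin n → ℂ}
    (hx : AEStronglyMeasurable x halfLine) (hy : AEStronglyMeasurable y halfLine) :
    AEStronglyMeasurable (w.form x y) halfLine := by
  have hx' := fun i => (hx.aemeasurable.eval i)
  have hy' := fun i => (hy.aemeasurable.eval i)
  have hw : ∀ i j, AEMeasurable (fun ξ => w.toFun ξ i j) halfLine := fun i j =>
    ((w.continuousOn i j).mono Ioi_subset_Ici_self).aemeasurable measurableSet_Ioi
  refine AEMeasurable.aestronglyMeasurable ?_
  unfold Weight.form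
  simp only [dotProduct, mulVec, Pi.star_apply]
  refine Finset.aemeasurable_fun_sum _ fun i _ => ?_
  refine AEMeasurable.mul (continuous_star.measurable.comp_aemeasurable (hx' i)) ?_
  exact Finset.aemeasurable_fun_sum _ fun j _ => (hw i j).mul (hy' j)

theorem Weight.form_swap (w : Weight n) (x y : ℝ → Fin n → ℂ) {ξ : ℝ} (hξ : 0 ≤ ξ) :
    star (w.form y x ξ) = w.form x y ξ := by
  unfold Weight.form
  rw [← star_dotProduct_star, star_star, star_mulVec, (w.posDef ξ hξ).isHermitian.eq,
    ← dotProduct_mulVec]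

/-- A crude pointwise Cauchy-Schwarz bound. -/
theorem Weight.norm_form_le (w : Weight n) (x y : ℝ → Fin n → ℂ) {ξ : ℝ} (hξ : 0 ≤ ξ) :
    ‖w.form x y ξ‖ ≤ 2 * (‖w.form x x ξ‖ + ‖w.form y y ξ‖) := by
  have key : ∀ c : ℂ, 0 ≤ w.form x x ξ + star c * c * w.form y y ξ +
      (c * w.form x y ξ + star c * w.form y x ξ) := by
    intro c
    have h := (w.posDef ξ hξ).posSemidef.dotProduct_mulVec_nonneg (x ξ + c • y ξ)
    have e : star (x ξ + c • y ξ) ⬝ᵥ (w.toFun ξ *ᵥ (x ξ + c • y ξ)) =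
        w.form x x ξ + star c * c * w.form y y ξ +
          (c * w.form x y ξ + star c * w.form y x ξ) := by
      simp only [Weight.form, star_add, star_smul, mulVec_add, mulVec_smul, add_dotProduct,
        dotProduct_add, smul_dotProduct, dotProduct_smul, smul_eq_mul]
      ring
    rwa [e] at h
  have hs := w.form_swap y x hξ
  have hx := w.form_self_nonneg x hξ
  have hy := w.form_self_nonneg y hξ
  have hx1 : ‖w.form x x ξ‖ = (w.form x x ξ).re :=
    congrArg Complex.re (Complex.norm_of_nonneg' hx)
  have hy1 : ‖w.form y y ξ‖ = (w.form y y ξ).re :=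
    congrArg Complex.re (Complex.norm_of_nonneg' hy)
  have k1 := (Complex.le_def.1 (key 1)).1
  have k2 := (Complex.le_def.1 (key (-1))).1
  have k3 := (Complex.le_def.1 (key Complex.I)).1
  have k4 := (Complex.le_def.1 (key (-Complex.I))).1
  rw [← hs] at k1 k2 k3 k4
  have hb := Complex.norm_le_abs_re_add_abs_im (w.form x y ξ)
  simp at k1 k2 k3 k4
  rw [hx1, hy1]
  have hre : |(w.form x y ξ).re| ≤ (w.form x x ξ).re + (w.form y y ξ).re := by
    rw [abs_le]; constructor <;> nlinarith [(Complex.le_def.1 hx).1, (Complex.le_def.1 hy).1]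
  have him : |(w.form x y ξ).im| ≤ (w.form x x ξ).re + (w.form y y ξ).re := by
    rw [abs_le]; constructor <;> nlinarith [(Complex.le_def.1 hx).1, (Complex.le_def.1 hy).1]
  linarith

theorem Weight.integrable_form (w : Weight n) {x y : ℝ → Fin n → ℂ}
    (hx : AEStronglyMeasurable x halfLine) (hy : AEStronglyMeasurable y halfLine)
    (hxx : Integrable (w.form x x) halfLine) (hyy : Integrable (w.form y y) halfLine) :
    Integrable (w.form x y) halfLine := by
  refine Integrable.mono' ((hxx.norm.add hyy.norm).const_mul 2)
    (w.aestronglyMeasurable_form hx hy) ?_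
  filter_upwards [ae_halfLine_pos] with ξ hξ using w.norm_form_le x y hξ.le

theorem Weight.form_congr (w : Weight n) {x x' y y' : ℝ → Fin n → ℂ}
    (hx : x =ᵐ[halfLine] x') (hy : y =ᵐ[halfLine] y') :
    w.form x y =ᵐ[halfLine] w.form x' y' := by
  filter_upwards [hx, hy] with ξ h1 h2
  simp only [Weight.form, h1, h2]

/-- The classes (modulo null sets) of measurable `x : (0,∞) → ℂⁿ` with
`∫ x^⋆ W x dξ < ∞`. -/
def l2Submodule (w : Weight n) : Submodule ℂ (ℝ →ₘ[halfLine] (Fin n → ℂ)) where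
  carrier := {x | Integrable (w.form x x) halfLine}
  add_mem' := by
    intro x y hx hy
    have hxy := w.integrable_form x.aestronglyMeasurable y.aestronglyMeasurable hx hy
    have hyx := w.integrable_form y.aestronglyMeasurable x.aestronglyMeasurable hy hx
    refine (((Integrable.add hx hxy).add hyx).add hy).congr ?_
    refine EventuallyEq.trans (Eventually.of_forall fun ξ => ?_)
      (w.form_congr (AEEqFun.coeFn_add x y) (AEEqFun.coeFn_add x y)).symm
    simp only [Weight.form, Pi.add_apply, star_add, mulVec_add, add_dotProduct, dotProduct_add]
    ring
  zero_mem' := by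
    refine (integrable_zero ℝ ℂ halfLine).congr ?_
    refine EventuallyEq.trans (Eventually.of_forall fun ξ => ?_)
      (w.form_congr AEEqFun.coeFn_zero AEEqFun.coeFn_zero).symm
    simp [Weight.form]
  smul_mem' := by
    intro c x hx
    refine (Integrable.const_mul hx (star c * c)).congr ?_
    refine EventuallyEq.trans (Eventually.of_forall fun ξ => ?_)
      (w.form_congr (AEEqFun.coeFn_smul c x) (AEEqFun.coeFn_smul c x)).symm
    simp only [Weight.form, Pi.smul_apply, star_smul, mulVec_smul, smul_dotProduct,
      dotProduct_smul, smul_eq_mul]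
    ring

/-- The weighted space `L²_W(0,∞)`. -/
def L2W (w : Weight n) : Type := l2Submodule w

instance (w : Weight n) : AddCommGroup (L2W w) := inferInstanceAs (AddCommGroup (l2Submodule w))

instance (w : Weight n) : Module ℂ (L2W w) := inferInstanceAs (Module ℂ (l2Submodule w))

/-- The underlying class of functions modulo null sets. -/
def L2W.toAE {w : Weight n} (x : L2W w) : ℝ →ₘ[halfLine] (Fin n → ℂ) := Subtype.val x

/-- A representative of `x`. -/
def L2W.rep {w : Weight n} (x : L2W w) : ℝ → Fin n → ℂ := x.toAE

theorem L2W.aestronglyMeasurable {w : Weight n} (x : L2W w) :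
    AEStronglyMeasurable x.rep halfLine := x.toAE.aestronglyMeasurable

theorem L2W.integrable {w : Weight n} (x : L2W w) : Integrable (w.form x.rep x.rep) halfLine :=
  Subtype.property x

theorem L2W.ext_ae {w : Weight n} {x y : L2W w} (h : x.rep =ᵐ[halfLine] y.rep) : x = y :=
  Subtype.ext (AEEqFun.ext h)

theorem L2W.rep_add {w : Weight n} (x y : L2W w) :
    (x + y).rep =ᵐ[halfLine] fun ξ => x.rep ξ + y.rep ξ := AEEqFun.coeFn_add x.toAE y.toAE

theorem L2W.rep_smul {w : Weight n} (c : ℂ) (x : L2W w) :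
    (c • x).rep =ᵐ[halfLine] fun ξ => c • x.rep ξ := AEEqFun.coeFn_smul c x.toAE

theorem L2W.rep_zero (w : Weight n) :
    (0 : L2W w).rep =ᵐ[halfLine] fun _ => 0 := AEEqFun.coeFn_zero

/-- The scalar product `⟨x,y⟩ = ∫ x^⋆ W y dξ`. -/
@[reducible] def innerCore (w : Weight n) : InnerProductSpace.Core ℂ (L2W w) where
  inner x y := ∫ ξ, w.form x.rep y.rep ξ ∂halfLine
  conj_inner_symm x y := by
    rw [← integral_conj]
    refine integral_congr_ae ?_
    filter_upwards [ae_halfLine_pos] with ξ hξ using w.form_swap _ _ hξ.le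
  re_inner_nonneg x := by
    have h : 0 ≤ ∫ ξ, w.form x.rep x.rep ξ ∂halfLine := by
      refine integral_nonneg_of_ae ?_
      filter_upwards [ae_halfLine_pos] with ξ hξ using w.form_self_nonneg _ hξ.le
    exact (Complex.le_def.1 h).1
  add_left x y z := by
    rw [← integral_add
      (w.integrable_form x.aestronglyMeasurable z.aestronglyMeasurable x.integrable z.integrable)
      (w.integrable_form y.aestronglyMeasurable z.aestronglyMeasurable y.integrable z.integrable)]
    refine integral_congr_ae ?_
    filter_upwards [x.rep_add y] with ξ h
    simp only [Weight.form, h, star_add, add_dotProduct]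
  smul_left x y c := by
    rw [← integral_const_mul]
    refine integral_congr_ae ?_
    filter_upwards [x.rep_smul c] with ξ h
    simp only [Weight.form, h, star_smul, smul_dotProduct, smul_eq_mul]
    rfl
  definite x h := by
    have h0 : ∀ᵐ ξ ∂halfLine, 0 ≤ (w.form x.rep x.rep ξ).re := by
      filter_upwards [ae_halfLine_pos] with ξ hξ
      exact (Complex.le_def.1 (w.form_self_nonneg x.rep hξ.le)).1
    have h1 : ∫ ξ, (w.form x.rep x.rep ξ).re ∂halfLine = 0 := by
      have := integral_re (𝕜 := ℂ) x.integrable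
      simp only [RCLike.re_to_complex] at this
      rw [this]
      have h' : ∫ ξ, w.form x.rep x.rep ξ ∂halfLine = 0 := h
      rw [h']; rfl
    have h2 := (integral_eq_zero_iff_of_nonneg_ae h0 x.integrable.re).1 h1
    refine L2W.ext_ae ?_
    filter_upwards [h2, ae_halfLine_pos, L2W.rep_zero w] with ξ h3 hξ h4
    rw [h4]
    by_contra hne
    have := (Complex.lt_def.1 ((w.posDef ξ hξ.le).dotProduct_mulVec_pos hne)).1
    exact this.ne' h3

instance (w : Weight n) : NormedAddCommGroup (L2W w) :=
  @InnerProductSpace.Core.toNormedAddCommGroup ℂ (L2W w) _ _ _ (innerCore w)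

instance (w : Weight n) : InnerProductSpace ℂ (L2W w) :=
  InnerProductSpace.ofCore (innerCore w).toCore

/-! ### Multiplication operators -/

/-- `x ↦ F x` is well defined as a map `L²_w → L²_v`. -/
def MulMapsInto (F : ℝ → Matrix (Fin n) (Fin n) ℂ) (w v : Weight n) : Prop :=
  ∀ x : L2W w, ∃ z : L2W v, z.rep =ᵐ[halfLine] fun ξ => F ξ *ᵥ x.rep ξ

/-- `x ↦ F x` is a bounded operator `L²_w → L²_v`. -/
def MulIsBounded (F : ℝ → Matrix (Fin n) (Fin n) ℂ) (w v : Weight n) : Prop :=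
  ∃ T : L2W w →L[ℂ] L2W v, ∀ x, (T x).rep =ᵐ[halfLine] fun ξ => F ξ *ᵥ x.rep ξ

/-- `x ↦ F x` is an isomorphism of Banach spaces `L²_w → L²_v`. -/
def MulIsIso (F : ℝ → Matrix (Fin n) (Fin n) ℂ) (w v : Weight n) : Prop :=
  ∃ T : L2W w ≃L[ℂ] L2W v, ∀ x, (T x).rep =ᵐ[halfLine] fun ξ => F ξ *ᵥ x.rep ξ

/-! ### Matrix functions -/

/-- Entrywise continuous differentiability on `[0,∞)`, one-sided at `0`. -/
def MatC1 {𝕜 : Type*} [NormedAddCommGroup 𝕜] [NormedSpace ℝ 𝕜]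
    (F : ℝ → Matrix (Fin n) (Fin n) 𝕜) : Prop :=
  ∀ i j, ContDiffOn ℝ 1 (fun ξ => F ξ i j) (Ici 0)

/-- Entrywise derivative on `[0,∞)`. -/
def matDeriv (F : ℝ → Matrix (Fin n) (Fin n) ℂ) (ξ : ℝ) : Matrix (Fin n) (Fin n) ℂ :=
  Matrix.of fun i j => derivWithin (fun ζ => F ζ i j) (Ici 0) ξ

/-- A real matrix regarded as a complex matrix. -/
abbrev cplx (M : Matrix (Fin n) (Fin n) ℝ) : Matrix (Fin n) (Fin n) ℂ :=
  M.map Complex.ofReal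

theorem cplx_posDef {M : Matrix (Fin n) (Fin n) ℝ} (hM : M.PosDef) : (cplx M).PosDef := by
  refine PosDef.of_dotProduct_mulVec_pos ?_ fun x hx => ?_
  · ext i j
    have h := congrFun (congrFun hM.isHermitian.eq i) j
    simp only [conjTranspose_apply, map_apply, star_trivial] at h ⊢
    rw [h]; simp
  · have hsym : ∀ i j, M j i = M i j := fun i j => by
      simpa using congrFun (congrFun hM.isHermitian.eq i) j
    set a : Fin n → ℝ := fun i => (x i).re with ha
    set b : Fin n → ℝ := fun i => (x i).im with hb
    have e : star x ⬝ᵥ (cplx M *ᵥ x) =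
        ((a ⬝ᵥ (M *ᵥ a) + b ⬝ᵥ (M *ᵥ b) : ℝ) : ℂ) := by
      have hx' : x = fun i => (a i : ℂ) + (b i : ℂ) * Complex.I := by
        funext i; simp [ha, hb, Complex.re_add_im]
      have hsw : ∑ i, ∑ j, (b i : ℂ) * ((M i j : ℂ) * (a j : ℂ)) =
          ∑ i, ∑ j, (a i : ℂ) * ((M i j : ℂ) * (b j : ℂ)) := by
        rw [Finset.sum_comm]
        refine Finset.sum_congr rfl fun i _ => Finset.sum_congr rfl fun j _ => ?_
        rw [hsym i j]; ring
      have hexp : star x ⬝ᵥ (cplx M *ᵥ x) =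
          (∑ i, ∑ j, (a i : ℂ) * ((M i j : ℂ) * (a j : ℂ))) +
          (∑ i, ∑ j, (b i : ℂ) * ((M i j : ℂ) * (b j : ℂ))) +
          Complex.I * ((∑ i, ∑ j, (a i : ℂ) * ((M i j : ℂ) * (b j : ℂ))) -
            ∑ i, ∑ j, (b i : ℂ) * ((M i j : ℂ) * (a j : ℂ))) := by
        rw [hx']
        simp only [dotProduct, mulVec, Pi.star_apply, map_apply, Finset.mul_sum,
          ← Finset.sum_add_distrib, ← Finset.sum_sub_distrib]
        refine Finset.sum_congr rfl fun i _ => Finset.sum_congr rfl fun j _ => ?_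
        simp only [star_add, star_mul', Complex.star_def, Complex.conj_ofReal, Complex.conj_I]
        linear_combination (-(b i : ℂ) * (M i j : ℂ) * (b j : ℂ)) * Complex.I_sq
      rw [hexp, hsw, sub_self, mul_zero, add_zero]
      simp only [dotProduct, mulVec, Finset.mul_sum]
      push_cast
      rfl
    rw [e]
    have hab : a ≠ 0 ∨ b ≠ 0 := by
      by_contra! hcon
      exact hx (funext fun i => Complex.ext (congrFun hcon.1 i) (congrFun hcon.2 i))
    have ha0 : 0 ≤ a ⬝ᵥ (M *ᵥ a) := by
      simpa using hM.posSemidef.dotProduct_mulVec_nonneg a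
    have hb0 : 0 ≤ b ⬝ᵥ (M *ᵥ b) := by
      simpa using hM.posSemidef.dotProduct_mulVec_nonneg b
    have : 0 < a ⬝ᵥ (M *ᵥ a) + b ⬝ᵥ (M *ᵥ b) := by
      rcases hab with h | h
      · have := hM.dotProduct_mulVec_pos h
        simp only [star_trivial] at this
        linarith
      · have := hM.dotProduct_mulVec_pos h
        simp only [star_trivial] at this
        linarith
    exact_mod_cast this

/-- The Hamiltonian as a weight. -/
def hamWeight (H : ℝ → Matrix (Fin n) (Fin n) ℝ) (hC : MatC1 H)
    (hpos : ∀ ξ, 0 ≤ ξ → (H ξ).PosDef) : Weight n where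
  toFun ξ := cplx (H ξ)
  continuousOn i j := Complex.continuous_ofReal.comp_continuousOn (hC i j).continuousOn
  posDef ξ hξ := cplx_posDef (hpos ξ hξ)

/-- `|D| = (D^⋆ D)^{1/2}` for a diagonal matrix `D`. -/
def absDiag (D : Matrix (Fin n) (Fin n) ℂ) : Matrix (Fin n) (Fin n) ℂ :=
  Matrix.diagonal fun i => ((‖D i i‖ : ℝ) : ℂ)

theorem absDiag_mul_self {D : Matrix (Fin n) (Fin n) ℂ} (hD : D.IsDiag) :
    absDiag D * absDiag D = Dᴴ * D := by
  obtain ⟨d, rfl⟩ : ∃ d, D = Matrix.diagonal d :=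
    ⟨_, ((isDiag_iff_diagonal_diag D).1 hD).symm⟩
  simp only [absDiag, diagonal_conjTranspose, diagonal_mul_diagonal, diagonal_apply_eq,
    Pi.star_apply]
  congr 1
  funext i
  rw [Complex.star_def, Complex.conj_mul']
  ring

/-- A diagonal matrix similar to `P₁ H`, with `P₁` invertible and `H` positive definite, has no
zero on its diagonal. -/
theorem diag_ne_zero {P₁ Δ S : Matrix (Fin n) (Fin n) ℂ} {H : Matrix (Fin n) (Fin n) ℝ}
    (hP₁ : IsUnit P₁) (hH : H.PosDef) (hΔ : Δ.IsDiag) (h : P₁ * cplx H = S⁻¹ * Δ * S)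
    (i : Fin n) : Δ i i ≠ 0 := by
  intro h0
  have h1 : IsUnit (P₁ * cplx H) := hP₁.mul (cplx_posDef hH).isUnit
  rw [h, isUnit_iff_isUnit_det, det_mul, det_mul] at h1
  have h2 : Δ.det = 0 := by
    rw [← (isDiag_iff_diagonal_diag Δ).1 hΔ, det_diagonal]
    exact Finset.prod_eq_zero (Finset.mem_univ i) h0
  simp [h2] at h1

/-- `|Δ|` as a weight. -/
def absWeight (Δ : ℝ → Matrix (Fin n) (Fin n) ℂ) (hC : MatC1 Δ)
    (hne : ∀ ξ, 0 ≤ ξ → ∀ i, Δ ξ i i ≠ 0) : Weight n where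
  toFun ξ := absDiag (Δ ξ)
  continuousOn i j := by
    by_cases hij : i = j
    · subst hij
      simp only [absDiag, diagonal_apply_eq]
      exact Complex.continuous_ofReal.comp_continuousOn (hC i i).continuousOn.norm
    · simp only [absDiag, diagonal_apply_ne _ hij]
      exact continuousOn_const
  posDef ξ hξ := by
    refine PosDef.diagonal fun i => ?_
    have := norm_pos_iff.2 (hne ξ hξ i)
    exact_mod_cast this

/-! ### Strongly continuous semigroups -/

/-- A strongly continuous one-parameter semigroup of bounded operators on `X`. -/
structure C0Semigroup (X : Type*) [NormedAddCommGroup X] [NormedSpace ℂ X] where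
  toFun : ℝ≥0 → X →L[ℂ] X
  map_zero : toFun 0 = ContinuousLinearMap.id ℂ X
  map_add : ∀ s t, toFun (s + t) = (toFun s).comp (toFun t)
  continuous : ∀ x, Continuous fun t => toFun t x

/-- `A` is the infinitesimal generator of `T`: `x ∈ D(A)` and `A x = z` exactly when
`(T(t)x - x)/t → z` as `t ↘ 0`. -/
def C0Semigroup.IsGenerator {X : Type*} [NormedAddCommGroup X] [NormedSpace ℂ X]
    (T : C0Semigroup X) (A : X →ₗ.[ℂ] X) : Prop :=
  ∀ x z : X, (x, z) ∈ A.graph ↔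
    Tendsto (fun t : ℝ≥0 => (((t : ℝ) : ℂ))⁻¹ • (T.toFun t x - x)) (𝓝[>] 0) (𝓝 z)

/-- `A` (with its exact domain) is the infinitesimal generator of some `C₀`-semigroup. -/
def GeneratesC0Semigroup {X : Type*} [NormedAddCommGroup X] [NormedSpace ℂ X]
    (A : X →ₗ.[ℂ] X) : Prop :=
  ∃ T : C0Semigroup X, T.IsGenerator A

/-! ### The port-Hamiltonian operator -/

/-- The function `y` is a locally absolutely continuous representative on `[0,∞)` of `W x`, and
`d` is its almost everywhere defined derivative `(W x)'`. -/
structure IsACRep {w : Weight n} (x : L2W w) (y d : ℝ → Fin n → ℂ) : Prop where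
  ac : ∀ b : ℝ, 0 ≤ b → AbsolutelyContinuousOnInterval y 0 b
  ae_eq : y =ᵐ[halfLine] fun ξ => w.toFun ξ *ᵥ x.rep ξ
  deriv : ∀ᵐ ξ ∂halfLine, HasDerivAt y (d ξ) ξ

theorem IsACRep.add {w : Weight n} {x x' : L2W w} {y d y' d' : ℝ → Fin n → ℂ}
    (h : IsACRep x y d) (h' : IsACRep x' y' d') : IsACRep (x + x') (y + y') (d + d') where
  ac b hb := (h.ac b hb).add (h'.ac b hb)
  ae_eq := by
    filter_upwards [h.ae_eq, h'.ae_eq, x.rep_add x'] with ξ h1 h2 h3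
    rw [Pi.add_apply, h1, h2, h3, mulVec_add]
  deriv := by
    filter_upwards [h.deriv, h'.deriv] with ξ h1 h2 using h1.add h2

theorem IsACRep.smul {w : Weight n} {x : L2W w} {y d : ℝ → Fin n → ℂ} (c : ℂ)
    (h : IsACRep x y d) : IsACRep (c • x) (c • y) (c • d) where
  ac b hb := by
    exact (h.ac b hb).const_smul c
  ae_eq := by
    filter_upwards [h.ae_eq, x.rep_smul c] with ξ h1 h2
    rw [Pi.smul_apply, h1, h2, mulVec_smul]
  deriv := by
    filter_upwards [h.deriv] with ξ h1 using h1.const_smul c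

theorem IsACRep.zero (w : Weight n) : IsACRep (0 : L2W w) 0 0 where
  ac b _ := by
    have : LipschitzOnWith 0 (0 : ℝ → Fin n → ℂ) (uIcc 0 b) :=
      (LipschitzWith.const (0 : Fin n → ℂ)).lipschitzOnWith
    exact this.absolutelyContinuousOnInterval
  ae_eq := by
    filter_upwards [L2W.rep_zero w] with ξ h
    simp [h]
  deriv := Eventually.of_forall fun ξ => hasDerivAt_const ξ (0 : Fin n → ℂ)

theorem IsACRep.deriv_eq_zero {w : Weight n} {y d : ℝ → Fin n → ℂ}
    (h : IsACRep (0 : L2W w) y d) : d =ᵐ[halfLine] 0 := by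
  have hc : ContinuousOn y (Ioi 0) := by
    intro ξ hξ
    have hξ' : (0 : ℝ) < ξ := hξ
    have h1 := (h.ac (ξ + 1) (by linarith)).continuousOn
    rw [uIcc_of_le (by linarith)] at h1
    exact (h1.continuousAt (Icc_mem_nhds hξ' (by linarith))).continuousWithinAt
  have h0 : y =ᵐ[halfLine] fun _ => 0 := by
    filter_upwards [h.ae_eq, L2W.rep_zero w] with ξ h1 h2
    rw [h1, h2, mulVec_zero]
  have h2 : EqOn y (fun _ => 0) (Ioi 0) :=
    Measure.eqOn_open_of_ae_eq h0 isOpen_Ioi hc continuousOn_const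
  filter_upwards [h.deriv, ae_halfLine_pos] with ξ h3 hξ
  have h4 : HasDerivAt y 0 ξ :=
    (hasDerivAt_const ξ (0 : Fin n → ℂ)).congr_of_eventuallyEq
      (h2.eventuallyEq_of_mem (Ioi_mem_nhds hξ))
  exact h3.unique h4

/-- The graph of `x ↦ P₁ (W x)' + P₀ W x` in `L²_W × L²_W` on the maximal domain, subject to the
boundary condition `W_B (W x)(0) = 0`. -/
def phGraph {m : ℕ} (w : Weight n) (P₁ P₀ : Matrix (Fin n) (Fin n) ℂ)
    (WB : Matrix (Fin m) (Fin n) ℂ) : Submodule ℂ (L2W w × L2W w) where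
  carrier := {p | ∃ y d : ℝ → Fin n → ℂ, IsACRep p.1 y d ∧ WB *ᵥ y 0 = 0 ∧
    p.2.rep =ᵐ[halfLine] fun ξ => P₁ *ᵥ d ξ + P₀ *ᵥ (w.toFun ξ *ᵥ p.1.rep ξ)}
  add_mem' := by
    rintro p q ⟨y, d, h, hb, he⟩ ⟨y', d', h', hb', he'⟩
    refine ⟨y + y', d + d', h.add h', by simp [mulVec_add, hb, hb'], ?_⟩
    filter_upwards [he, he', p.1.rep_add q.1, p.2.rep_add q.2] with ξ h1 h2 h3 h4
    rw [Prod.snd_add, Prod.fst_add, h4, h3, h1, h2]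
    simp only [Pi.add_apply, mulVec_add]
    abel
  zero_mem' := by
    refine ⟨0, 0, IsACRep.zero w, by simp, ?_⟩
    filter_upwards [L2W.rep_zero w] with ξ h
    simp [h]
  smul_mem' := by
    rintro c p ⟨y, d, h, hb, he⟩
    refine ⟨c • y, c • d, h.smul c, by simp [mulVec_smul, hb], ?_⟩
    filter_upwards [he, p.1.rep_smul c, p.2.rep_smul c] with ξ h1 h2 h3
    rw [Prod.smul_snd, Prod.smul_fst, h3, h2, h1]
    simp only [Pi.smul_apply, mulVec_smul, smul_add]

/-- The operator `A x = P₁ (W x)' + P₀ W x` in `L²_W(0,∞)`. Its domain consists of all `x` in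
`L²_W(0,∞)` such that `W x` is locally absolutely continuous on `[0,∞)`, the function
`P₁ (W x)' + P₀ W x` belongs to `L²_W(0,∞)`, and `W_B (W x)(0) = 0`. -/
def phOp {m : ℕ} (w : Weight n) (P₁ P₀ : Matrix (Fin n) (Fin n) ℂ)
    (WB : Matrix (Fin m) (Fin n) ℂ) : L2W w →ₗ.[ℂ] L2W w :=
  (phGraph w P₁ P₀ WB).toLinearPMap

/-- The defining graph is single valued, so it is the graph of the operator. -/
theorem phOp_graph {m : ℕ} (w : Weight n) (P₁ P₀ : Matrix (Fin n) (Fin n) ℂ)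
    (WB : Matrix (Fin m) (Fin n) ℂ) : (phOp w P₁ P₀ WB).graph = phGraph w P₁ P₀ WB := by
  refine Submodule.toLinearPMap_graph_eq _ ?_
  rintro ⟨x, z⟩ ⟨y, d, h, -, he⟩ hx
  change x = 0 at hx
  subst hx
  refine L2W.ext_ae ?_
  filter_upwards [he, h.deriv_eq_zero, L2W.rep_zero w] with ξ h1 h2 h3
  change z.rep ξ = P₁ *ᵥ d ξ + P₀ *ᵥ (w.toFun ξ *ᵥ (0 : L2W w).rep ξ) at h1
  rw [h1, h2, h3]
  simp

/-- The `x` in `L²_W(0,∞)` such that `W x` is locally absolutely continuous on `[0,∞)`,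
`(W x)'` belongs to `L²_W(0,∞)`, and `W_B (W x)(0) = 0`. -/
def derivDomain {m : ℕ} (w : Weight n) (WB : Matrix (Fin m) (Fin n) ℂ) :
    Submodule ℂ (L2W w) where
  carrier := {x | ∃ (y d : ℝ → Fin n → ℂ) (z : L2W w), IsACRep x y d ∧ WB *ᵥ y 0 = 0 ∧
    z.rep =ᵐ[halfLine] d}
  add_mem' := by
    rintro x x' ⟨y, d, z, h, hb, he⟩ ⟨y', d', z', h', hb', he'⟩
    refine ⟨y + y', d + d', z + z', h.add h', by simp [mulVec_add, hb, hb'], ?_⟩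
    filter_upwards [he, he', z.rep_add z'] with ξ h1 h2 h3
    rw [h3, h1, h2, Pi.add_apply]
  zero_mem' := ⟨0, 0, 0, IsACRep.zero w, by simp, L2W.rep_zero w⟩
  smul_mem' := by
    rintro c x ⟨y, d, z, h, hb, he⟩
    refine ⟨c • y, c • d, c • z, h.smul c, by simp [mulVec_smul, hb], ?_⟩
    filter_upwards [he, z.rep_smul c] with ξ h1 h2
    rw [h2, h1, Pi.smul_apply]

/-! ### Spectral data -/

/-- The span of the eigenvectors of `M` belonging to negative eigenvalues. -/
def negEigenspan (M : Matrix (Fin n) (Fin n) ℂ) : Submodule ℂ (Fin n → ℂ) :=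
  Submodule.span ℂ {v | ∃ r : ℝ, r < 0 ∧ Module.End.HasEigenvector (Matrix.toLin' M) (r : ℂ) v}

end PortHam

end

noncomputable section

namespace PortHam

/-! ### Semigroups and generators -/

section Semigroup

variable {X : Type*} [NormedAddCommGroup X] [NormedSpace ℂ X]

/-! The substitution g = S x diagonalizes the principal part. Since P₁ H = S⁻¹ Δ S, the product rule
gives S P₁ (H x)' = (Δ g)' + S (S⁻¹)' Δ g. Up to the isomorphism (b) and the bounded perturbations S
(S⁻¹)' Δ and S P₀ H S⁻¹, the operator is therefore the system of decoupled transport operators g ↦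
(Δ g)'. The diagonal entries of Δ are eigenvalues of P₁ H, hence real; being continuous and nonzero,
they keep their signs. The boundary condition becomes N (Δ g)(0) = 0 with N = W_B P₁⁻¹ S(0)⁻¹, and
U₂ differs from the block N₂ of negative columns of N by an invertible diagonal factor.

Sufficiency. In the weight κ|Δ|, with a constant κ for each coordinate, the real part of ⟨g, (Δ g)'⟩
is a boundary term at 0 (`energy_identity`); nothing is left at infinity because Δ is bounded. If N₂
is invertible, the kernel of N is a graph over the positive coordinates, and a suitable κ makes the
boundary term dissipative. In the resolvent equation with compactly supported right side, square
integrability is obtained by forcing the positive components at 0, while the negative ones remain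
free; invertibility of N₂ lets the boundary condition determine them (`exists_solution`,
`diag_surjective`). A bounded perturbation of such a maximal dissipative operator generates
(`exists_semigroup_of_dissipative`), by the Hille-Yosida construction.

Necessity. A nonzero vector in the kernel of N₂ yields, for every l > 0, an eigenvector of the
unperturbed diagonal model. For the full operator it is an approximate eigenvector with an error
bounded independently of l, which `C0Semigroup.lower_bound` excludes for large l.

Condition 3 is the same statement as condition 2, since the negative columns of S(0)⁻¹ span the
negative eigenvectors. For the domain prescribed by (H x)', the closed graph theorem and tests with
short tent functions show that the constant matrix P₁ multiplies L²_H boundedly. Constant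
multipliers form a finite-dimensional algebra, so P₁⁻¹ is one as well, and the two domains coincide
(`domain_eq_derivDomain`). -/

theorem C0Semigroup.exists_bound [CompleteSpace X] (T : C0Semigroup X) :
    ∃ M : ℝ, 1 ≤ M ∧ ∀ t ≤ 1, ‖T.toFun t‖ ≤ M := by
  have h : ∀ x : X, ∃ C, ∀ t : Icc (0 : ℝ≥0) 1, ‖T.toFun t x‖ ≤ C := by
    intro x
    obtain ⟨C, hC⟩ := (isCompact_Icc (a := (0 : ℝ≥0)) (b := 1)).exists_bound_of_continuousOn
      (T.continuous x).continuousOn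
    exact ⟨C, fun t => hC t t.2⟩
  obtain ⟨M, hM⟩ := banach_steinhaus h
  exact ⟨max M 1, le_max_right _ _, fun t ht => (hM ⟨t, zero_le, ht⟩).trans (le_max_left _ _)⟩

theorem tendsto_toNNReal_sub (s : ℝ) :
    Tendsto (fun r : ℝ => (r - s).toNNReal) (𝓝[>] s) (𝓝[>] 0) := by
  refine tendsto_nhdsWithin_iff.2 ⟨?_, ?_⟩
  · have : Continuous fun r : ℝ => (r - s).toNNReal := by fun_prop
    have h := this.tendsto s
    simp only [sub_self, Real.toNNReal_zero] at h
    exact h.mono_left nhdsWithin_le_nhds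
  · filter_upwards [self_mem_nhdsWithin] with r hr
    exact Real.toNNReal_pos.2 (sub_pos.2 hr)

/-- For r > s one has T(r) x - T(s) x = T(s) (T(r - s) x - x), so the right difference quotient at s
is T(s) applied to the one at 0. One-sided derivatives are all that the mean value inequality needs.
-/
theorem C0Semigroup.hasDerivWithinAt (T : C0Semigroup X) {x z : X}
    (h : Tendsto (fun t : ℝ≥0 => (((t : ℝ) : ℂ))⁻¹ • (T.toFun t x - x)) (𝓝[>] 0) (𝓝 z))
    {s : ℝ} (hs : 0 ≤ s) :
    HasDerivWithinAt (fun r : ℝ => T.toFun r.toNNReal x) (T.toFun s.toNNReal z) (Ici s) s := by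
  rw [← hasDerivWithinAt_Ioi_iff_Ici, hasDerivWithinAt_iff_tendsto_slope' (by simp)]
  have h1 := ((T.toFun s.toNNReal).continuous.tendsto z).comp (h.comp (tendsto_toNNReal_sub s))
  refine h1.congr' ?_
  filter_upwards [self_mem_nhdsWithin] with r hr
  have hr' : s < r := hr
  have e : r.toNNReal = s.toNNReal + (r - s).toNNReal := by
    rw [← Real.toNNReal_add hs (by linarith)]; congr 1; ring
  simp only [Function.comp_apply, slope, vsub_eq_sub]
  rw [e, T.map_add, map_smul, map_sub, Real.coe_toNNReal _ (by linarith), ← Complex.ofReal_inv]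
  rfl

/-- A lower bound for `λ - A` where `A` is a generator and `λ > 0` is large. -/
theorem C0Semigroup.lower_bound (T : C0Semigroup X) {M : ℝ} (hM : ∀ t ≤ 1, ‖T.toFun t‖ ≤ M)
    {x z : X}
    (h : Tendsto (fun t : ℝ≥0 => (((t : ℝ) : ℂ))⁻¹ • (T.toFun t x - x)) (𝓝[>] 0) (𝓝 z))
    {l : ℝ} (hl : 0 < l) :
    ‖x‖ * (1 - M * Real.exp (-l)) ≤ M / l * ‖(l : ℂ) • x - z‖ := by
  have hM0 : 0 ≤ M := (norm_nonneg _).trans (hM 0 zero_le_one)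
  set K := ‖(l : ℂ) • x - z‖
  have hc : Continuous fun r : ℝ => x - Real.exp (-l * r) • T.toFun r.toNNReal x := by
    have := T.continuous x
    fun_prop
  -- The curve x - e^{-lr} T(r) x starts at 0 and has right derivative e^{-lr} T(r) (l x - z).
  -- Integrating only over [0, 1] makes the local bound M sufficient; no exponential growth bound is
  -- required.
  have key := image_norm_le_of_norm_deriv_right_le_deriv_boundary
    (f := fun r : ℝ => x - Real.exp (-l * r) • T.toFun r.toNNReal x)
    (f' := fun r => Real.exp (-l * r) • T.toFun r.toNNReal ((l : ℂ) • x - z))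
    (a := 0) (b := 1) (B := fun r => M / l * K * (1 - Real.exp (-l * r)))
    (B' := fun r => M * K * Real.exp (-l * r))
    hc.continuousOn ?_ ?_ ?_ ?_ (right_mem_Icc.2 zero_le_one)
  · simp only [mul_one, Real.toNNReal_one] at key
    have h1 : ‖x‖ - Real.exp (-l) * (M * ‖x‖) ≤ ‖x - Real.exp (-l) • T.toFun 1 x‖ := by
      have h2 := norm_sub_norm_le x (Real.exp (-l) • T.toFun 1 x)
      rw [norm_smul, Real.norm_eq_abs, abs_of_pos (Real.exp_pos _)] at h2
      have h3 : ‖T.toFun 1 x‖ ≤ M * ‖x‖ :=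
        (T.toFun 1).le_of_opNorm_le (hM 1 le_rfl) x
      nlinarith [Real.exp_pos (-l)]
    have h4 : M / l * K * (1 - Real.exp (-l)) ≤ M / l * K :=
      mul_le_of_le_one_right (by positivity) (by linarith [Real.exp_pos (-l)])
    linarith
  · intro s hs
    have h1 := T.hasDerivWithinAt h hs.1
    have h2 : HasDerivWithinAt (fun r : ℝ => Real.exp (-l * r)) (Real.exp (-l * s) * (-l))
        (Ici s) s := by
      have := ((hasDerivAt_id s).const_mul (-l)).exp
      simpa using this.hasDerivWithinAt
    have h3 := (h2.fun_smul h1).const_sub x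
    refine h3.congr_deriv ?_
    rw [map_sub, map_smul, mul_smul, Complex.coe_smul]
    module
  · simp [T.map_zero]
  · intro s
    have := ((hasDerivAt_id s).const_mul (-l)).exp
    have h2 : HasDerivAt (fun r : ℝ => Real.exp (-l * r)) (Real.exp (-l * s) * (-l)) s := by
      simpa using this
    refine ((h2.const_sub 1).const_mul (M / l * K)).congr_deriv ?_
    field_simp
  · intro s hs
    rw [norm_smul, Real.norm_eq_abs, abs_of_pos (Real.exp_pos _), mul_comm]
    refine mul_le_mul_of_nonneg_right ?_ (Real.exp_pos _).le
    refine (T.toFun _).le_of_opNorm_le (hM _ ?_) _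
    exact Real.toNNReal_le_one.2 hs.2.le

end Semigroup

/-! ### Exponentials of the Yosida approximations -/

section Yosida

variable {X : Type*} [NormedAddCommGroup X] [NormedSpace ℂ X]

/-- The Yosida approximation built from the resolvent at `l`. -/
def yosida (R : ℝ → X →L[ℂ] X) (l : ℝ) : X →L[ℂ] X := (l ^ 2) • R l - l • 1

/-- The semigroup generated by the Yosida approximation. -/
def yosidaExp (R : ℝ → X →L[ℂ] X) (l t : ℝ) : X →L[ℂ] X :=
  -- The scalar part -l of the approximation is split off, so that its decay can be set against the
  -- growth of the second factor in the norm estimate.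
  Real.exp (-l * t) • NormedSpace.exp (t • ((l ^ 2) • R l))

theorem yosidaExp_zero (R : ℝ → X →L[ℂ] X) (l : ℝ) : yosidaExp R l 0 = 1 := by
  simp [yosidaExp, NormedSpace.exp_zero]

variable [CompleteSpace X]

theorem yosidaExp_add (R : ℝ → X →L[ℂ] X) (l s t : ℝ) :
    yosidaExp R l (s + t) = yosidaExp R l s * yosidaExp R l t := by
  let _ : NormedAlgebra ℚ (X →L[ℂ] X) := NormedAlgebra.restrictScalars ℚ ℝ _
  unfold yosidaExp
  rw [add_smul, NormedSpace.exp_add_of_commute, mul_add, Real.exp_add, smul_mul_smul_comm]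
  exact ((Commute.refl _).smul_left s).smul_right t

theorem hasDerivAt_yosidaExp (R : ℝ → X →L[ℂ] X) (l t : ℝ) :
    HasDerivAt (yosidaExp R l) (yosidaExp R l t * yosida R l) t := by
  have h1 : HasDerivAt (fun r : ℝ => Real.exp (-l * r)) (Real.exp (-l * t) * (-l)) t := by
    have := ((hasDerivAt_id t).const_mul (-l)).exp
    simpa using this
  have h2 := h1.fun_smul (hasDerivAt_exp_smul_const ((l ^ 2) • R l) t)
  refine h2.congr_deriv ?_
  unfold yosidaExp yosida
  rw [smul_mul_assoc, mul_sub, smul_sub, mul_smul_comm l, mul_one, mul_smul]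
  module

theorem hasDerivAt_yosidaExp_apply (R : ℝ → X →L[ℂ] X) (l t : ℝ) (x : X) :
    HasDerivAt (fun s => yosidaExp R l s x) (yosidaExp R l t (yosida R l x)) t :=
  ((ContinuousLinearMap.apply ℂ X x).restrictScalars ℝ).hasFDerivAt.comp_hasDerivAt t
    (hasDerivAt_yosidaExp R l t)

/-- The curve u(s) = exp(s B) x solves u' = B u with u(0) = x, so Gronwall's inequality applies. -/
theorem norm_exp_smul_apply_le (B : X →L[ℂ] X) {t : ℝ} (ht : 0 ≤ t) (x : X) :
    ‖NormedSpace.exp (t • B) x‖ ≤ ‖x‖ * Real.exp (‖B‖ * t) := by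
  have hd : ∀ s : ℝ, HasDerivAt (fun s : ℝ => NormedSpace.exp (s • B) x)
      (B (NormedSpace.exp (s • B) x)) s := fun s =>
    ((ContinuousLinearMap.apply ℂ X x).restrictScalars ℝ).hasFDerivAt.comp_hasDerivAt s
      (hasDerivAt_exp_smul_const' B s)
  have := norm_le_gronwallBound_of_norm_deriv_right_le (δ := ‖x‖) (K := ‖B‖) (ε := 0)
    (a := 0) (b := t) (f := fun s : ℝ => NormedSpace.exp (s • B) x)
    (fun s _ => (hd s).continuousAt.continuousWithinAt)
    (fun s _ => (hd s).hasDerivWithinAt) (by simp [NormedSpace.exp_zero])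
    (fun s _ => by simpa using B.le_opNorm _) t (right_mem_Icc.2 ht)
  simpa [gronwallBound_ε0] using this

/-- For l ≥ 2 w one has l² / (l - w) ≤ l + 2 w, and the factor e^{-lt} cancels the part of the
exponent that grows with l. What remains is uniform in l. -/
theorem norm_yosidaExp_apply_le {R : ℝ → X →L[ℂ] X} {w l : ℝ} (hw : 0 ≤ w) (hl : 0 < l)
    (hlw : 2 * w ≤ l) (hR : ‖R l‖ ≤ (l - w)⁻¹) {t : ℝ} (ht : 0 ≤ t) (x : X) :
    ‖yosidaExp R l t x‖ ≤ Real.exp (2 * w * t) * ‖x‖ := by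
  have h1 := norm_exp_smul_apply_le ((l ^ 2) • R l) ht x
  have h2 : ‖(l ^ 2) • R l‖ ≤ l ^ 2 * (l - w)⁻¹ := by
    rw [norm_smul, Real.norm_eq_abs, abs_of_nonneg (by positivity)]
    gcongr
  have h3 : l ^ 2 * (l - w)⁻¹ ≤ l + 2 * w := by
    rw [← div_eq_mul_inv, div_le_iff₀ (by linarith)]
    nlinarith
  unfold yosidaExp
  rw [_root_.smul_apply, norm_smul, Real.norm_eq_abs, abs_of_pos (Real.exp_pos _)]
  calc _ ≤ Real.exp (-l * t) * (‖x‖ * Real.exp ((l + 2 * w) * t)) := by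
        gcongr
        exact h1.trans (by gcongr; exact h2.trans h3)
    _ = Real.exp (2 * w * t) * ‖x‖ := by
        rw [mul_left_comm, ← Real.exp_add, mul_comm]; congr 2; ring

end Yosida

/-! ### The Hille-Yosida theorem -/

section HilleYosida

variable {X : Type*} [NormedAddCommGroup X] [NormedSpace ℂ X]

theorem tendsto_zero_of_dense {ι : Type*} {f : Filter ι} {F : ι → X →L[ℂ] X} {C : ℝ}
    (hC : ∀ᶠ i in f, ∀ x, ‖F i x‖ ≤ C * ‖x‖) {D : Set X} (hD : Dense D)
    (h : ∀ x ∈ D, Tendsto (fun i => F i x) f (𝓝 0)) (x : X) :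
    Tendsto (fun i => F i x) f (𝓝 0) := by
  rw [Metric.tendsto_nhds]
  intro ε hε
  obtain ⟨y, hy, hyx⟩ := Metric.mem_closure_iff.1 (hD x) (ε / (2 * (|C| + 1))) (by positivity)
  have h1 := Metric.tendsto_nhds.1 (h y hy) (ε / 2) (by positivity)
  filter_upwards [hC, h1] with i hi1 hi2
  rw [dist_zero_right] at hi2 ⊢
  have h2 : F i x = F i (x - y) + F i y := by rw [← map_add, sub_add_cancel]
  have h3 : ‖F i (x - y)‖ ≤ ε / 2 := by
    refine (hi1 _).trans ?_
    rw [← dist_eq_norm]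
    calc C * dist x y ≤ (|C| + 1) * (ε / (2 * (|C| + 1))) := by
          gcongr
          linarith [le_abs_self C]
      _ = ε / 2 := by field_simp
  rw [h2]
  linarith [norm_add_le (F i (x - y)) (F i y)]

/-- `R l` inverts `l - A` for all `l > w`, where `Γ` is the graph of `A`, and it satisfies the
Hille-Yosida estimate. -/
structure IsResolventFamily (Γ : Set (X × X)) (w : ℝ) (R : ℝ → X →L[ℂ] X) : Prop where
  norm_le : ∀ l, w < l → ‖R l‖ ≤ (l - w)⁻¹
  -- Both inverse relations are encoded at once: the forward direction is R l (l - A) x = x, and the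
  -- backward direction at x = R l f, z = l R l f - f says that R l f lies in the domain with (l -
  -- A) R l f = f.
  mem_iff : ∀ l, w < l → ∀ x z, (x, z) ∈ Γ ↔ R l ((l : ℂ) • x - z) = x

variable {Γ : Set (X × X)} {w : ℝ} {R : ℝ → X →L[ℂ] X}

/-- The resolvent equation: R m f lies in the domain, and (l - A) R m f = f + (l - m) R m f, to
which R l is applied. -/
theorem IsResolventFamily.identity (h : IsResolventFamily Γ w R) {l m : ℝ} (hl : w < l)
    (hm : w < m) (f : X) : R m f = R l f + ((l : ℂ) - m) • R l (R m f) := by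
  have h1 : (R m f, (m : ℂ) • R m f - f) ∈ Γ := by
    rw [h.mem_iff m hm, sub_sub_cancel]
  rw [h.mem_iff l hl] at h1
  nth_rw 1 [← h1]
  rw [← map_smul (R l), ← map_add (R l)]
  congr 1
  module

/-- The resolvent equation and its version with l and m exchanged express both products, multiplied
by l - m, as the same difference R m - R l. -/
theorem IsResolventFamily.commute (h : IsResolventFamily Γ w R) {l m : ℝ} (hl : w < l)
    (hm : w < m) : Commute (R l) (R m) := by
  rcases eq_or_ne l m with rfl | hlm
  · exact Commute.refl _
  ext f
  have h1 := h.identity hl hm f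
  have h2 := h.identity hm hl f
  have h3 : ((l : ℂ) - m) ≠ 0 := by
    rw [sub_ne_zero]; exact_mod_cast hlm
  refine smul_right_injective X h3 ?_
  change ((l : ℂ) - m) • R l (R m f) = ((l : ℂ) - m) • R m (R l f)
  have h4 : ((l : ℂ) - m) • R l (R m f) = R m f - R l f := by rw [eq_sub_iff_add_eq', ← h1]
  have h5 : ((m : ℂ) - l) • R m (R l f) = R l f - R m f := by rw [eq_sub_iff_add_eq', ← h2]
  rw [h4, ← neg_sub (m : ℂ), neg_smul, h5, neg_sub]

/-- On the domain the approximation becomes l R l A, whose convergence to A is then a matter of l R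
l tending strongly to the identity. -/
theorem IsResolventFamily.yosida_apply (h : IsResolventFamily Γ w R) {l : ℝ} (hl : w < l)
    {x z : X} (hxz : (x, z) ∈ Γ) : yosida R l x = (l : ℂ) • R l z := by
  have h1 := (h.mem_iff l hl x z).1 hxz
  have h2 : (l : ℂ) • R l x - R l z = x := by rw [← map_smul, ← map_sub, h1]
  have h3 : R l z = (l : ℂ) • R l x - x := eq_sub_of_add_eq (sub_eq_iff_eq_add'.1 h2).symm
  unfold yosida
  rw [h3, _root_.sub_apply, _root_.smul_apply, _root_.smul_apply, one_apply_eq_self,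
    Complex.coe_smul, Complex.coe_smul]
  module

theorem eventually_bounds (w : ℝ) : ∀ᶠ l : ℝ in atTop, 0 < l ∧ 2 * w ≤ l ∧ w < l := by
  filter_upwards [eventually_gt_atTop 0, eventually_ge_atTop (2 * w), eventually_gt_atTop w]
    with l h1 h2 h3 using ⟨h1, h2, h3⟩

/-- On the domain l R l x - x = R l (A x), which is at most ‖A x‖ / (l - w). Elsewhere density
suffices, because ‖l R l‖ ≤ l / (l - w) ≤ 2 for l ≥ 2 w; subtracting the identity gives the uniform
constant 3. -/
theorem IsResolventFamily.tendsto_smul (h : IsResolventFamily Γ w R)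
    (hD : Dense {x | ∃ z, (x, z) ∈ Γ}) (z : X) :
    Tendsto (fun l : ℝ => (l : ℂ) • R l z) atTop (𝓝 z) := by
  have key := tendsto_zero_of_dense (f := atTop) (C := 3)
    (F := fun l : ℝ => (l : ℂ) • R l - 1) ?_ hD ?_ z
  · have := key.add_const z
    simpa using this
  · filter_upwards [eventually_bounds w] with l ⟨h0, h2, h3⟩ x
    rw [_root_.sub_apply, _root_.smul_apply, one_apply_eq_self]
    refine (norm_sub_le _ _).trans ?_
    rw [norm_smul, Complex.norm_real, Real.norm_eq_abs, abs_of_pos h0]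
    have h4 := (R l).le_of_opNorm_le (h.norm_le l h3) x
    have h5 : l * (l - w)⁻¹ ≤ 2 := by
      rw [← div_eq_mul_inv, div_le_iff₀ (by linarith)]; linarith
    nlinarith [norm_nonneg x, mul_le_mul_of_nonneg_left h4 h0.le,
      mul_le_mul_of_nonneg_right h5 (norm_nonneg x)]
  · rintro x ⟨z', hz'⟩
    have h1 : Tendsto (fun l : ℝ => (l - w)⁻¹ * ‖z'‖) atTop (𝓝 0) := by
      have : Tendsto (fun l : ℝ => (l - w)⁻¹) atTop (𝓝 0) :=
        tendsto_inv_atTop_zero.comp (tendsto_atTop_add_const_right _ _ tendsto_id)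
      simpa using this.mul_const ‖z'‖
    refine squeeze_zero_norm' ?_ h1
    filter_upwards [eventually_gt_atTop w] with l hl
    have h2 := (h.mem_iff l hl x z').1 hz'
    have h3 : (l : ℂ) • R l x - x = R l z' := by
      rw [map_sub, map_smul] at h2
      nth_rw 2 [← h2]
      abel
    rw [_root_.sub_apply, _root_.smul_apply, one_apply_eq_self, h3]
    exact (R l).le_of_opNorm_le (h.norm_le l hl) z'

variable [CompleteSpace X]

theorem IsResolventFamily.yosidaExp_bound (h : IsResolventFamily Γ w R) (hw : 0 ≤ w) {l : ℝ}
    (hl : 0 < l ∧ 2 * w ≤ l ∧ w < l) {t : ℝ} (ht : 0 ≤ t) (x : X) :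
    ‖yosidaExp R l t x‖ ≤ Real.exp (2 * w * t) * ‖x‖ :=
  norm_yosidaExp_apply_le hw hl.1 hl.2.1 (h.norm_le l hl.2.2) ht x

/-- Duhamel's formula. The curve s ↦ e^{(t-s)A_m} e^{sA_l} x joins the two orbits; as everything
commutes, its derivative is the same product of exponentials applied to A_l x - A_m x, and the two
growth factors combine to e^{2wt} for every s. -/
theorem IsResolventFamily.norm_sub_le (h : IsResolventFamily Γ w R) (hw : 0 ≤ w) {l m : ℝ}
    (hl : 0 < l ∧ 2 * w ≤ l ∧ w < l) (hm : 0 < m ∧ 2 * w ≤ m ∧ w < m) {t : ℝ} (ht : 0 ≤ t)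
    (x : X) : ‖yosidaExp R l t x - yosidaExp R m t x‖ ≤
      Real.exp (2 * w * t) * ‖yosida R l x - yosida R m x‖ * t := by
  have hcomm : ∀ s, Commute (yosida R m) (yosidaExp R l s) := by
    intro s
    have h1 := h.commute hm.2.2 hl.2.2
    have h2 : Commute (R m) (yosidaExp R l s) :=
      ((((h1.smul_right _).smul_right _).exp_right).smul_right _)
    exact (h2.smul_left _).sub_left ((Commute.one_left _).smul_left _)
  have hd : ∀ s : ℝ, HasDerivAt (fun s => yosidaExp R m (t - s) (yosidaExp R l s x))
      (yosidaExp R m (t - s) (yosidaExp R l s (yosida R l x - yosida R m x))) s := by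
    intro s
    have h1 := (hasDerivAt_yosidaExp R m (t - s)).scomp s ((hasDerivAt_id s).const_sub t)
    have h2 := h1.mul (hasDerivAt_yosidaExp R l s)
    have h3 := ((ContinuousLinearMap.apply ℂ X x).restrictScalars ℝ).hasFDerivAt.comp_hasDerivAt s
      h2
    refine h3.congr_deriv ?_
    simp only [neg_smul, one_smul, Function.comp_apply, neg_mul]
    rw [mul_assoc, (hcomm s).eq]
    simp only [ContinuousLinearMap.coe_restrictScalars', ContinuousLinearMap.apply_apply,
      _root_.add_apply, _root_.neg_apply, mul_apply_eq_comp, map_sub]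
    abel
  have key := norm_image_sub_le_of_norm_deriv_le_segment' (a := 0) (b := t)
    (f := fun s => yosidaExp R m (t - s) (yosidaExp R l s x))
    (C := Real.exp (2 * w * t) * ‖yosida R l x - yosida R m x‖)
    (fun s _ => (hd s).hasDerivWithinAt) ?_ t (right_mem_Icc.2 ht)
  · simpa [yosidaExp_zero] using key
  · intro s hs
    refine (h.yosidaExp_bound hw hm (sub_nonneg.2 hs.2.le) _).trans ?_
    refine (mul_le_mul_of_nonneg_left (h.yosidaExp_bound hw hl hs.1 _) (Real.exp_pos _).le).trans ?_
    rw [← mul_assoc, ← Real.exp_add]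
    apply le_of_eq
    congr 2
    ring

/-- The net is Cauchy on the domain, where the Duhamel estimate is governed by the convergent l R l
z, and the uniform bound extends this to the closure. -/
theorem IsResolventFamily.exists_tendsto (h : IsResolventFamily Γ w R) (hw : 0 ≤ w)
    (hD : Dense {x | ∃ z, (x, z) ∈ Γ}) {t : ℝ} (ht : 0 ≤ t) (x : X) :
    ∃ y, Tendsto (fun l => yosidaExp R l t x) atTop (𝓝 y) := by
  suffices hC : Cauchy (map (fun l => yosidaExp R l t x) atTop) from CompleteSpace.complete hC
  rw [cauchy_map_iff]
  refine ⟨inferInstance, ?_⟩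
  rw [uniformity_eq_comap_nhds_zero, tendsto_comap_iff]
  have hev : ∀ᶠ p : ℝ × ℝ in atTop ×ˢ atTop, (0 < p.1 ∧ 2 * w ≤ p.1 ∧ w < p.1) ∧
      (0 < p.2 ∧ 2 * w ≤ p.2 ∧ w < p.2) :=
    (eventually_bounds w).prod_mk (eventually_bounds w)
  refine tendsto_zero_of_dense (f := atTop ×ˢ atTop) (C := 2 * Real.exp (2 * w * t))
    (F := fun p : ℝ × ℝ => yosidaExp R p.2 t - yosidaExp R p.1 t) ?_ hD ?_ x
  · filter_upwards [hev] with p ⟨h1, h2⟩ y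
    refine (_root_.norm_sub_le (yosidaExp R p.2 t y) (yosidaExp R p.1 t y)).trans ?_
    linarith [h.yosidaExp_bound hw h1 ht y, h.yosidaExp_bound hw h2 ht y]
  · rintro y ⟨z, hz⟩
    have h1 := h.tendsto_smul hD z
    have h2 : Tendsto (fun p : ℝ × ℝ => Real.exp (2 * w * t) *
        ‖(p.2 : ℂ) • R p.2 z - (p.1 : ℂ) • R p.1 z‖ * t) (atTop ×ˢ atTop) (𝓝 0) := by
      have h3 := (h1.comp tendsto_snd).sub (h1.comp (tendsto_fst (f := atTop) (g := atTop)))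
      have h4 := (h3.norm.const_mul (Real.exp (2 * w * t))).mul_const t
      simpa using h4
    refine squeeze_zero_norm' ?_ h2
    filter_upwards [hev] with p ⟨hp1, hp2⟩
    have := h.norm_sub_le hw hp2 hp1 ht y
    rwa [h.yosida_apply hp1.2.2 hz, h.yosida_apply hp2.2.2 hz] at this

/-- The limit of the Yosida semigroups. -/
theorem IsResolventFamily.exists_limit (h : IsResolventFamily Γ w R) (hw : 0 ≤ w)
    (hD : Dense {x | ∃ z, (x, z) ∈ Γ}) :
    ∃ S : ℝ≥0 → X →L[ℂ] X, ∀ (t : ℝ≥0) x,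
      Tendsto (fun l => yosidaExp R l t x) atTop (𝓝 (S t x)) := by
  choose L hL using fun (t : ℝ≥0) x => h.exists_tendsto hw hD t.2 x
  refine ⟨fun t => continuousLinearMapOfTendsto (fun l => yosidaExp R l t)
    (tendsto_pi_nhds.2 fun x => hL t x), fun t x => ?_⟩
  exact hL t x

/-- **Hille-Yosida**: a family of resolvents with the contraction type estimate and dense range is
the resolvent of the generator of a strongly continuous semigroup. -/
theorem IsResolventFamily.exists_semigroup (h : IsResolventFamily Γ w R) (hw : 0 ≤ w)
    (hD : Dense {x | ∃ z, (x, z) ∈ Γ}) :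
    ∃ T : C0Semigroup X, ∀ x z, (x, z) ∈ Γ ↔
      Tendsto (fun t : ℝ≥0 => (((t : ℝ) : ℂ))⁻¹ • (T.toFun t x - x)) (𝓝[>] 0) (𝓝 z) := by
  obtain ⟨S, hS⟩ := h.exists_limit hw hD
  have hSb : ∀ (t : ℝ≥0) x, ‖S t x‖ ≤ Real.exp (2 * w * t) * ‖x‖ := by
    intro t x
    refine le_of_tendsto (hS t x).norm ?_
    filter_upwards [eventually_bounds w] with l hl using h.yosidaExp_bound hw hl t.2 x
  have hmono : ∀ {s t : ℝ}, s ≤ t → Real.exp (2 * w * s) ≤ Real.exp (2 * w * t) := by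
    intro s t hst
    gcongr
  -- Orbits of points of the domain are Lipschitz: the approximate orbits have derivative e^{rA_l}
  -- (l R l z), and the bound survives the limit.
  have hlip : ∀ {x z : X}, (x, z) ∈ Γ → ∀ s t b : ℝ≥0, s ≤ t → t ≤ b →
      ‖S t x - S s x‖ ≤ Real.exp (2 * w * b) * ‖z‖ * (t - s) := by
    intro x z hxz s t b hst htb
    have h1 : Tendsto (fun l : ℝ => Real.exp (2 * w * b) * ‖(l : ℂ) • R l z‖ * ((t : ℝ) - s)) atTop
        (𝓝 (Real.exp (2 * w * b) * ‖z‖ * (t - s))) :=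
      ((h.tendsto_smul hD z).norm.const_mul _).mul_const _
    refine le_of_tendsto_of_tendsto ((hS t x).sub (hS s x)).norm h1 ?_
    filter_upwards [eventually_bounds w] with l hl
    refine norm_image_sub_le_of_norm_deriv_le_segment' (a := s) (b := t)
      (f := fun r => yosidaExp R l r x)
      (fun r _ => (hasDerivAt_yosidaExp_apply R l r x).hasDerivWithinAt) ?_ (t : ℝ)
      (right_mem_Icc.2 (by exact_mod_cast hst))
    intro r hr
    rw [h.yosida_apply hl.2.2 hxz]
    refine (h.yosidaExp_bound hw hl (s.2.trans hr.1) _).trans ?_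
    refine mul_le_mul_of_nonneg_right (hmono (hr.2.le.trans ?_)) (norm_nonneg _)
    exact_mod_cast htb
  have hzero : S 0 = ContinuousLinearMap.id ℂ X := by
    ext x
    refine tendsto_nhds_unique (hS 0 x) ?_
    simp [yosidaExp_zero]
  have hadd : ∀ s t, S (s + t) = (S s).comp (S t) := by
    intro s t
    ext x
    refine tendsto_nhds_unique (hS (s + t) x) ?_
    have h1 := (hS s (S t x))
    -- In e^{sA_l} e^{tA_l} x the inner limit is taken first; the error is controlled by the bound
    -- on e^{sA_l}, uniform in l.
    have h2 : Tendsto (fun l => yosidaExp R l s (yosidaExp R l t x - S t x)) atTop (𝓝 0) := by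
      have h3 : Tendsto (fun l => Real.exp (2 * w * s) * ‖yosidaExp R l t x - S t x‖) atTop
          (𝓝 0) := by
        have := ((hS t x).sub_const (S t x)).norm.const_mul (Real.exp (2 * w * s))
        simpa using this
      refine squeeze_zero_norm' ?_ h3
      filter_upwards [eventually_bounds w] with l hl using h.yosidaExp_bound hw hl s.2 _
    have h4 := h2.add h1
    rw [zero_add] at h4
    refine h4.congr fun l => ?_
    rw [← map_add, sub_add_cancel, NNReal.coe_add, yosidaExp_add]
    rfl
  have hcont : ∀ x, Continuous fun t => S t x := by
    intro x
    rw [continuous_iff_continuousAt]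
    intro t₀
    rw [Metric.continuousAt_iff']
    intro ε hε
    set K := Real.exp (2 * w * (t₀ + 1 : ℝ≥0))
    have hK : 0 < K := Real.exp_pos _
    obtain ⟨y, ⟨z, hz⟩, hyx⟩ := Metric.mem_closure_iff.1 (hD x) (ε / (4 * K)) (by positivity)
    have h1 : ∀ᶠ t : ℝ≥0 in 𝓝 t₀, t ≤ t₀ + 1 := Iic_mem_nhds (lt_add_one t₀)
    have h2 : ∀ᶠ t : ℝ≥0 in 𝓝 t₀, dist t t₀ < ε / (2 * K * (‖z‖ + 1)) :=
      Metric.ball_mem_nhds _ (by positivity)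
    filter_upwards [h1, h2] with t ht1 ht2
    have h3 : ∀ u : ℝ≥0, u ≤ t₀ + 1 → ‖S u (x - y)‖ ≤ ε / 4 := by
      intro u hu
      refine (hSb u _).trans ?_
      rw [← dist_eq_norm]
      calc _ ≤ K * (ε / (4 * K)) := by
            refine mul_le_mul (hmono ?_) hyx.le dist_nonneg hK.le
            exact_mod_cast hu
        _ = ε / 4 := by field_simp
    have h4 : ‖S t y - S t₀ y‖ ≤ K * ‖z‖ * dist t t₀ := by
      rcases le_total t t₀ with htt | htt
      · rw [norm_sub_rev, dist_comm, NNReal.dist_eq, abs_of_nonneg (by simpa using htt)]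
        exact hlip hz t t₀ (t₀ + 1) htt le_self_add
      · rw [NNReal.dist_eq, abs_of_nonneg (by simpa using htt)]
        exact hlip hz t₀ t (t₀ + 1) htt ht1
    have h5 : K * ‖z‖ * dist t t₀ < ε / 2 := by
      calc K * ‖z‖ * dist t t₀ ≤ K * (‖z‖ + 1) * dist t t₀ := by gcongr; linarith
        _ < K * (‖z‖ + 1) * (ε / (2 * K * (‖z‖ + 1))) := by gcongr
        _ = ε / 2 := by field_simp
    rw [dist_eq_norm]
    have h6 : S t x - S t₀ x = S t (x - y) - S t₀ (x - y) + (S t y - S t₀ y) := by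
      simp only [map_sub]; abel
    rw [h6]
    have h7 := norm_add_le (S t (x - y) - S t₀ (x - y)) (S t y - S t₀ y)
    have h8 := _root_.norm_sub_le (S t (x - y)) (S t₀ (x - y))
    linarith [h3 t ht1, h3 t₀ le_self_add]
  let T : C0Semigroup X := ⟨S, hzero, hadd, hcont⟩
  have hfwd : ∀ x z, (x, z) ∈ Γ →
      Tendsto (fun t : ℝ≥0 => (((t : ℝ) : ℂ))⁻¹ • (T.toFun t x - x)) (𝓝[>] 0) (𝓝 z) := by
    intro x z hxz
    rw [Metric.tendsto_nhds]
    intro ε hε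
    set K := Real.exp (2 * w)
    have hK : 0 < K := Real.exp_pos _
    -- The orbit of z has to be compared with z near time 0, but z need not lie in the domain. It is
    -- replaced by a nearby y that does, whose orbit is Lipschitz with constant governed by v = A y.
    obtain ⟨y, ⟨v, hv⟩, hyz⟩ := Metric.mem_closure_iff.1 (hD z) (ε / (2 * (K + 1))) (by positivity)
    have h1 : ∀ᶠ t : ℝ≥0 in 𝓝[>] 0, t ≤ 1 :=
      nhdsWithin_le_nhds (Iic_mem_nhds zero_lt_one)
    have h2 : ∀ᶠ t : ℝ≥0 in 𝓝[>] 0, dist t 0 < ε / (4 * K * (‖v‖ + 1)) :=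
      nhdsWithin_le_nhds (Metric.ball_mem_nhds _ (by positivity))
    filter_upwards [h1, h2, self_mem_nhdsWithin] with t ht1 ht2 ht0
    have ht0' : (0 : ℝ) < t := by exact_mod_cast (show (0 : ℝ≥0) < t from ht0)
    have ht1' : (t : ℝ) ≤ 1 := by exact_mod_cast ht1
    have main : ‖S t x - x - (t : ℝ) • z‖ ≤ ((K + 1) * ‖z - y‖ + K * ‖v‖ * t) * t := by
      have hlim : Tendsto (fun l : ℝ => (K * ‖(l : ℂ) • R l z - z‖ + (K + 1) * ‖z - y‖ +
          K * ‖(l : ℂ) • R l v‖ * t) * t) atTop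
          (𝓝 ((K * ‖z - z‖ + (K + 1) * ‖z - y‖ + K * ‖v‖ * t) * t)) := by
        refine Tendsto.mul_const _ (Tendsto.add (Tendsto.add_const _ ?_) ?_)
        · exact (((h.tendsto_smul hD z).sub_const z).norm).const_mul _
        · exact ((h.tendsto_smul hD v).norm.const_mul _).mul_const _
      simp only [sub_self, norm_zero, mul_zero, zero_add] at hlim
      refine le_of_tendsto_of_tendsto (((hS t x).sub_const x).sub_const _).norm hlim ?_
      filter_upwards [eventually_bounds w] with l hl
      have hb : ∀ r : ℝ, 0 ≤ r → r ≤ 1 → ∀ u, ‖yosidaExp R l r u‖ ≤ K * ‖u‖ := by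
        intro r hr hr1 u
        refine (h.yosidaExp_bound hw hl hr u).trans ?_
        refine mul_le_mul_of_nonneg_right ?_ (norm_nonneg _)
        have := hmono hr1
        rwa [mul_one] at this
      have hd : ∀ r : ℝ, HasDerivAt (fun r : ℝ => yosidaExp R l r x - r • z)
          (yosidaExp R l r ((l : ℂ) • R l z) - z) r := by
        intro r
        have h3 := (hasDerivAt_yosidaExp_apply R l r x).fun_sub ((hasDerivAt_id r).smul_const z)
        rw [one_smul, h.yosida_apply hl.2.2 hxz] at h3
        exact h3
      have key := norm_image_sub_le_of_norm_deriv_le_segment' (a := 0) (b := t)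
        (f := fun r : ℝ => yosidaExp R l r x - r • z)
        (C := K * ‖(l : ℂ) • R l z - z‖ + (K + 1) * ‖z - y‖ + K * ‖(l : ℂ) • R l v‖ * t)
        (fun r _ => (hd r).hasDerivWithinAt) ?_ t (right_mem_Icc.2 ht0'.le)
      · simp only [yosidaExp_zero, one_apply_eq_self, zero_smul, sub_zero] at key
        rwa [sub_right_comm] at key
      · intro r hr
        have hr1 : r ≤ 1 := hr.2.le.trans ht1'
        have h6 : ‖yosidaExp R l r y - y‖ ≤ K * ‖(l : ℂ) • R l v‖ * r := by
          have := norm_image_sub_le_of_norm_deriv_le_segment' (a := 0) (b := r)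
            (f := fun q : ℝ => yosidaExp R l q y) (C := K * ‖(l : ℂ) • R l v‖)
            (fun q _ => (hasDerivAt_yosidaExp_apply R l q y).hasDerivWithinAt) ?_ r
            (right_mem_Icc.2 hr.1)
          · simpa [yosidaExp_zero] using this
          · intro q hq
            rw [h.yosida_apply hl.2.2 hv]
            exact hb q hq.1 (hq.2.le.trans hr1) _
        -- The three errors are: the defect of l R l z as an approximation of z, the replacement of
        -- z by y, and the motion of the orbit of y during time r.
        have h7 : yosidaExp R l r ((l : ℂ) • R l z) - z =
            yosidaExp R l r ((l : ℂ) • R l z - z) + (yosidaExp R l r (z - y) - (z - y)) +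
              (yosidaExp R l r y - y) := by
          simp only [map_sub]; abel
        rw [h7]
        have h8 := hb r hr.1 hr1 ((l : ℂ) • R l z - z)
        have h9 := hb r hr.1 hr1 (z - y)
        have h10 : K * ‖(l : ℂ) • R l v‖ * r ≤ K * ‖(l : ℂ) • R l v‖ * t := by
          have := hr.2.le
          gcongr
        have h11 := norm_add₃_le (a := yosidaExp R l r ((l : ℂ) • R l z - z))
          (b := yosidaExp R l r (z - y) - (z - y)) (c := yosidaExp R l r y - y)
        have h12 := _root_.norm_sub_le (yosidaExp R l r (z - y)) (z - y)
        linarith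
    have hq : (((t : ℝ) : ℂ))⁻¹ • (T.toFun t x - x) - z =
        (t : ℝ)⁻¹ • (S t x - x - (t : ℝ) • z) := by
      rw [smul_sub (t : ℝ)⁻¹, smul_smul, inv_mul_cancel₀ ht0'.ne', one_smul, ← Complex.ofReal_inv,
        Complex.coe_smul]
    rw [dist_eq_norm, hq, norm_smul, norm_inv, Real.norm_eq_abs, abs_of_pos ht0']
    have h3 : (t : ℝ)⁻¹ * ‖S t x - x - (t : ℝ) • z‖ ≤ (K + 1) * ‖z - y‖ + K * ‖v‖ * t := by
      rw [inv_mul_le_iff₀ ht0']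
      linarith
    refine h3.trans_lt ?_
    have h4 : (K + 1) * ‖z - y‖ ≤ ε / 2 := by
      rw [← dist_eq_norm]
      calc (K + 1) * dist z y ≤ (K + 1) * (ε / (2 * (K + 1))) := by gcongr
        _ = ε / 2 := by field_simp
    have h5 : K * ‖v‖ * t ≤ ε / 4 := by
      rw [NNReal.dist_eq, NNReal.coe_zero, sub_zero, abs_of_pos ht0'] at ht2
      calc K * ‖v‖ * t ≤ K * (‖v‖ + 1) * (ε / (4 * K * (‖v‖ + 1))) := by gcongr; linarith
        _ = ε / 4 := by field_simp
    linarith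
  refine ⟨T, fun x z => ⟨hfwd x z, fun hx => ?_⟩⟩
  obtain ⟨M, -, hMb⟩ := T.exists_bound
  have hlim : Tendsto (fun l : ℝ => 1 - M * Real.exp (-l)) atTop (𝓝 (1 - M * 0)) :=
    (Real.tendsto_exp_neg_atTop_nhds_zero.const_mul M).const_sub 1
  have hpos : ∀ᶠ l : ℝ in atTop, 0 < 1 - M * Real.exp (-l) :=
    hlim.eventually (lt_mem_nhds (by simp))
  obtain ⟨l, hl, hl0, -, hlw⟩ := (hpos.and (eventually_bounds w)).exists
  -- The generator has no larger domain: x and R l f both lie in it and have the same image f under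
  -- l minus the generator, and that operator is injective for large l by the lower bound.
  set f := (l : ℂ) • x - z
  have h1 : (R l f, (l : ℂ) • R l f - f) ∈ Γ := by
    rw [h.mem_iff l hlw, sub_sub_cancel]
  have h2 := hfwd _ _ h1
  have h3 : Tendsto (fun t : ℝ≥0 => (((t : ℝ) : ℂ))⁻¹ • (T.toFun t (x - R l f) - (x - R l f)))
      (𝓝[>] 0) (𝓝 (z - ((l : ℂ) • R l f - f))) := by
    refine (hx.sub h2).congr fun t => ?_
    rw [← smul_sub, map_sub (T.toFun t)]
    congr 1
    abel
  have h4 := T.lower_bound hMb h3 hl0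
  have h5 : (l : ℂ) • (x - R l f) - (z - ((l : ℂ) • R l f - f)) = 0 := by
    simp only [f, smul_sub]; abel
  rw [h5, norm_zero, mul_zero] at h4
  have h6 : ‖x - R l f‖ = 0 := by
    by_contra hne
    have := lt_of_le_of_ne (norm_nonneg _) (Ne.symm hne)
    nlinarith
  rw [h.mem_iff l hlw]
  exact (sub_eq_zero.1 (norm_eq_zero.1 h6)).symm

end HilleYosida

/-! ### Dissipative operators in a Hilbert space -/

section LumerPhillips

variable {X : Type*} [NormedAddCommGroup X] [InnerProductSpace ℂ X]

/-- Pair l x - z with x: the real part is at least (l - w) ‖x‖², and the Cauchy-Schwarz inequality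
gives the rest. -/
theorem norm_le_of_dissipative {x z : X} {w : ℝ} (h : (inner ℂ x z).re ≤ w * ‖x‖ ^ 2) (l : ℝ) :
    (l - w) * ‖x‖ ≤ ‖(l : ℂ) • x - z‖ := by
  rcases eq_or_ne x 0 with rfl | hx
  · simp
  have hx' : 0 < ‖x‖ := norm_pos_iff.2 hx
  have h1 : (inner ℂ x ((l : ℂ) • x - z)).re = l * ‖x‖ ^ 2 - (inner ℂ x z).re := by
    rw [inner_sub_right, inner_smul_right, inner_self_eq_norm_sq_to_K]
    simp [← Complex.ofReal_pow]
  have h2 : (inner ℂ x ((l : ℂ) • x - z)).re ≤ ‖x‖ * ‖(l : ℂ) • x - z‖ :=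
    (Complex.re_le_norm _).trans (norm_inner_le_norm _ _)
  have h3 : ‖x‖ * ((l - w) * ‖x‖) ≤ ‖x‖ * ‖(l : ℂ) • x - z‖ := by nlinarith
  exact le_of_mul_le_mul_left h3 hx'

/-- The resolvent of a dissipative operator with full range condition. -/
theorem exists_resolvent {Γ : Submodule ℂ (X × X)} {w : ℝ}
    (hdiss : ∀ p ∈ Γ, (inner ℂ p.1 p.2).re ≤ w * ‖p.1‖ ^ 2) {l : ℝ} (hl : w < l)
    (hsurj : ∀ f, ∃ p ∈ Γ, (l : ℂ) • p.1 - p.2 = f) :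
    ∃ R : X →L[ℂ] X, ‖R‖ ≤ (l - w)⁻¹ ∧ ∀ x z, (x, z) ∈ Γ ↔ R ((l : ℂ) • x - z) = x := by
  choose p hp hpf using hsurj
  have hbound : ∀ q ∈ Γ, (l - w) * ‖q.1‖ ≤ ‖(l : ℂ) • q.1 - q.2‖ := fun q hq =>
    norm_le_of_dissipative (hdiss q hq) l
  have hpos : 0 < l - w := sub_pos.2 hl
  -- The bound makes l - A injective, so the chosen preimages are the only ones; linearity of the
  -- choice and both inverse relations follow from this.
  have huniq : ∀ q ∈ Γ, (p ((l : ℂ) • q.1 - q.2)).1 = q.1 := by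
    intro q hq
    have h1 := hbound _ (Γ.sub_mem (hp ((l : ℂ) • q.1 - q.2)) hq)
    have h2 : (l : ℂ) • (p ((l : ℂ) • q.1 - q.2) - q).1 - (p ((l : ℂ) • q.1 - q.2) - q).2 = 0 := by
      have h3 := hpf ((l : ℂ) • q.1 - q.2)
      rw [Prod.fst_sub, Prod.snd_sub, smul_sub, sub_sub_sub_comm, h3, sub_self]
    rw [h2, norm_zero] at h1
    have h3 : ‖(p ((l : ℂ) • q.1 - q.2) - q).1‖ ≤ 0 := by
      by_contra hne
      push Not at hne
      nlinarith
    exact sub_eq_zero.1 (norm_le_zero_iff.1 h3)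
  let R₀ : X →ₗ[ℂ] X :=
    { toFun := fun f => (p f).1
      map_add' := by
        intro f g
        have h1 := huniq _ (Γ.add_mem (hp f) (hp g))
        have h2 : (l : ℂ) • (p f + p g).1 - (p f + p g).2 = f + g := by
          rw [Prod.fst_add, Prod.snd_add, smul_add, add_sub_add_comm, hpf, hpf]
        rwa [h2] at h1
      map_smul' := by
        intro c f
        have h1 := huniq _ (Γ.smul_mem c (hp f))
        have h2 : (l : ℂ) • (c • p f).1 - (c • p f).2 = c • f := by
          rw [Prod.smul_fst, Prod.smul_snd, smul_comm, ← smul_sub, hpf]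
        rwa [h2] at h1 }
  refine ⟨R₀.mkContinuous (l - w)⁻¹ ?_, R₀.mkContinuous_norm_le (inv_nonneg.2 hpos.le) _, ?_⟩
  · intro f
    have h1 := hbound _ (hp f)
    rw [hpf] at h1
    rw [← div_eq_inv_mul, le_div_iff₀' hpos]
    exact h1
  · intro x z
    constructor
    · intro h
      exact huniq _ h
    · intro h
      have h1 : (p ((l : ℂ) • x - z)).1 = x := h
      have h2 := hp ((l : ℂ) • x - z)
      have h3 := hpf ((l : ℂ) • x - z)
      rw [h1] at h3
      have h4 : p ((l : ℂ) • x - z) = (x, z) := Prod.ext h1 (sub_right_injective h3)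
      rwa [h4] at h2

/-- The graph of `A + B`, where `Γ` is the graph of `A`. -/
def perturbGraph (Γ : Submodule ℂ (X × X)) (B : X →L[ℂ] X) : Submodule ℂ (X × X) :=
  Γ.comap (LinearMap.prod (LinearMap.fst ℂ X X)
    (LinearMap.snd ℂ X X - (B : X →ₗ[ℂ] X).comp (LinearMap.fst ℂ X X)))

theorem mem_perturbGraph {Γ : Submodule ℂ (X × X)} {B : X →L[ℂ] X} {p : X × X} :
    p ∈ perturbGraph Γ B ↔ (p.1, p.2 - B p.1) ∈ Γ := Iff.rfl

variable [CompleteSpace X]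

/-- A vector h orthogonal to the domain is written as h = l x - z with (x, z) in the graph. Then ⟨x,
h⟩ = 0 gives l ‖x‖² = Re⟨x, z⟩ ≤ w ‖x‖², so x = 0; single-valuedness gives z = 0 and hence h = 0. -/
theorem dense_domain {Γ : Submodule ℂ (X × X)} {w : ℝ}
    (hdiss : ∀ p ∈ Γ, (inner ℂ p.1 p.2).re ≤ w * ‖p.1‖ ^ 2) {l : ℝ} (hl : w < l)
    (hsurj : ∀ f, ∃ p ∈ Γ, (l : ℂ) • p.1 - p.2 = f) (hsv : ∀ z, ((0 : X), z) ∈ Γ → z = 0) :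
    Dense {x | ∃ z, (x, z) ∈ Γ} := by
  have he : {x | ∃ z, (x, z) ∈ Γ} = (Γ.map (LinearMap.fst ℂ X X) : Set X) := by
    ext x
    simp
  rw [he, Submodule.dense_iff_topologicalClosure_eq_top,
    Submodule.topologicalClosure_eq_top_iff, Submodule.eq_bot_iff]
  intro h hh
  obtain ⟨⟨x, z⟩, hp, hf⟩ := hsurj h
  have h1 : inner ℂ x h = 0 :=
    (Submodule.mem_orthogonal _ _).1 hh x ⟨(x, z), hp, rfl⟩
  have h2 := hdiss _ hp
  have h3 : l * ‖x‖ ^ 2 = (inner ℂ x z).re := by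
    have h4 : inner ℂ x ((l : ℂ) • x - z) = 0 := by rw [← h1, ← hf]
    rw [inner_sub_right, inner_smul_right, inner_self_eq_norm_sq_to_K, sub_eq_zero] at h4
    rw [← h4]
    simp [← Complex.ofReal_pow]
  simp only at h2
  have h5 : ‖x‖ ^ 2 ≤ 0 := by
    by_contra hne
    push Not at hne
    nlinarith
  have h6 : x = 0 := by
    have := pow_eq_zero_iff (two_ne_zero) |>.1 (le_antisymm h5 (by positivity))
    exact norm_eq_zero.1 this
  subst h6
  have h7 := hsv z hp
  rw [← hf, h7]
  simp

/-- A bounded perturbation of a maximal dissipative operator in a Hilbert space generates a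
strongly continuous semigroup. -/
theorem exists_semigroup_of_dissipative {Γ : Submodule ℂ (X × X)}
    (hsv : ∀ z, ((0 : X), z) ∈ Γ → z = 0)
    (hdiss : ∀ p ∈ Γ, (inner ℂ p.1 p.2).re ≤ 0)
    (hsurj : ∀ l : ℝ, 0 < l → ∀ f, ∃ p ∈ Γ, (l : ℂ) • p.1 - p.2 = f) (B : X →L[ℂ] X) :
    ∃ T : C0Semigroup X, ∀ x z, (x, z - B x) ∈ Γ ↔
      Tendsto (fun t : ℝ≥0 => (((t : ℝ) : ℂ))⁻¹ • (T.toFun t x - x)) (𝓝[>] 0) (𝓝 z) := by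
  have hdissB : ∀ p ∈ perturbGraph Γ B, (inner ℂ p.1 p.2).re ≤ ‖B‖ * ‖p.1‖ ^ 2 := by
    intro p hp
    have h1 := hdiss _ (mem_perturbGraph.1 hp)
    simp only [inner_sub_right, Complex.sub_re] at h1
    have h2 : (inner ℂ p.1 (B p.1)).re ≤ ‖p.1‖ * (‖B‖ * ‖p.1‖) :=
      ((Complex.re_le_norm _).trans (norm_inner_le_norm _ _)).trans
        (mul_le_mul_of_nonneg_left (B.le_opNorm _) (norm_nonneg _))
    nlinarith
  -- With R the resolvent of the unperturbed operator A, the factorization l - A - B = (1 - B R) (l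
  -- - A) reduces the range condition to a Neumann series, since ‖B R‖ ≤ ‖B‖ / l < 1.
  have hsurjB : ∀ l : ℝ, ‖B‖ < l → ∀ f, ∃ p ∈ perturbGraph Γ B, (l : ℂ) • p.1 - p.2 = f := by
    intro l hl f
    have hl0 : 0 < l := (norm_nonneg _).trans_lt hl
    obtain ⟨R, hR, hRΓ⟩ := exists_resolvent (w := 0) (by simpa using hdiss) hl0 (hsurj l hl0)
    have hBR : ‖B * R‖ < 1 := by
      refine (norm_mul_le _ _).trans_lt ?_
      rw [sub_zero] at hR
      refine (mul_le_mul_of_nonneg_left hR (norm_nonneg _)).trans_lt ?_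
      rw [← div_eq_mul_inv, div_lt_one hl0]
      exact hl
    obtain ⟨V, hV⟩ := (isUnit_one_sub_of_norm_lt_one hBR).exists_right_inv
    have h1 : V f - B (R (V f)) = f := by
      have := congrArg (fun F : X →L[ℂ] X => F f) hV
      simpa using this
    refine ⟨(R (V f), (l : ℂ) • R (V f) - f), ?_, by simp⟩
    rw [mem_perturbGraph]
    simp only
    rw [hRΓ]
    congr 1
    nth_rw 3 [← h1]
    abel
  have hsvB : ∀ z, ((0 : X), z) ∈ perturbGraph Γ B → z = 0 := by
    intro z hz
    refine hsv z ?_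
    simpa using mem_perturbGraph.1 hz
  -- For l ≤ ‖B‖ the resolvent is given the default value 0, about which nothing is claimed.
  have hR : ∀ l : ℝ, ∃ R : X →L[ℂ] X, ‖B‖ < l → ‖R‖ ≤ (l - ‖B‖)⁻¹ ∧
      ∀ x z, (x, z) ∈ perturbGraph Γ B ↔ R ((l : ℂ) • x - z) = x := by
    intro l
    by_cases hl : ‖B‖ < l
    · obtain ⟨R, h⟩ := exists_resolvent hdissB hl (hsurjB l hl)
      exact ⟨R, fun _ => h⟩
    · exact ⟨0, fun h => absurd h hl⟩
  choose R hR using hR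
  have hfam : IsResolventFamily (perturbGraph Γ B : Set (X × X)) ‖B‖ R :=
    ⟨fun l hl => (hR l hl).1, fun l hl => (hR l hl).2⟩
  exact hfam.exists_semigroup (norm_nonneg _)
    (dense_domain hdissB (lt_add_one _) (hsurjB _ (lt_add_one _)) hsvB)

end LumerPhillips

/-- Semigroups are transported along isomorphisms of Banach spaces. -/
theorem generates_of_equiv {X Y : Type*} [NormedAddCommGroup X] [NormedSpace ℂ X]
    [NormedAddCommGroup Y] [NormedSpace ℂ Y] (Φ : X ≃L[ℂ] Y) {A : X →ₗ.[ℂ] X} (T : C0Semigroup Y)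
    (h : ∀ x z, (x, z) ∈ A.graph ↔ Tendsto
      (fun t : ℝ≥0 => (((t : ℝ) : ℂ))⁻¹ • (T.toFun t (Φ x) - Φ x)) (𝓝[>] 0) (𝓝 (Φ z))) :
    GeneratesC0Semigroup A := by
  refine ⟨⟨fun t => (Φ.symm : Y →L[ℂ] X).comp ((T.toFun t).comp (Φ : X →L[ℂ] Y)), ?_, ?_, ?_⟩, ?_⟩
  · ext x
    simp [T.map_zero]
  · intro s t
    ext x
    simp [T.map_add]
  · intro x
    exact Φ.symm.continuous.comp (T.continuous (Φ x))
  · intro x z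
    rw [h x z]
    change _ ↔ Tendsto (fun t : ℝ≥0 => (((t : ℝ) : ℂ))⁻¹ • (Φ.symm (T.toFun t (Φ x)) - x)) _ _
    have e : ∀ t : ℝ≥0, (((t : ℝ) : ℂ))⁻¹ • (Φ.symm (T.toFun t (Φ x)) - x) =
        Φ.symm ((((t : ℝ) : ℂ))⁻¹ • (T.toFun t (Φ x) - Φ x)) := by
      intro t
      rw [map_smul, map_sub, Φ.symm_apply_apply]
    simp only [e]
    constructor
    · intro h1
      have := (Φ.symm.continuous.tendsto (Φ z)).comp h1
      rwa [Φ.symm_apply_apply] at this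
    · intro h1
      have := (Φ.continuous.tendsto z).comp h1
      refine this.congr fun t => ?_
      exact Φ.apply_symm_apply _

/-! ### Locally absolutely continuous functions on the half-line -/

theorem absolutelyContinuousOnInterval_lipschitz_comp {X Y : Type*} [PseudoMetricSpace X]
    [PseudoMetricSpace Y] {f : ℝ → X} {a b : ℝ} (hf : AbsolutelyContinuousOnInterval f a b)
    {g : X → Y} {K : ℝ≥0} (hg : LipschitzWith K g) :
    AbsolutelyContinuousOnInterval (fun ξ => g (f ξ)) a b := by
  refine squeeze_zero (fun t => Finset.sum_nonneg fun i _ => dist_nonneg) (fun t => ?_)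
    (by simpa using Tendsto.const_mul (K : ℝ) hf)
  rw [Finset.mul_sum]
  exact Finset.sum_le_sum fun i _ => hg.dist_le_mul _ _

theorem absolutelyContinuousOnInterval_sum {F ι : Type*} [SeminormedAddCommGroup F] {a b : ℝ}
    {f : ι → ℝ → F} (s : Finset ι) (hf : ∀ i, AbsolutelyContinuousOnInterval (f i) a b) :
    AbsolutelyContinuousOnInterval (fun ξ => ∑ i ∈ s, f i ξ) a b := by
  classical
  induction s using Finset.induction_on with
  | empty =>
    have : LipschitzOnWith 0 (fun _ : ℝ => (0 : F)) (uIcc a b) :=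
      (LipschitzWith.const (0 : F)).lipschitzOnWith
    simpa using this.absolutelyContinuousOnInterval
  | insert i s hi ih =>
    simp only [Finset.sum_insert hi]
    exact (hf i).fun_add ih

theorem absolutelyContinuousOnInterval_pi {n : ℕ} {a b : ℝ} {y : ℝ → Fin n → ℂ}
    (hy : ∀ i, AbsolutelyContinuousOnInterval (fun ξ => y ξ i) a b) :
    AbsolutelyContinuousOnInterval y a b := by
  have h := absolutelyContinuousOnInterval_sum Finset.univ fun i =>
    absolutelyContinuousOnInterval_lipschitz_comp (hy i)
      (g := fun c : ℂ => (Pi.single i c : Fin n → ℂ)) (K := 1) (by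
        refine LipschitzWith.of_dist_le_mul fun c c' => ?_
        rw [NNReal.coe_one, one_mul, dist_pi_le_iff dist_nonneg]
        intro j
        by_cases hij : j = i
        · subst hij; simp
        · simp [Pi.single_eq_of_ne hij])
  have e : y = fun ξ => ∑ i, Pi.single i (y ξ i) := by
    funext ξ
    exact (Finset.univ_sum_single (y ξ)).symm
  rwa [e]

/-- `y` is locally absolutely continuous on `[0,∞)` with almost everywhere derivative `d`. -/
structure LocAC (y d : ℝ → ℂ) : Prop where
  ac : ∀ b : ℝ, 0 ≤ b → AbsolutelyContinuousOnInterval y 0 b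
  deriv : ∀ᵐ ξ ∂halfLine, HasDerivAt y (d ξ) ξ

theorem ae_restrict_of_ae_halfLine {p : ℝ → Prop} (h : ∀ᵐ ξ ∂halfLine, p ξ) (b : ℝ) :
    ∀ᵐ ξ ∂volume.restrict (Ioc 0 b), p ξ :=
  ae_restrict_of_ae_restrict_of_subset Ioc_subset_Ioi_self h

section FTC

/-- The fundamental theorem for real valued absolutely continuous functions is applied to the real
and imaginary parts. Agreement of d with the derivative almost everywhere is enough. -/
theorem LocAC.intervalIntegrable_and_integral_eq {y d : ℝ → ℂ} (h : LocAC y d) {b : ℝ}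
    (hb : 0 ≤ b) : IntervalIntegrable d volume 0 b ∧ ∫ ξ in (0 : ℝ)..b, d ξ = y b - y 0 := by
  have key : ∀ L : ℂ →L[ℝ] ℝ, IntervalIntegrable (fun ξ => L (d ξ)) volume 0 b ∧
      ∫ ξ in (0 : ℝ)..b, L (d ξ) = L (y b) - L (y 0) := by
    intro L
    have hac := absolutelyContinuousOnInterval_lipschitz_comp (h.ac b hb) L.lipschitz
    have hae : ∀ᵐ ξ ∂volume.restrict (uIoc 0 b),
        _root_.deriv (fun ξ => L (y ξ)) ξ = L (d ξ) := by
      rw [uIoc_of_le hb]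
      filter_upwards [ae_restrict_of_ae_halfLine h.deriv b] with ξ hξ
      exact (L.hasFDerivAt.comp_hasDerivAt ξ hξ).deriv
    constructor
    · exact hac.intervalIntegrable_deriv.congr_ae hae
    · rw [← hac.integral_deriv_eq_sub]
      refine intervalIntegral.integral_congr_ae_restrict ?_
      filter_upwards [hae] with ξ hξ using hξ.symm
  obtain ⟨h1, h1'⟩ := key Complex.reCLM
  obtain ⟨h2, h2'⟩ := key Complex.imCLM
  have hd : d = fun ξ => ((Complex.reCLM (d ξ) : ℝ) : ℂ) + ((Complex.imCLM (d ξ) : ℝ) : ℂ) *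
      Complex.I := by
    funext ξ; simp [Complex.re_add_im]
  have hi1 : IntervalIntegrable (fun ξ => ((Complex.reCLM (d ξ) : ℝ) : ℂ)) volume 0 b := by
    rw [intervalIntegrable_iff] at h1 ⊢
    exact h1.ofReal
  have hi2 : IntervalIntegrable (fun ξ => ((Complex.imCLM (d ξ) : ℝ) : ℂ) * Complex.I)
      volume 0 b := by
    rw [intervalIntegrable_iff] at h2 ⊢
    exact h2.ofReal.mul_const _
  refine ⟨by rw [hd]; exact hi1.add hi2, ?_⟩
  rw [hd, intervalIntegral.integral_add hi1 hi2, intervalIntegral.integral_mul_const,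
    intervalIntegral.integral_ofReal, intervalIntegral.integral_ofReal, h1', h2']
  apply Complex.ext <;> simp

theorem LocAC.intervalIntegrable {y d : ℝ → ℂ} (h : LocAC y d) {b : ℝ} (hb : 0 ≤ b) :
    IntervalIntegrable d volume 0 b := (h.intervalIntegrable_and_integral_eq hb).1

theorem LocAC.integral_eq {y d : ℝ → ℂ} (h : LocAC y d) {b : ℝ} (hb : 0 ≤ b) :
    ∫ ξ in (0 : ℝ)..b, d ξ = y b - y 0 := (h.intervalIntegrable_and_integral_eq hb).2

theorem ae_halfLine_of_forall_Ioc {p : ℝ → Prop}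
    (h : ∀ N : ℕ, ∀ᵐ ξ : ℝ, ξ ∈ Ioc 0 (N : ℝ) → p ξ) : ∀ᵐ ξ ∂halfLine, p ξ := by
  rw [ae_restrict_iff' measurableSet_Ioi]
  filter_upwards [ae_all_iff.2 h] with ξ hξ hpos
  obtain ⟨N, hN⟩ := exists_nat_ge ξ
  exact hξ N ⟨hpos, hN⟩

theorem locAC_primitive {d : ℝ → ℂ} (hd : ∀ b : ℝ, 0 ≤ b → IntervalIntegrable d volume 0 b)
    (c : ℂ) : LocAC (fun ξ => c + ∫ ζ in (0 : ℝ)..ξ, d ζ) d where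
  ac b hb := by
    have h1 := (hd b hb)
    rw [intervalIntegrable_iff] at h1
    have hre : IntervalIntegrable (fun ξ => (d ξ).re) volume 0 b := by
      rw [intervalIntegrable_iff]; exact h1.re
    have him : IntervalIntegrable (fun ξ => (d ξ).im) volume 0 b := by
      rw [intervalIntegrable_iff]; exact h1.im
    have a1 := absolutelyContinuousOnInterval_lipschitz_comp
      (hre.absolutelyContinuousOnInterval_intervalIntegral left_mem_uIcc)
      Complex.isometry_ofReal.lipschitz
    have a2 := absolutelyContinuousOnInterval_lipschitz_comp
      (him.absolutelyContinuousOnInterval_intervalIntegral left_mem_uIcc)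
      Complex.isometry_ofReal.lipschitz
    have a3 : LipschitzOnWith 0 (fun _ : ℝ => c) (uIcc 0 b) :=
      (LipschitzWith.const c).lipschitzOnWith
    have a4 := a3.absolutelyContinuousOnInterval.fun_add (a1.fun_add (a2.const_smul Complex.I))
    have heq : EqOn (fun x : ℝ => c + (((∫ v in (0 : ℝ)..x, (d v).re : ℝ) : ℂ) +
        Complex.I • ((∫ v in (0 : ℝ)..x, (d v).im : ℝ) : ℂ)))
        (fun ξ => c + ∫ ζ in (0 : ℝ)..ξ, d ζ) (uIcc 0 b) := by
      intro x hx
      rw [uIcc_of_le hb] at hx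
      have h2 := hd x hx.1
      rw [intervalIntegrable_iff] at h2
      have e1 : ((∫ v in (0 : ℝ)..x, (d v).re : ℝ) : ℂ) = ∫ v in (0 : ℝ)..x, ((d v).re : ℂ) :=
        intervalIntegral.integral_ofReal.symm
      have e2 : ((∫ v in (0 : ℝ)..x, (d v).im : ℝ) : ℂ) = ∫ v in (0 : ℝ)..x, ((d v).im : ℂ) :=
        intervalIntegral.integral_ofReal.symm
      simp only [e1, e2, smul_eq_mul]
      rw [← intervalIntegral.integral_const_mul, ← intervalIntegral.integral_add]
      · congr 1
        refine intervalIntegral.integral_congr fun v _ => ?_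
        rw [mul_comm, Complex.re_add_im]
      · rw [intervalIntegrable_iff]; exact h2.re.ofReal
      · rw [intervalIntegrable_iff]; exact h2.im.ofReal.const_mul _
    refine Tendsto.congr' ?_ a4
    -- Absolute continuity on [0, b] only tests endpoints of intervals inside [0, b], so agreement
    -- there transfers it.
    have hmem : ∀ᶠ E : ℕ × (ℕ → ℝ × ℝ) in (AbsolutelyContinuousOnInterval.totalLengthFilter ⊓
        𝓟 (AbsolutelyContinuousOnInterval.disjWithin 0 b)),
        E ∈ AbsolutelyContinuousOnInterval.disjWithin 0 b :=
      mem_inf_of_right (mem_principal_self _)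
    filter_upwards [hmem] with E hE
    refine Finset.sum_congr rfl fun i hi => ?_
    have := hE.1 i hi
    exact congrArg₂ dist (heq this.1) (heq this.2)
  deriv := by
    refine ae_halfLine_of_forall_Ioc fun N => ?_
    have h1 := (hd N (Nat.cast_nonneg N)).ae_hasDerivAt_integral
    filter_upwards [h1] with ξ hξ hmem
    rw [uIcc_of_le (Nat.cast_nonneg N)] at hξ
    exact (hξ (Ioc_subset_Icc_self hmem) 0 (left_mem_Icc.2 (Nat.cast_nonneg N))).const_add c

theorem LocAC.mul {y d y' d' : ℝ → ℂ} (h : LocAC y d) (h' : LocAC y' d') :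
    LocAC (fun ξ => y ξ * y' ξ) (fun ξ => d ξ * y' ξ + y ξ * d' ξ) where
  ac b hb := (h.ac b hb).fun_smul (h'.ac b hb)
  deriv := by
    filter_upwards [h.deriv, h'.deriv] with ξ h1 h2 using h1.mul h2

theorem LocAC.sum {ι : Type*} (s : Finset ι) {y d : ι → ℝ → ℂ} (h : ∀ i, LocAC (y i) (d i)) :
    LocAC (fun ξ => ∑ i ∈ s, y i ξ) (fun ξ => ∑ i ∈ s, d i ξ) where
  ac b hb := absolutelyContinuousOnInterval_sum s fun i => (h i).ac b hb
  deriv := by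
    have h1 : ∀ᵐ ξ ∂halfLine, ∀ i ∈ s, HasDerivAt (y i) (d i ξ) ξ := by
      exact (ae_ball_iff s.countable_toSet).2 fun i _ => (h i).deriv
    filter_upwards [h1] with ξ h2 using HasDerivAt.fun_sum h2

theorem LocAC.const_mul {y d : ℝ → ℂ} (c : ℂ) (h : LocAC y d) :
    LocAC (fun ξ => c * y ξ) (fun ξ => c * d ξ) where
  ac b hb := (h.ac b hb).const_smul c
  deriv := by
    filter_upwards [h.deriv] with ξ h1 using h1.const_mul c

theorem LocAC.conj {y d : ℝ → ℂ} (h : LocAC y d) :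
    LocAC (fun ξ => star (y ξ)) (fun ξ => star (d ξ)) where
  ac b hb := absolutelyContinuousOnInterval_lipschitz_comp (h.ac b hb)
    Complex.conjLIE.isometry.lipschitz
  deriv := by
    filter_upwards [h.deriv] with ξ h1 using h1.star

theorem LocAC.congr_deriv {y d d' : ℝ → ℂ} (h : LocAC y d) (hd : d =ᵐ[halfLine] d') :
    LocAC y d' where
  ac := h.ac
  deriv := by
    filter_upwards [h.deriv, hd] with ξ h1 h2 using h2 ▸ h1

theorem LocAC.continuousOn {y d : ℝ → ℂ} (h : LocAC y d) : ContinuousOn y (Ici 0) := by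
  intro ξ hξ
  have hξ' : (0 : ℝ) ≤ ξ := hξ
  have h1 := (h.ac (ξ + 1) (by linarith)).continuousOn
  rw [uIcc_of_le (by linarith)] at h1
  refine (h1 ξ ⟨hξ', by linarith⟩).mono_of_mem_nhdsWithin ?_
  rw [mem_nhdsWithin]
  exact ⟨Iio (ξ + 1), isOpen_Iio, by simp, fun x hx => ⟨hx.2, hx.1.le⟩⟩

theorem locAC_of_contDiffOn {f : ℝ → ℂ} (hf : ContDiffOn ℝ 1 f (Ici 0)) :
    LocAC f (fun ξ => derivWithin f (Ici 0) ξ) where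
  ac b hb := by
    refine (hf.mono ?_).absolutelyContinuousOnInterval
    rw [uIcc_of_le hb]
    exact Icc_subset_Ici_self
  deriv := by
    filter_upwards [ae_halfLine_pos] with ξ hξ
    have h1 := (hf.differentiableOn one_ne_zero ξ hξ.le).hasDerivWithinAt
    exact h1.hasDerivAt (Ici_mem_nhds hξ)

end FTC

variable {n : ℕ}

theorem IsACRep.locAC {w : Weight n} {x : L2W w} {y d : ℝ → Fin n → ℂ} (h : IsACRep x y d)
    (i : Fin n) : LocAC (fun ξ => y ξ i) (fun ξ => d ξ i) where
  ac b hb := absolutelyContinuousOnInterval_lipschitz_comp (h.ac b hb)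
    (LipschitzWith.eval i)
  deriv := by
    filter_upwards [h.deriv] with ξ h1 using hasDerivAt_pi.1 h1 i

theorem IsACRep.of_locAC {w : Weight n} {x : L2W w} {y d : ℝ → Fin n → ℂ}
    (h : ∀ i, LocAC (fun ξ => y ξ i) (fun ξ => d ξ i))
    (he : y =ᵐ[halfLine] fun ξ => w.toFun ξ *ᵥ x.rep ξ) : IsACRep x y d where
  ac b hb := absolutelyContinuousOnInterval_pi fun i => (h i).ac b hb
  ae_eq := he
  deriv := by
    filter_upwards [ae_all_iff.2 fun i => (h i).deriv] with ξ h1 using hasDerivAt_pi.2 h1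

theorem locAC_mulVec {M : ℝ → Matrix (Fin n) (Fin n) ℂ} (hM : MatC1 M) {y d : ℝ → Fin n → ℂ}
    (h : ∀ i, LocAC (fun ξ => y ξ i) (fun ξ => d ξ i)) (i : Fin n) :
    LocAC (fun ξ => (M ξ *ᵥ y ξ) i) (fun ξ => (matDeriv M ξ *ᵥ y ξ + M ξ *ᵥ d ξ) i) := by
  have := LocAC.sum Finset.univ fun j => (locAC_of_contDiffOn (hM i j)).mul (h j)
  simpa only [Pi.add_apply, mulVec, dotProduct, ← Finset.sum_add_distrib, matDeriv,
    Matrix.of_apply] using this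

theorem locAC_const_mulVec (M : Matrix (Fin n) (Fin n) ℂ) {y d : ℝ → Fin n → ℂ}
    (h : ∀ i, LocAC (fun ξ => y ξ i) (fun ξ => d ξ i)) (i : Fin n) :
    LocAC (fun ξ => (M *ᵥ y ξ) i) (fun ξ => (M *ᵥ d ξ) i) :=
  LocAC.sum Finset.univ fun j => (h j).const_mul (M i j)


/-! ### The weighted spaces -/

/-- The real quadratic form `v^⋆ W(ξ) v`. -/
def Weight.q (w : Weight n) (v : Fin n → ℂ) (ξ : ℝ) : ℝ := (star v ⬝ᵥ (w.toFun ξ *ᵥ v)).re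

theorem Weight.q_nonneg (w : Weight n) (v : Fin n → ℂ) {ξ : ℝ} (hξ : 0 ≤ ξ) : 0 ≤ w.q v ξ :=
  (Complex.le_def.1 (w.form_self_nonneg (fun _ => v) hξ)).1

theorem Weight.form_self (w : Weight n) (x : ℝ → Fin n → ℂ) {ξ : ℝ} (hξ : 0 ≤ ξ) :
    w.form x x ξ = (w.q (x ξ) ξ : ℂ) := by
  have h := (Complex.le_def.1 (w.form_self_nonneg x hξ)).2
  exact Complex.ext rfl h.symm

theorem Weight.form_self_ae (w : Weight n) (x : ℝ → Fin n → ℂ) :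
    w.form x x =ᵐ[halfLine] fun ξ => (w.q (x ξ) ξ : ℂ) := by
  filter_upwards [ae_halfLine_pos] with ξ hξ using w.form_self x hξ.le

theorem Weight.integrable_form_iff (w : Weight n) (x : ℝ → Fin n → ℂ) :
    Integrable (w.form x x) halfLine ↔ Integrable (fun ξ => w.q (x ξ) ξ) halfLine := by
  rw [integrable_congr (w.form_self_ae x)]
  exact ⟨fun h => h.re, fun h => h.ofReal⟩

theorem Weight.aestronglyMeasurable_q (w : Weight n) {x : ℝ → Fin n → ℂ}
    (hx : AEStronglyMeasurable x halfLine) :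
    AEStronglyMeasurable (fun ξ => w.q (x ξ) ξ) halfLine :=
  Complex.continuous_re.comp_aestronglyMeasurable (w.aestronglyMeasurable_form hx hx)

/-- The element of `L²_W` with a given representative. -/
def L2W.of (w : Weight n) (f : ℝ → Fin n → ℂ) (hf : AEStronglyMeasurable f halfLine)
    (hi : Integrable (fun ξ => w.q (f ξ) ξ) halfLine) : L2W w :=
  ⟨AEEqFun.mk f hf, ((w.integrable_form_iff f).2 hi).congr
    (w.form_congr (AEEqFun.coeFn_mk f hf).symm (AEEqFun.coeFn_mk f hf).symm)⟩

theorem L2W.rep_of {w : Weight n} {f : ℝ → Fin n → ℂ} (hf : AEStronglyMeasurable f halfLine)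
    (hi : Integrable (fun ξ => w.q (f ξ) ξ) halfLine) :
    (L2W.of w f hf hi).rep =ᵐ[halfLine] f := AEEqFun.coeFn_mk f hf

theorem L2W.integrable_q {w : Weight n} (x : L2W w) :
    Integrable (fun ξ => w.q (x.rep ξ) ξ) halfLine := (w.integrable_form_iff _).1 x.integrable

theorem L2W.inner_eq {w : Weight n} (x y : L2W w) :
    inner ℂ x y = ∫ ξ, w.form x.rep y.rep ξ ∂halfLine := rfl

theorem L2W.norm_sq_eq {w : Weight n} (x : L2W w) :
    ‖x‖ ^ 2 = ∫ ξ, w.q (x.rep ξ) ξ ∂halfLine := by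
  have h : inner ℂ x x = ((∫ ξ, w.q (x.rep ξ) ξ ∂halfLine : ℝ) : ℂ) := by
    rw [L2W.inner_eq, integral_congr_ae (w.form_self_ae x.rep)]
    exact integral_ofReal
  rw [inner_self_eq_norm_sq_to_K] at h
  exact Complex.ofReal_injective (by simpa using h)

theorem L2W.integrable_form {w : Weight n} (x y : L2W w) :
    Integrable (w.form x.rep y.rep) halfLine :=
  w.integrable_form x.aestronglyMeasurable y.aestronglyMeasurable x.integrable y.integrable

theorem aestronglyMeasurable_mulVec {F : ℝ → Matrix (Fin n) (Fin n) ℂ}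
    (hF : ∀ i j, AEStronglyMeasurable (fun ξ => F ξ i j) halfLine) {x : ℝ → Fin n → ℂ}
    (hx : AEStronglyMeasurable x halfLine) :
    AEStronglyMeasurable (fun ξ => F ξ *ᵥ x ξ) halfLine := by
  refine AEMeasurable.aestronglyMeasurable (aemeasurable_pi_lambda _ fun i => ?_)
  simp only [mulVec, dotProduct]
  refine Finset.aemeasurable_fun_sum _ fun j _ => ?_
  exact (hF i j).aemeasurable.mul (hx.aemeasurable.eval j)

/-- A pointwise bound yields a bounded multiplication operator. -/
theorem mulIsBounded_of_bound {F : ℝ → Matrix (Fin n) (Fin n) ℂ} {w v : Weight n}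
    (hF : ∀ i j, AEStronglyMeasurable (fun ξ => F ξ i j) halfLine) {C : ℝ}
    (hC : ∀ᵐ ξ ∂halfLine, ∀ u, v.q (F ξ *ᵥ u) ξ ≤ C * w.q u ξ) : MulIsBounded F w v := by
  have hm : ∀ x : L2W w, AEStronglyMeasurable (fun ξ => F ξ *ᵥ x.rep ξ) halfLine := fun x =>
    aestronglyMeasurable_mulVec hF x.aestronglyMeasurable
  have hi : ∀ x : L2W w, Integrable (fun ξ => v.q (F ξ *ᵥ x.rep ξ) ξ) halfLine := by
    intro x
    refine Integrable.mono' (x.integrable_q.const_mul C) (v.aestronglyMeasurable_q (hm x)) ?_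
    filter_upwards [hC, ae_halfLine_pos] with ξ h hξ
    rw [Real.norm_eq_abs, abs_of_nonneg (v.q_nonneg _ hξ.le)]
    exact h _
  have hr : ∀ x, (L2W.of v _ (hm x) (hi x)).rep =ᵐ[halfLine] fun ξ => F ξ *ᵥ x.rep ξ := fun x =>
    L2W.rep_of _ _
  let T : L2W w →ₗ[ℂ] L2W v :=
    { toFun := fun x => L2W.of v _ (hm x) (hi x)
      map_add' := by
        intro x y
        refine L2W.ext_ae ?_
        filter_upwards [hr (x + y), hr x, hr y, L2W.rep_add x y,
          L2W.rep_add (L2W.of v _ (hm x) (hi x)) (L2W.of v _ (hm y) (hi y))] with ξ h1 h2 h3 h4 h5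
        rw [h1, h5, h2, h3, h4, mulVec_add]
      map_smul' := by
        intro c x
        refine L2W.ext_ae ?_
        filter_upwards [hr (c • x), hr x, L2W.rep_smul c x,
          L2W.rep_smul c (L2W.of v _ (hm x) (hi x))] with ξ h1 h2 h3 h4
        rw [h1, RingHom.id_apply, h4, h2, h3, mulVec_smul] }
  -- The hypothesis bounds squared norms, whence the square root; the sign of C is not prescribed,
  -- whence the absolute value.
  refine ⟨T.mkContinuous (Real.sqrt |C|) fun x => ?_, hr⟩
  have h1 : ‖T x‖ ^ 2 ≤ |C| * ‖x‖ ^ 2 := by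
    rw [L2W.norm_sq_eq, L2W.norm_sq_eq, ← integral_const_mul]
    refine integral_mono_ae (T x).integrable_q (x.integrable_q.const_mul _) ?_
    filter_upwards [hC, ae_halfLine_pos, hr x] with ξ h hξ h2
    change v.q ((L2W.of v _ (hm x) (hi x)).rep ξ) ξ ≤ _
    rw [h2]
    exact (h _).trans (mul_le_mul_of_nonneg_right (le_abs_self C) (w.q_nonneg _ hξ.le))
  refine le_of_sq_le_sq ?_ (by positivity)
  rw [mul_pow, Real.sq_sqrt (abs_nonneg _)]
  exact h1

theorem Weight.isUnit_det (w : Weight n) {ξ : ℝ} (hξ : 0 ≤ ξ) : IsUnit (w.toFun ξ).det :=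
  (isUnit_iff_isUnit_det _).1 (w.posDef ξ hξ).isUnit

theorem Weight.continuousOn_matrix (w : Weight n) : ContinuousOn w.toFun (Ici 0) :=
  continuousOn_pi.2 fun i => continuousOn_pi.2 fun j => w.continuousOn i j

theorem Weight.continuousOn_inv (w : Weight n) (i j : Fin n) :
    ContinuousOn (fun ξ => (w.toFun ξ)⁻¹ i j) (Ici 0) := by
  have h1 : ContinuousOn (fun ξ => (w.toFun ξ).det) (Ici 0) :=
    (continuous_id.matrix_det).comp_continuousOn w.continuousOn_matrix
  have h2 : ContinuousOn (fun ξ => (w.toFun ξ).adjugate) (Ici 0) :=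
    (continuous_id.matrix_adjugate).comp_continuousOn w.continuousOn_matrix
  have h3 : ContinuousOn (fun ξ => (w.toFun ξ).adjugate i j) (Ici 0) :=
    continuousOn_pi.1 (continuousOn_pi.1 h2 i) j
  have h4 : ContinuousOn (fun ξ => (w.toFun ξ).det⁻¹ * (w.toFun ξ).adjugate i j) (Ici 0) :=
    (h1.inv₀ fun ξ hξ => (w.isUnit_det hξ).ne_zero).mul h3
  refine h4.congr fun ξ _ => ?_
  rw [Matrix.inv_def, Ring.inverse_eq_inv', Matrix.smul_apply, smul_eq_mul]

theorem continuousOn_mulVec {M : ℝ → Matrix (Fin n) (Fin n) ℂ} {a : ℝ → Fin n → ℂ} {s : Set ℝ}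
    (hM : ∀ i j, ContinuousOn (fun ξ => M ξ i j) s) (ha : ContinuousOn a s) :
    ContinuousOn (fun ξ => M ξ *ᵥ a ξ) s :=
  continuousOn_pi.2 fun i => by
    simp only [mulVec, dotProduct]
    exact continuousOn_finsetSum _ fun j _ => (hM i j).mul (continuousOn_pi.1 ha j)

theorem Weight.continuousOn_q (w : Weight n) {a : ℝ → Fin n → ℂ} {s : Set ℝ} (hs : s ⊆ Ici 0)
    (ha : ContinuousOn a s) : ContinuousOn (fun ξ => w.q (a ξ) ξ) s := by
  refine Complex.continuous_re.comp_continuousOn ?_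
  have h1 := continuousOn_mulVec (fun i j => (w.continuousOn i j).mono hs) ha
  refine continuousOn_finsetSum _ fun j _ => ?_
  exact (continuous_star.comp_continuousOn (continuousOn_pi.1 ha j)).mul (continuousOn_pi.1 h1 j)

theorem Weight.q_zero (w : Weight n) (ξ : ℝ) : w.q 0 ξ = 0 := by simp [Weight.q]

/-- Truncations of functions which are square integrable near the truncated interval. -/
theorem exists_indicator (w : Weight n) {a : ℝ → Fin n → ℂ} (b c : ℝ) (hb : 0 ≤ b)
    (ha : ContinuousOn a (Icc b c)) :
    ∃ x : L2W w, x.rep =ᵐ[halfLine] (Ioc b c).indicator a := by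
  have hm : AEStronglyMeasurable ((Ioc b c).indicator a) halfLine := by
    rw [aestronglyMeasurable_indicator_iff measurableSet_Ioc]
    have := (ha.mono Ioc_subset_Icc_self).aestronglyMeasurable measurableSet_Ioc (μ := halfLine)
    exact this
  have hq : (fun ξ => w.q ((Ioc b c).indicator a ξ) ξ) =
      (Ioc b c).indicator fun ξ => w.q (a ξ) ξ := by
    funext ξ
    by_cases h : ξ ∈ Ioc b c
    · simp [h]
    · simp [h, w.q_zero]
  refine ⟨L2W.of w _ hm ?_, L2W.rep_of _ _⟩
  rw [hq, integrable_indicator_iff measurableSet_Ioc]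
  have h1 : IntegrableOn (fun ξ => w.q (a ξ) ξ) (Icc b c) :=
    (w.continuousOn_q (fun ξ hξ => hb.trans hξ.1) ha).integrableOn_Icc
  exact (h1.mono_set Ioc_subset_Icc_self).mono_measure Measure.restrict_le_self

/-- Pointwise Riesz representation: W⁻¹ applied to the conjugate of a represents v ↦ a · v in the
scalar product defined by W. It turns integration against a into an inner product. -/
theorem Weight.star_inv_mulVec_dotProduct (w : Weight n) {ξ : ℝ} (hξ : 0 ≤ ξ)
    (a v : Fin n → ℂ) : star ((w.toFun ξ)⁻¹ *ᵥ star a) ⬝ᵥ (w.toFun ξ *ᵥ v) = a ⬝ᵥ v := by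
  rw [star_mulVec, star_star, conjTranspose_nonsing_inv, (w.posDef ξ hξ).isHermitian.eq,
    dotProduct_mulVec, vecMul_vecMul, nonsing_inv_mul _ (w.isUnit_det hξ), vecMul_one]

/-- Integration against a continuous function over `(0,b]` is a bounded functional. -/
theorem exists_functional (w : Weight n) {a : ℝ → Fin n → ℂ} (ha : ContinuousOn a (Ici 0))
    (b : ℝ) : ∃ ℓ : L2W w →L[ℂ] ℂ, ∀ z : L2W w,
      IntegrableOn (fun ξ => a ξ ⬝ᵥ z.rep ξ) (Ioc 0 b) ∧
      ℓ z = ∫ ξ in Ioc 0 b, a ξ ⬝ᵥ z.rep ξ := by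
  have hc : ContinuousOn (fun ξ => (w.toFun ξ)⁻¹ *ᵥ star (a ξ)) (Icc 0 b) :=
    (continuousOn_mulVec w.continuousOn_inv (continuous_star.comp_continuousOn ha)).mono
      Icc_subset_Ici_self
  obtain ⟨x, hx⟩ := exists_indicator w 0 b le_rfl hc
  have he : ∀ z : L2W w, w.form x.rep z.rep =ᵐ[halfLine]
      (Ioc 0 b).indicator fun ξ => a ξ ⬝ᵥ z.rep ξ := by
    intro z
    filter_upwards [hx, ae_halfLine_pos] with ξ h hξ
    rw [Weight.form, h]
    by_cases hm : ξ ∈ Ioc 0 b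
    · rw [indicator_of_mem hm, indicator_of_mem hm, w.star_inv_mulVec_dotProduct hξ.le]
    · rw [indicator_of_notMem hm, indicator_of_notMem hm]
      simp
  have hr : halfLine.restrict (Ioc 0 b) = volume.restrict (Ioc 0 b) := by
    rw [Measure.restrict_restrict measurableSet_Ioc, inter_eq_left.2 Ioc_subset_Ioi_self]
  refine ⟨innerSL ℂ x, fun z => ⟨?_, ?_⟩⟩
  · have h1 := (L2W.integrable_form x z).congr (he z)
    rw [integrable_indicator_iff measurableSet_Ioc, IntegrableOn, hr] at h1
    exact h1
  · rw [innerSL_apply_apply, L2W.inner_eq, integral_congr_ae (he z),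
      integral_indicator measurableSet_Ioc, hr]

theorem L2W.integrableOn {w : Weight n} (z : L2W w) (i : Fin n) (b : ℝ) :
    IntegrableOn (fun ξ => z.rep ξ i) (Ioc 0 b) := by
  obtain ⟨ℓ, h⟩ := exists_functional w (a := fun _ => Pi.single i 1) continuousOn_const b
  simpa using (h z).1

theorem L2W.integrableOn_mul {w : Weight n} (z : L2W w) (i : Fin n) (b : ℝ) :
    IntegrableOn (fun ξ => (w.toFun ξ *ᵥ z.rep ξ) i) (Ioc 0 b) := by
  obtain ⟨ℓ, h⟩ := exists_functional w (a := fun ξ => w.toFun ξ i)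
    (continuousOn_pi.2 fun j => w.continuousOn i j) b
  exact (h z).1

/-- The two functions have the same primitive on the half-line, and by Lebesgue's differentiation
theorem each is its derivative almost everywhere. -/
theorem ae_eq_of_integral_eq {u v : ℝ → ℂ} (hu : ∀ b, IntegrableOn u (Ioc 0 b))
    (hv : ∀ b, IntegrableOn v (Ioc 0 b))
    (h : ∀ b, 0 ≤ b → ∫ ξ in Ioc 0 b, u ξ = ∫ ξ in Ioc 0 b, v ξ) : u =ᵐ[halfLine] v := by
  have hu' := locAC_primitive (d := u)
    (fun b hb => (intervalIntegrable_iff_integrableOn_Ioc_of_le hb).2 (hu b)) 0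
  have hv' := locAC_primitive (d := v)
    (fun b hb => (intervalIntegrable_iff_integrableOn_Ioc_of_le hb).2 (hv b)) 0
  filter_upwards [hu'.deriv, hv'.deriv, ae_halfLine_pos] with ξ h1 h2 hξ
  refine h1.unique (h2.congr_of_eventuallyEq ?_)
  filter_upwards [Ioi_mem_nhds hξ] with b hb
  have hb' : (0 : ℝ) ≤ b := le_of_lt hb
  rw [intervalIntegral.integral_of_le hb', intervalIntegral.integral_of_le hb', h b hb']

theorem L2W.eq_of_integral_eq {w : Weight n} {x y : L2W w}
    (h : ∀ b, 0 ≤ b → ∀ i, ∫ ξ in Ioc 0 b, x.rep ξ i = ∫ ξ in Ioc 0 b, y.rep ξ i) : x = y := by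
  refine L2W.ext_ae ?_
  have := fun i => ae_eq_of_integral_eq (x.integrableOn i) (y.integrableOn i)
    fun b hb => h b hb i
  filter_upwards [ae_all_iff.2 this] with ξ h1 using funext h1

/-! ### Closedness -/

/-- Integrate the derivative of (b - ξ) y(ξ) over [0, b]. The factor b - ξ removes the value at b,
so that apart from y 0 only integrals of y and d occur. -/
theorem LocAC.integral_eq_smul {y d : ℝ → ℂ} (h : LocAC y d) {b : ℝ} (hb : 0 ≤ b) :
    ∫ ξ in Ioc 0 b, y ξ = b * y 0 + ∫ ξ in Ioc 0 b, ((b : ℂ) - ξ) * d ξ := by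
  have h1 : LocAC (fun ξ : ℝ => (b : ℂ) - ξ) (fun _ => -1) := by
    refine (locAC_of_contDiffOn ?_).congr_deriv ?_
    · exact (contDiff_const.sub Complex.ofRealCLM.contDiff).contDiffOn
    · filter_upwards [ae_halfLine_pos] with ξ hξ
      have : HasDerivAt (fun ξ : ℝ => (b : ℂ) - ξ) (-1) ξ := by
        simpa using (Complex.ofRealCLM.hasDerivAt (x := ξ)).const_sub (b : ℂ)
      exact this.hasDerivWithinAt.derivWithin (uniqueDiffOn_Ici 0 ξ hξ.le)
  have h2 := (h1.mul h).integral_eq hb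
  have hy : IntervalIntegrable y volume 0 b :=
    (h.continuousOn.mono (by rw [uIcc_of_le hb]; exact Icc_subset_Ici_self)).intervalIntegrable
  have h3 : IntervalIntegrable (fun ξ : ℝ => -1 * y ξ) volume 0 b := hy.const_mul _
  have h4 : IntervalIntegrable (fun ξ : ℝ => ((b : ℂ) - ξ) * d ξ) volume 0 b :=
    (h.intervalIntegrable hb).continuousOn_mul (by fun_prop)
  rw [intervalIntegral.integral_add h3 h4, intervalIntegral.integral_const_mul,
    intervalIntegral.integral_of_le hb, intervalIntegral.integral_of_le hb] at h2
  simp only [sub_self, zero_mul, Complex.ofReal_zero, sub_zero] at h2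
  linear_combination -h2

/-- This replaces regularity and almost everywhere statements by linear equations between bounded
functionals of the pair, with c in the role of (W x)(0). Conversely, the equations force W x to
agree with the primitive of P₁⁻¹ z starting at c, because both have the same integral over every (0,
b]. -/
theorem mem_phGraph_iff {m : ℕ} (w : Weight n) {P₁ : Matrix (Fin n) (Fin n) ℂ}
    (hP₁ : IsUnit P₁) (WB : Matrix (Fin m) (Fin n) ℂ) (p : L2W w × L2W w) :
    p ∈ phGraph w P₁ 0 WB ↔ ∃ c : Fin n → ℂ, WB *ᵥ c = 0 ∧ ∀ b : ℝ, 0 ≤ b → ∀ i,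
      ∫ ξ in Ioc 0 b, w.toFun ξ i ⬝ᵥ p.1.rep ξ = b * c i +
        ∫ ξ in Ioc 0 b, (((b : ℂ) - ξ) • P₁⁻¹ i) ⬝ᵥ p.2.rep ξ := by
  have hdet : IsUnit P₁.det := (isUnit_iff_isUnit_det _).1 hP₁
  constructor
  · rintro ⟨y, d, h, hb, he⟩
    refine ⟨y 0, hb, fun b hb0 i => ?_⟩
    have h1 := (h.locAC i).integral_eq_smul hb0
    have h2 : ∫ ξ in Ioc 0 b, w.toFun ξ i ⬝ᵥ p.1.rep ξ = ∫ ξ in Ioc 0 b, y ξ i := by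
      refine integral_congr_ae ?_
      filter_upwards [ae_restrict_of_ae_halfLine h.ae_eq b] with ξ hξ
      rw [hξ]; rfl
    rw [h2, h1]
    congr 1
    refine integral_congr_ae ?_
    filter_upwards [ae_restrict_of_ae_halfLine he b] with ξ hξ
    rw [hξ, smul_dotProduct, smul_eq_mul, zero_mulVec, add_zero]
    congr 1
    change d ξ i = (P₁⁻¹ *ᵥ (P₁ *ᵥ d ξ)) i
    rw [mulVec_mulVec, nonsing_inv_mul _ hdet, one_mulVec]
  · rintro ⟨c, hc, hbi⟩
    have hint : ∀ i b, IntegrableOn (fun ξ => (P₁⁻¹ *ᵥ p.2.rep ξ) i) (Ioc 0 b) := by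
      intro i b
      simp only [mulVec, dotProduct]
      exact integrable_finsetSum _ fun j _ => (p.2.integrableOn j b).const_mul _
    have hac := fun i => locAC_primitive (d := fun ξ => (P₁⁻¹ *ᵥ p.2.rep ξ) i)
      (fun b hb => (intervalIntegrable_iff_integrableOn_Ioc_of_le hb).2 (hint i b)) (c i)
    set y : ℝ → Fin n → ℂ := fun ξ i => c i + ∫ ζ in (0 : ℝ)..ξ, (P₁⁻¹ *ᵥ p.2.rep ζ) i with hy
    have hy0 : y 0 = c := by funext i; simp [hy]
    refine ⟨y, fun ξ => P₁⁻¹ *ᵥ p.2.rep ξ, IsACRep.of_locAC hac ?_, by rw [hy0, hc], ?_⟩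
    · have : ∀ i, (fun ξ => y ξ i) =ᵐ[halfLine] fun ξ => (w.toFun ξ *ᵥ p.1.rep ξ) i := by
        intro i
        refine ae_eq_of_integral_eq (fun b => ?_) (p.1.integrableOn_mul i) fun b hb0 => ?_
        · exact (((hac i).continuousOn.mono Icc_subset_Ici_self).integrableOn_Icc).mono_set
            Ioc_subset_Icc_self
        · refine ((hac i).integral_eq_smul hb0).trans ?_
          refine Eq.trans ?_ (hbi b hb0 i).symm
          simp only [intervalIntegral.integral_same, add_zero, smul_dotProduct, smul_eq_mul]
          rfl
      filter_upwards [ae_all_iff.2 this] with ξ h1 using funext h1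
    · refine Eventually.of_forall fun ξ => ?_
      simp only [zero_mulVec, add_zero]
      rw [mulVec_mulVec, mul_nonsing_inv _ hdet, one_mulVec]

/-- The equations at b = 1 determine c as a continuous function of the pair. After eliminating c,
the graph is an intersection of zero sets of continuous maps. -/
theorem isClosed_phGraph {m : ℕ} (w : Weight n) {P₁ : Matrix (Fin n) (Fin n) ℂ}
    (hP₁ : IsUnit P₁) (WB : Matrix (Fin m) (Fin n) ℂ) :
    IsClosed (phGraph w P₁ 0 WB : Set (L2W w × L2W w)) := by
  choose F hF using fun (b : ℝ) (i : Fin n) => exists_functional w (a := fun ξ => w.toFun ξ i)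
    (continuousOn_pi.2 fun j => w.continuousOn i j) b
  choose G hG using fun (b : ℝ) (i : Fin n) => exists_functional w
    (a := fun ξ => ((b : ℂ) - ξ) • P₁⁻¹ i) (by fun_prop) b
  have key : (phGraph w P₁ 0 WB : Set (L2W w × L2W w)) =
      {p | WB *ᵥ (fun i => F 1 i p.1 - G 1 i p.2) = 0} ∩ ⋂ b : ℝ, ⋂ (_ : 0 ≤ b), ⋂ i,
        {p | F b i p.1 = b * (F 1 i p.1 - G 1 i p.2) + G b i p.2} := by
    ext p
    rw [SetLike.mem_coe, mem_phGraph_iff w hP₁]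
    simp only [mem_inter_iff, mem_iInter, mem_ofPred_eq]
    constructor
    · rintro ⟨c, hc, h⟩
      have h' : ∀ b : ℝ, 0 ≤ b → ∀ i, F b i p.1 = b * c i + G b i p.2 := by
        intro b hb i
        rw [(hF b i p.1).2, (hG b i p.2).2]
        exact h b hb i
      have hc' : c = fun i => F 1 i p.1 - G 1 i p.2 := by
        funext i
        rw [h' 1 zero_le_one i]
        simp
      refine ⟨by rw [← hc', hc], fun b hb i => ?_⟩
      have := congrFun hc' i
      rw [h' b hb i, this]
    · rintro ⟨hc, h⟩
      refine ⟨_, hc, fun b hb i => ?_⟩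
      rw [← (hF b i p.1).2, ← (hG b i p.2).2]
      exact h b hb i
  rw [key]
  refine IsClosed.inter ?_ (isClosed_iInter fun b => isClosed_iInter fun _ =>
    isClosed_iInter fun i => ?_)
  · refine isClosed_eq ?_ continuous_const
    refine Continuous.matrix_mulVec continuous_const (continuous_pi fun i => ?_)
    fun_prop
  · exact isClosed_eq (by fun_prop) (by fun_prop)

/-! ### Diagonal weights -/

/-- A diagonal weight. -/
def diagWeight (ρ : Fin n → ℝ → ℝ) (hc : ∀ i, ContinuousOn (ρ i) (Ici 0))
    (hpos : ∀ i ξ, 0 ≤ ξ → 0 < ρ i ξ) : Weight n where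
  toFun ξ := Matrix.diagonal fun i => (ρ i ξ : ℂ)
  continuousOn i j := by
    by_cases hij : i = j
    · subst hij
      simp only [diagonal_apply_eq]
      exact Complex.continuous_ofReal.comp_continuousOn (hc i)
    · simp only [diagonal_apply_ne _ hij]
      exact continuousOn_const
  posDef ξ hξ := PosDef.diagonal fun i => by exact_mod_cast hpos i ξ hξ

section Diag

variable {ρ : Fin n → ℝ → ℝ} {hc : ∀ i, ContinuousOn (ρ i) (Ici 0)}
  {hpos : ∀ i ξ, 0 ≤ ξ → 0 < ρ i ξ}

theorem diagWeight_mulVec (v : Fin n → ℂ) (ξ : ℝ) (i : Fin n) :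
    ((diagWeight ρ hc hpos).toFun ξ *ᵥ v) i = ρ i ξ * v i := by
  simp [diagWeight, mulVec_diagonal]

theorem diagWeight_q (v : Fin n → ℂ) (ξ : ℝ) :
    (diagWeight ρ hc hpos).q v ξ = ∑ i, ρ i ξ * ‖v i‖ ^ 2 := by
  unfold Weight.q
  simp only [dotProduct, diagWeight_mulVec, Complex.re_sum, Pi.star_apply]
  refine Finset.sum_congr rfl fun i _ => ?_
  rw [mul_left_comm, Complex.re_ofReal_mul, Complex.star_def, Complex.conj_mul',
    ← Complex.ofReal_pow, Complex.ofReal_re]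

theorem aestronglyMeasurable_of_continuousOn {f : ℝ → ℝ} (hf : ContinuousOn f (Ici 0)) :
    AEStronglyMeasurable f halfLine :=
  (hf.mono Ioi_subset_Ici_self).aestronglyMeasurable measurableSet_Ioi

theorem diagWeight_aestronglyMeasurable (s : ℝ → ℝ) (hs : Measurable s) {x : ℝ → Fin n → ℂ}
    (hcρ : ∀ i, ContinuousOn (ρ i) (Ici 0)) (hx : AEStronglyMeasurable x halfLine) :
    AEStronglyMeasurable (fun ξ i => ((s (ρ i ξ) : ℝ) : ℂ) * x ξ i) halfLine := by
  refine AEMeasurable.aestronglyMeasurable (aemeasurable_pi_lambda _ fun i => ?_)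
  have h1 := (aestronglyMeasurable_of_continuousOn (hcρ i)).aemeasurable
  exact (Complex.measurable_ofReal.comp_aemeasurable (hs.comp_aemeasurable h1)).mul
    (hx.aemeasurable.eval i)

/-- Multiplying the i-th coordinate by √ρᵢ is an isometry onto the unweighted space L²((0,∞); ℂⁿ),
with inverse given by 1/√ρᵢ. -/
instance completeSpace_diagWeight : CompleteSpace (L2W (diagWeight ρ hc hpos)) := by
  set w := diagWeight ρ hc hpos
  let F : (ℝ → Fin n → ℂ) → ℝ → EuclideanSpace ℂ (Fin n) := fun x ξ =>
    WithLp.toLp 2 fun i => ((Real.sqrt (ρ i ξ) : ℝ) : ℂ) * x ξ i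
  have hFm : ∀ x : L2W w, AEStronglyMeasurable (F x.rep) halfLine := fun x =>
    (PiLp.continuous_toLp 2 _).comp_aestronglyMeasurable
      (diagWeight_aestronglyMeasurable Real.sqrt Real.continuous_sqrt.measurable hc
        x.aestronglyMeasurable)
  have hFn : ∀ (x : ℝ → Fin n → ℂ) ξ, 0 ≤ ξ → ‖F x ξ‖ ^ 2 = w.q (x ξ) ξ := by
    intro x ξ hξ
    rw [EuclideanSpace.norm_sq_eq, diagWeight_q]
    refine Finset.sum_congr rfl fun i _ => ?_
    simp only [F]
    rw [norm_mul, mul_pow, Complex.norm_real, Real.norm_eq_abs, sq_abs,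
      Real.sq_sqrt (hpos i ξ hξ).le]
  have hL : ∀ x : L2W w, MemLp (F x.rep) 2 halfLine := by
    intro x
    rw [memLp_two_iff_integrable_sq_norm (hFm x)]
    refine x.integrable_q.congr ?_
    filter_upwards [ae_halfLine_pos] with ξ hξ using (hFn _ ξ hξ.le).symm
  let J : L2W w →ₗ[ℂ] Lp (EuclideanSpace ℂ (Fin n)) 2 halfLine :=
    { toFun := fun x => (hL x).toLp
      map_add' := by
        intro x y
        rw [← MemLp.toLp_add, MemLp.toLp_eq_toLp_iff]
        filter_upwards [x.rep_add y] with ξ h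
        ext i
        simp [F, h, mul_add]
      map_smul' := by
        intro c x
        rw [RingHom.id_apply, ← MemLp.toLp_const_smul, MemLp.toLp_eq_toLp_iff]
        filter_upwards [x.rep_smul c] with ξ h
        ext i
        simp [F, h, mul_left_comm] }
  have hJn : ∀ x, ‖J x‖ = ‖x‖ := by
    intro x
    have h1 : ‖J x‖ ^ 2 = ‖x‖ ^ 2 := by
      rw [L2W.norm_sq_eq]
      have h2 : inner ℂ (J x) (J x) = ((∫ ξ, w.q (x.rep ξ) ξ ∂halfLine : ℝ) : ℂ) := by
        rw [L2.inner_def, ← integral_complex_ofReal]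
        refine integral_congr_ae ?_
        filter_upwards [(hL x).coeFn_toLp, ae_halfLine_pos] with ξ h hξ
        change inner ℂ (MemLp.toLp _ (hL x) ξ) (MemLp.toLp _ (hL x) ξ) = _
        rw [h, inner_self_eq_norm_sq_to_K, ← hFn _ ξ hξ.le]
        simp
      rw [inner_self_eq_norm_sq_to_K] at h2
      exact Complex.ofReal_injective (by simpa using h2)
    exact (pow_left_inj₀ (norm_nonneg _) (norm_nonneg _) two_ne_zero).1 h1
  let Ji : L2W w →ₗᵢ[ℂ] Lp (EuclideanSpace ℂ (Fin n)) 2 halfLine := ⟨J, hJn⟩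
  refine (Ji.isometry.isUniformInducing.completeSpace_congr ?_).2 inferInstance
  intro f
  let x : ℝ → Fin n → ℂ := fun ξ i => (((Real.sqrt (ρ i ξ))⁻¹ : ℝ) : ℂ) * f ξ i
  have hxm : AEStronglyMeasurable x halfLine :=
    diagWeight_aestronglyMeasurable (x := fun ξ i => f ξ i) (fun t => (Real.sqrt t)⁻¹)
      Real.continuous_sqrt.measurable.inv hc
      ((PiLp.continuous_ofLp 2 _).comp_aestronglyMeasurable (Lp.aestronglyMeasurable f))
  have hFx : ∀ ξ, 0 ≤ ξ → F x ξ = f ξ := by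
    intro ξ hξ
    ext i
    simp only [F, x]
    rw [← mul_assoc, ← Complex.ofReal_mul, mul_inv_cancel₀
      (Real.sqrt_pos.2 (hpos i ξ hξ)).ne', Complex.ofReal_one, one_mul]
  have hxi : Integrable (fun ξ => w.q (x ξ) ξ) halfLine := by
    have h1 := (memLp_two_iff_integrable_sq_norm (Lp.aestronglyMeasurable f)).1 (Lp.memLp f)
    refine h1.congr ?_
    filter_upwards [ae_halfLine_pos] with ξ hξ
    rw [← hFn _ ξ hξ.le, hFx ξ hξ.le]
  refine ⟨L2W.of w x hxm hxi, ?_⟩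
  refine Lp.ext ?_
  refine (hL _).coeFn_toLp.trans ?_
  filter_upwards [L2W.rep_of hxm hxi, ae_halfLine_pos] with ξ h hξ
  rw [← hFx ξ hξ.le]
  ext i
  simp only [F, h]

/-! ### The energy identity -/

theorem mem_Ioi_atTop_integrableAtFilter {f : ℝ → ℂ} (hf : Integrable f halfLine) {L : ℂ}
    (hL : Tendsto f atTop (𝓝 L)) : L = 0 := by
  have h1 : IntegrableAtFilter f atTop volume := ⟨Ioi 0, Ioi_mem_atTop 0, hf⟩
  refine h1.eq_zero_of_tendsto ?_ hL
  intro s hs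
  obtain ⟨a, ha⟩ := mem_atTop_sets.1 hs
  refine measure_mono_top (s₁ := Ici a) (fun x hx => ha x hx) ?_
  simp

/-- The function E = ∑ pᵢ |yᵢ|² has the integrable derivative 2 Re of the form of g and h, so it
converges at infinity. It is itself integrable, because |yᵢ|² = ρᵢ² |gᵢ|² ≤ M ρᵢ |gᵢ|²; its limit is
therefore 0 and only -E(0) remains. The upper bound on ρ is what removes the contribution at
infinity. -/
theorem energy_identity {M : ℝ} (hM : ∀ i ξ, 0 ≤ ξ → ρ i ξ ≤ M) (p : Fin n → ℝ)
    {g h : L2W (diagWeight ρ hc hpos)} {y d : ℝ → Fin n → ℂ} (hy : IsACRep g y d)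
    (hh : h.rep =ᵐ[halfLine] fun ξ i => p i * d ξ i) :
    (inner ℂ g h).re = -(1 / 2) * ∑ i, p i * ‖y 0 i‖ ^ 2 := by
  set E : ℝ → ℂ := fun ξ => ∑ i, (p i : ℂ) * (star (y ξ i) * y ξ i)
  have hyi : ∀ᵐ ξ ∂halfLine, ∀ i, y ξ i = ρ i ξ * g.rep ξ i := by
    filter_upwards [hy.ae_eq] with ξ h1 i
    rw [h1, diagWeight_mulVec]
  have hE := LocAC.sum Finset.univ fun i =>
    LocAC.const_mul (p i : ℂ) ((hy.locAC i).conj.mul (hy.locAC i))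
  have hE' : LocAC E (fun ξ => star ((diagWeight ρ hc hpos).form g.rep h.rep ξ) + (diagWeight ρ hc hpos).form g.rep h.rep ξ) := by
    refine hE.congr_deriv ?_
    filter_upwards [hyi, hh] with ξ h1 h2
    simp only [Weight.form, dotProduct, star_sum, ← Finset.sum_add_distrib]
    refine Finset.sum_congr rfl fun i _ => ?_
    rw [diagWeight_mulVec, h2, h1 i]
    simp only [Pi.star_apply, star_mul', Complex.star_def, Complex.conj_ofReal, Complex.conj_conj]
    ring
  have hint : Integrable (fun ξ => star ((diagWeight ρ hc hpos).form g.rep h.rep ξ) + (diagWeight ρ hc hpos).form g.rep h.rep ξ)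
      halfLine := by
    have h1 := L2W.integrable_form g h
    refine Integrable.add ?_ h1
    exact (Complex.conjCLE : ℂ →L[ℝ] ℂ).integrable_comp h1
  have hEint : Integrable E halfLine := by
    have hm : AEStronglyMeasurable E halfLine :=
      (hE.continuousOn.mono Ioi_subset_Ici_self).aestronglyMeasurable measurableSet_Ioi
    refine Integrable.mono' (g.integrable_q.const_mul (M * ∑ i, |p i|)) hm ?_
    filter_upwards [hyi, ae_halfLine_pos] with ξ h1 hξ
    rw [diagWeight_q, mul_assoc, Finset.sum_mul, Finset.mul_sum]
    refine (norm_sum_le _ _).trans (Finset.sum_le_sum fun i _ => ?_)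
    rw [norm_mul, norm_mul, norm_star, Complex.norm_real, Real.norm_eq_abs, h1 i, norm_mul,
      Complex.norm_real, Real.norm_eq_abs, abs_of_pos (hpos i ξ hξ.le)]
    have h2 : ρ i ξ * ‖g.rep ξ i‖ ^ 2 ≤ ∑ j, ρ j ξ * ‖g.rep ξ j‖ ^ 2 :=
      Finset.single_le_sum (f := fun j => ρ j ξ * ‖g.rep ξ j‖ ^ 2)
        (fun j _ => mul_nonneg (hpos j ξ hξ.le).le (sq_nonneg _)) (Finset.mem_univ i)
    have h3 := hpos i ξ hξ.le
    calc |p i| * (ρ i ξ * ‖g.rep ξ i‖ * (ρ i ξ * ‖g.rep ξ i‖))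
        = ρ i ξ * (|p i| * (ρ i ξ * ‖g.rep ξ i‖ ^ 2)) := by ring
      _ ≤ M * (|p i| * ∑ j, ρ j ξ * ‖g.rep ξ j‖ ^ 2) := by
          refine mul_le_mul (hM i ξ hξ.le) (mul_le_mul_of_nonneg_left h2 (abs_nonneg _))
            (by positivity) (h3.le.trans (hM i ξ hξ.le))
  have hlim : Tendsto E atTop (𝓝 (E 0 + ∫ ξ, (star ((diagWeight ρ hc hpos).form g.rep h.rep ξ) +
      (diagWeight ρ hc hpos).form g.rep h.rep ξ) ∂halfLine)) := by
    have h1 := (intervalIntegral_tendsto_integral_Ioi 0 hint tendsto_id).const_add (E 0)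
    refine h1.congr' ?_
    filter_upwards [eventually_ge_atTop 0] with b hb
    rw [id, hE'.integral_eq hb]
    ring
  have h0 := mem_Ioi_atTop_integrableAtFilter hEint hlim
  have h1 : ∫ ξ, (star ((diagWeight ρ hc hpos).form g.rep h.rep ξ) + (diagWeight ρ hc hpos).form g.rep h.rep ξ) ∂halfLine =
      star (inner ℂ g h) + inner ℂ g h := by
    rw [integral_add _ (L2W.integrable_form g h), L2W.inner_eq]
    · congr 1
      exact integral_conj
    · exact (Complex.conjCLE : ℂ →L[ℝ] ℂ).integrable_comp (L2W.integrable_form g h)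
  have h2 : E 0 = ((∑ i, p i * ‖y 0 i‖ ^ 2 : ℝ) : ℂ) := by
    simp only [E, Complex.star_def, Complex.conj_mul']
    push_cast
    rfl
  rw [h1, h2] at h0
  have h3 := congrArg Complex.re h0
  rw [Complex.add_re, Complex.ofReal_re, Complex.add_re, Complex.star_def, Complex.conj_re,
    Complex.zero_re] at h3
  linarith

end Diag

/-! ### The resolvent equation of a diagonal operator -/

section Scalar

/-- The travel time `∫_0^ξ r⁻¹`. -/
def travelTime (r : ℝ → ℝ) (ξ : ℝ) : ℝ := ∫ ζ in (0 : ℝ)..ξ, (r ζ)⁻¹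

variable {r : ℝ → ℝ}

theorem hasDerivAt_travelTime (hr : Continuous r) (hr0 : ∀ ξ, 0 < r ξ)
    (ξ : ℝ) : HasDerivAt (travelTime r) (r ξ)⁻¹ ξ := by
  have hc : Continuous fun ζ => (r ζ)⁻¹ := hr.inv₀ fun ξ => (hr0 ξ).ne'
  exact intervalIntegral.integral_hasDerivAt_right (hc.intervalIntegrable _ _)
    (hc.stronglyMeasurableAtFilter _ _) hc.continuousAt

theorem hasDerivAt_exp_travelTime (hr : Continuous r) (hr0 : ∀ ξ, 0 < r ξ)
    (a ξ : ℝ) :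
    HasDerivAt (fun ζ => Real.exp (a * travelTime r ζ))
      (a * (r ξ)⁻¹ * Real.exp (a * travelTime r ξ)) ξ := by
  refine (((hasDerivAt_travelTime hr hr0 ξ).const_mul a).exp).congr_deriv ?_
  ring

theorem locAC_exp_travelTime (hr : Continuous r) (hr0 : ∀ ξ, 0 < r ξ)
    (a : ℝ) :
    LocAC (fun ζ => ((Real.exp (a * travelTime r ζ) : ℝ) : ℂ))
      (fun ξ => ((a * (r ξ)⁻¹ * Real.exp (a * travelTime r ξ) : ℝ) : ℂ)) := by
  have hd : ∀ ξ, HasDerivAt (fun ζ => ((Real.exp (a * travelTime r ζ) : ℝ) : ℂ))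
      ((a * (r ξ)⁻¹ * Real.exp (a * travelTime r ξ) : ℝ) : ℂ) ξ := fun ξ =>
    (hasDerivAt_exp_travelTime hr hr0 a ξ).ofReal_comp
  have hcE : Continuous fun ζ => Real.exp (a * travelTime r ζ) :=
    continuous_iff_continuousAt.2 fun ξ => (hasDerivAt_exp_travelTime hr hr0 a ξ).continuousAt
  have hcr : Continuous fun ζ => (r ζ)⁻¹ := hr.inv₀ fun ξ => (hr0 ξ).ne'
  refine (locAC_of_contDiffOn (ContDiff.contDiffOn ?_)).congr_deriv ?_
  · rw [contDiff_one_iff_deriv]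
    refine ⟨fun ξ => (hd ξ).differentiableAt, ?_⟩
    rw [funext fun ξ => (hd ξ).deriv]
    exact Complex.continuous_ofReal.comp ((continuous_const.mul hcr).mul hcE)
  · filter_upwards [ae_halfLine_pos] with ξ hξ
    exact (hd ξ).hasDerivWithinAt.derivWithin (uniqueDiffOn_Ici 0 ξ hξ.le)

/-- The integrand is the nonnegative derivative of a⁻¹ e^{aτ}, with τ the travel time, and τ(ξ) ≥ ξ
/ M tends to infinity. -/
theorem integrableOn_exp_travelTime (hr : Continuous r) (hr0 : ∀ ξ, 0 < r ξ)
    {M : ℝ} (hM : ∀ ξ, 0 ≤ ξ → r ξ ≤ M) {a : ℝ} (ha : a < 0)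
    {R : ℝ} : IntegrableOn (fun ξ => (r ξ)⁻¹ * Real.exp (a * travelTime r ξ)) (Ioi R) := by
  have hM0 : 0 < M := (hr0 0).trans_le (hM 0 le_rfl)
  have htop : Tendsto (travelTime r) atTop atTop := by
    have h1 : Tendsto (fun ξ : ℝ => M⁻¹ * ξ) atTop atTop :=
      tendsto_id.const_mul_atTop (inv_pos.2 hM0)
    refine tendsto_atTop_mono' _ ?_ h1
    filter_upwards [eventually_ge_atTop 0] with ξ hξ
    have hc : Continuous fun ζ => (r ζ)⁻¹ := hr.inv₀ fun ξ => (hr0 ξ).ne'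
    have := intervalIntegral.integral_mono_on hξ
      (intervalIntegrable_const (μ := volume) (c := M⁻¹))
      (hc.intervalIntegrable 0 ξ) fun ζ hζ => inv_anti₀ (hr0 ζ) (hM ζ hζ.1)
    simpa [mul_comm, travelTime] using this
  have hlim : Tendsto (fun ξ => a⁻¹ * Real.exp (a * travelTime r ξ)) atTop (𝓝 (a⁻¹ * 0)) := by
    refine Tendsto.const_mul _ (Real.tendsto_exp_atBot.comp ?_)
    exact htop.const_mul_atTop_of_neg ha
  have hd : ∀ ξ, HasDerivAt (fun ξ => a⁻¹ * Real.exp (a * travelTime r ξ))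
      ((r ξ)⁻¹ * Real.exp (a * travelTime r ξ)) ξ := by
    intro ξ
    refine ((hasDerivAt_exp_travelTime hr hr0 a ξ).const_mul a⁻¹).congr_deriv ?_
    rw [mul_assoc, ← mul_assoc, inv_mul_cancel₀ ha.ne, one_mul]
  exact integrableOn_Ioi_deriv_of_nonneg (hd R).continuousAt.continuousWithinAt
    (fun ξ _ => hd ξ) (fun ξ _ => by have := hr0 ξ; positivity) hlim

/-- The equation `p y' = (l / r) y - f` has a square integrable solution when `f` vanishes near
infinity. For `p < 0` the value at `0` is arbitrary. -/
theorem exists_solution_scalar (hr : Continuous r) (hr0 : ∀ ξ, 0 < r ξ)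
    {M : ℝ} (hM : ∀ ξ, 0 ≤ ξ → r ξ ≤ M) {p l : ℝ} (hp : p ≠ 0)
    (hl : 0 < l) {f : ℝ → ℂ} (hf : ∀ b, IntegrableOn f (Ioc 0 b)) {R : ℝ} (hR : 0 ≤ R)
    (hfR : ∀ᵐ ξ ∂halfLine, R < ξ → f ξ = 0) :
    ∃ a : ℂ, (R = 0 → a = 0) ∧ ∀ c : ℂ, (0 < p → c = a) → ∃ y d : ℝ → ℂ, LocAC y d ∧ y 0 = c ∧
      (∀ᵐ ξ ∂halfLine, (p : ℂ) * d ξ = l * ((r ξ : ℂ)⁻¹ * y ξ) - f ξ) ∧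
      Integrable (fun ξ => (r ξ)⁻¹ * ‖y ξ‖ ^ 2) halfLine := by
  -- Variation of constants: e^{kτ} with k = l / p solves the homogeneous equation, and y = e^{kτ} v
  -- reduces the problem to v' = -p⁻¹ e^{-kτ} f.
  set k : ℝ := l / p
  set E : ℝ → ℂ := fun ζ => ((Real.exp (k * travelTime r ζ) : ℝ) : ℂ)
  set E' : ℝ → ℂ := fun ζ => ((Real.exp (-k * travelTime r ζ) : ℝ) : ℂ)
  have hEac := locAC_exp_travelTime hr hr0 k
  have hE'ac := locAC_exp_travelTime hr hr0 (-k)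
  have hEE' : ∀ ξ, E ξ * E' ξ = 1 := by
    intro ξ
    simp only [E, E']
    rw [← Complex.ofReal_mul, ← Real.exp_add]
    simp
  have hE0 : E 0 = 1 := by simp [E, travelTime]
  set φ : ℝ → ℂ := fun ξ => -((p : ℂ)⁻¹ * (E' ξ * f ξ))
  have hφ : ∀ b : ℝ, 0 ≤ b → IntervalIntegrable φ volume 0 b := by
    intro b hb
    have h1 : IntervalIntegrable f volume 0 b :=
      (intervalIntegrable_iff_integrableOn_Ioc_of_le hb).2 (hf b)
    refine ((h1.continuousOn_mul ?_).const_mul _).neg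
    refine hE'ac.continuousOn.mono ?_
    rw [uIcc_of_le hb]; exact Icc_subset_Ici_self
  have hφR : ∀ ξ, R ≤ ξ → ∫ ζ in (0 : ℝ)..ξ, φ ζ = ∫ ζ in (0 : ℝ)..R, φ ζ := by
    intro ξ hξ
    rw [← sub_eq_zero, intervalIntegral.integral_interval_sub_left (hφ ξ (hR.trans hξ)) (hφ R hR),
      intervalIntegral.integral_of_le hξ]
    refine integral_eq_zero_of_ae ?_
    have h1 : ∀ᵐ ζ ∂volume.restrict (Ioc R ξ), R < ζ → f ζ = 0 :=
      ae_restrict_of_ae_restrict_of_subset (fun ζ hζ => hR.trans_lt hζ.1) hfR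
    filter_upwards [h1, ae_restrict_mem measurableSet_Ioc] with ζ h2 h3
    simp [φ, h2 h3.1]
  -- Beyond R the factor v is constant. If p > 0 the exponential grows, and this initial value is
  -- the one for which v vanishes there; if p < 0 the exponential decays and any initial value is
  -- admissible.
  refine ⟨-∫ ζ in (0 : ℝ)..R, φ ζ, fun h => by simp [h], fun c hcp => ?_⟩
  have hv := locAC_primitive hφ c
  set v : ℝ → ℂ := fun ξ => c + ∫ ζ in (0 : ℝ)..ξ, φ ζ
  have hy := hEac.mul hv
  refine ⟨_, _, hy, by simp [travelTime, v], Eventually.of_forall fun ξ => ?_, ?_⟩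
  · change (p : ℂ) * (((k * (r ξ)⁻¹ * Real.exp (k * travelTime r ξ) : ℝ) : ℂ) * v ξ + E ξ * φ ξ) =
      l * ((r ξ : ℂ)⁻¹ * (E ξ * v ξ)) - f ξ
    have hp' : (p : ℂ) ≠ 0 := by exact_mod_cast hp
    have hk : (p : ℂ) * (k : ℂ) = l := by
      simp only [k]
      push_cast
      field_simp
    have e1 : E ξ * φ ξ = -((p : ℂ)⁻¹ * f ξ) := by
      simp only [φ]
      linear_combination (-((p : ℂ)⁻¹ * f ξ)) * hEE' ξ
    rw [e1]
    simp only [Complex.ofReal_mul, Complex.ofReal_inv]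
    change (p : ℂ) * ((k : ℂ) * (r ξ : ℂ)⁻¹ * E ξ * v ξ + -((p : ℂ)⁻¹ * f ξ)) = _
    have hpi : (p : ℂ) * (p : ℂ)⁻¹ = 1 := mul_inv_cancel₀ hp'
    linear_combination ((r ξ : ℂ)⁻¹ * E ξ * v ξ) * hk - f ξ * hpi
  · change Integrable (fun ξ => (r ξ)⁻¹ * ‖E ξ * v ξ‖ ^ 2) halfLine
    rw [← IntegrableOn, ← Ioc_union_Ioi_eq_Ioi hR]
    have hcr : Continuous fun ζ => (r ζ)⁻¹ := hr.inv₀ fun ξ => (hr0 ξ).ne'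
    refine IntegrableOn.union ?_ ?_
    · have h1 : ContinuousOn (fun ξ => (r ξ)⁻¹ * ‖E ξ * v ξ‖ ^ 2) (Icc 0 R) :=
        hcr.continuousOn.mul ((hy.continuousOn.mono Icc_subset_Ici_self).norm.pow 2)
      exact h1.integrableOn_Icc.mono_set Ioc_subset_Icc_self
    · rcases hp.lt_or_gt with hneg | hpos
      · have hk : 2 * k < 0 := by
          have : k < 0 := div_neg_of_pos_of_neg hl hneg
          linarith
        have h1 := (integrableOn_exp_travelTime hr hr0 hM hk (R := R)).mul_const (‖v R‖ ^ 2)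
        refine h1.congr ?_
        filter_upwards [ae_restrict_mem measurableSet_Ioi] with ξ hξ
        have hvξ : v ξ = v R := by simp only [v]; rw [hφR ξ (le_of_lt hξ)]
        rw [hvξ, norm_mul, mul_pow, Complex.norm_real, Real.norm_eq_abs, sq_abs, ← Real.exp_nat_mul,
          mul_assoc]
        congr 3
        push_cast
        ring
      · refine integrableOn_zero.congr ?_
        filter_upwards [ae_restrict_mem measurableSet_Ioi] with ξ hξ
        have hvξ : v ξ = 0 := by
          simp only [v]
          rw [hφR ξ (le_of_lt hξ), hcp hpos]
          ring
        simp [hvξ]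

end Scalar

section Vector

variable {ρ : Fin n → ℝ → ℝ} {hc : ∀ i, ContinuousOn (ρ i) (Ici 0)}
  {hpos : ∀ i ξ, 0 ≤ ξ → 0 < ρ i ξ}

/-- Solvability of the resolvent equation `l g - P₁ (W g)' = f` for diagonal `P₁` and `W`, when
`f` vanishes near infinity. -/
theorem exists_solution {M : ℝ} (hM : ∀ i ξ, 0 ≤ ξ → ρ i ξ ≤ M) {p : Fin n → ℝ}
    (hp : ∀ i, p i ≠ 0) {l : ℝ} (hl : 0 < l) (f : L2W (diagWeight ρ hc hpos)) {R : ℝ}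
    (hR : 0 ≤ R) (hfR : ∀ᵐ ξ ∂halfLine, R < ξ → f.rep ξ = 0) :
    ∃ a : Fin n → ℂ, (R = 0 → a = 0) ∧ ∀ c : Fin n → ℂ, (∀ i, 0 < p i → c i = a i) →
      ∃ (g : L2W (diagWeight ρ hc hpos)) (y d : ℝ → Fin n → ℂ), IsACRep g y d ∧ y 0 = c ∧
        ∀ᵐ ξ ∂halfLine, ∀ i, (p i : ℂ) * d ξ i = l * g.rep ξ i - f.rep ξ i := by
  -- Each ρᵢ is continued to negative arguments by its value at 0, which provides the globally
  -- continuous positive function that the scalar equation requires.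
  let r : Fin n → ℝ → ℝ := fun i ξ => ρ i (max ξ 0)
  have hr : ∀ i, Continuous (r i) := fun i =>
    (hc i).comp_continuous (by fun_prop) fun ξ => mem_Ici.2 (le_max_right _ _)
  have hr0 : ∀ i ξ, 0 < r i ξ := fun i ξ => hpos i _ (le_max_right _ _)
  have hrρ : ∀ i ξ, 0 ≤ ξ → r i ξ = ρ i ξ := fun i ξ hξ => by simp [r, hξ]
  have hsol := fun i => exists_solution_scalar (hr i) (hr0 i)
    (fun ξ hξ => (hrρ i ξ hξ).trans_le (hM i ξ hξ)) (hp i) hl (f.integrableOn i) hR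
    (hfR.mono fun ξ h hξ => by rw [h hξ]; rfl)
  choose a ha0 ha using hsol
  refine ⟨a, fun h => funext fun i => ha0 i h, fun c hca => ?_⟩
  choose y d hyd hy0 heq hint using fun i => ha i (c i) (hca i)
  let g₀ : ℝ → Fin n → ℂ := fun ξ i => (((r i ξ)⁻¹ : ℝ) : ℂ) * y i ξ
  have hm : AEStronglyMeasurable g₀ halfLine := by
    refine AEMeasurable.aestronglyMeasurable (aemeasurable_pi_lambda _ fun i => ?_)
    refine AEMeasurable.mul ?_ ?_
    · exact (Complex.continuous_ofReal.comp
        ((hr i).inv₀ fun ξ => (hr0 i ξ).ne')).measurable.aemeasurable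
    · exact ((hyd i).continuousOn.mono Ioi_subset_Ici_self).aemeasurable measurableSet_Ioi
  have hi : Integrable (fun ξ => (diagWeight ρ hc hpos).q (g₀ ξ) ξ) halfLine := by
    have h1 : Integrable (fun ξ => ∑ i, (r i ξ)⁻¹ * ‖y i ξ‖ ^ 2) halfLine :=
      integrable_finsetSum _ fun i _ => hint i
    refine h1.congr ?_
    filter_upwards [ae_halfLine_pos] with ξ hξ
    rw [diagWeight_q]
    refine Finset.sum_congr rfl fun i _ => ?_
    have h2 := hr0 i ξ
    simp only [g₀]
    rw [← hrρ i ξ hξ.le, norm_mul, Complex.norm_real, Real.norm_eq_abs,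
      abs_of_pos (inv_pos.2 h2)]
    field_simp
  refine ⟨L2W.of _ g₀ hm hi, fun ξ i => y i ξ, fun ξ i => d i ξ, IsACRep.of_locAC hyd ?_,
    funext hy0, ?_⟩
  · filter_upwards [L2W.rep_of hm hi, ae_halfLine_pos] with ξ h hξ
    rw [h]
    funext i
    rw [diagWeight_mulVec, ← hrρ i ξ hξ.le]
    simp only [g₀]
    rw [← mul_assoc, ← Complex.ofReal_mul, mul_inv_cancel₀ (hr0 i ξ).ne', Complex.ofReal_one,
      one_mul]
  · filter_upwards [L2W.rep_of hm hi, ae_all_iff.2 heq] with ξ h h2 i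
    rw [h, h2 i]
    simp [g₀]

/-- Truncation to a bounded interval. -/
theorem L2W.exists_truncation {w : Weight n} (f : L2W w) :
    ∃ F : ℕ → L2W w, Tendsto F atTop (𝓝 f) ∧
      ∀ k : ℕ, ∀ᵐ ξ ∂halfLine, (k : ℝ) < ξ → (F k).rep ξ = 0 := by
  have hm : ∀ k : ℕ, AEStronglyMeasurable ((Iic (k : ℝ)).indicator f.rep) halfLine := fun k =>
    f.aestronglyMeasurable.indicator measurableSet_Iic
  have hq : ∀ k : ℕ, (fun ξ => w.q ((Iic (k : ℝ)).indicator f.rep ξ) ξ) =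
      (Iic (k : ℝ)).indicator fun ξ => w.q (f.rep ξ) ξ := by
    intro k
    funext ξ
    by_cases h : ξ ∈ Iic (k : ℝ)
    · rw [indicator_of_mem h, indicator_of_mem h]
    · rw [indicator_of_notMem h, indicator_of_notMem h, w.q_zero]
  have hi : ∀ k : ℕ, Integrable (fun ξ => w.q ((Iic (k : ℝ)).indicator f.rep ξ) ξ) halfLine := by
    intro k
    rw [hq]
    exact f.integrable_q.indicator measurableSet_Iic
  refine ⟨fun k => L2W.of w _ (hm k) (hi k), ?_, fun k => ?_⟩
  · rw [tendsto_iff_norm_sub_tendsto_zero]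
    have h1 : Tendsto (fun k : ℕ => ‖L2W.of w _ (hm k) (hi k) - f‖ ^ 2) atTop (𝓝 0) := by
      have h2 : Tendsto (fun k : ℕ => ∫ ξ, (Ioi (k : ℝ)).indicator (fun ξ => w.q (f.rep ξ) ξ) ξ
          ∂halfLine) atTop (𝓝 (∫ _ : ℝ, (0 : ℝ) ∂halfLine)) := by
        refine tendsto_integral_of_dominated_convergence (fun ξ => ‖w.q (f.rep ξ) ξ‖)
          (fun k => (f.integrable_q.indicator measurableSet_Ioi).aestronglyMeasurable)
          f.integrable_q.norm (fun k => Eventually.of_forall fun ξ => norm_indicator_le_norm_self _ _)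
          (Eventually.of_forall fun ξ => ?_)
        refine tendsto_const_nhds.congr' ?_
        obtain ⟨N, hN⟩ := exists_nat_ge ξ
        filter_upwards [eventually_ge_atTop N] with k hk
        rw [indicator_of_notMem]
        simp only [mem_Ioi, not_lt]
        exact hN.trans (by exact_mod_cast hk)
      rw [integral_zero] at h2
      refine h2.congr fun k => ?_
      rw [L2W.norm_sq_eq]
      refine integral_congr_ae ?_
      have h3 : L2W.of w _ (hm k) (hi k) - f = L2W.of w _ (hm k) (hi k) + (-1 : ℂ) • f := by
        rw [neg_one_smul, sub_eq_add_neg]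
      rw [h3]
      filter_upwards [L2W.rep_of (hm k) (hi k), L2W.rep_add (L2W.of w _ (hm k) (hi k))
        ((-1 : ℂ) • f), L2W.rep_smul (-1 : ℂ) f] with ξ h4 h5 h6
      rw [h5, h4, h6]
      by_cases h : ξ ∈ Iic (k : ℝ)
      · rw [indicator_of_mem h, indicator_of_notMem (by simpa using h), neg_one_smul,
          add_neg_cancel, w.q_zero]
      · rw [indicator_of_notMem h, indicator_of_mem (by simpa using h), zero_add]
        simp [Weight.q, mulVec_neg]
    have h2 := h1.sqrt
    simpa [Real.sqrt_sq (norm_nonneg _)] using h2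
  · filter_upwards [L2W.rep_of (hm k) (hi k)] with ξ h hξ
    rw [h, indicator_of_notMem (by simpa using hξ)]

theorem L2W.rep_sub {w : Weight n} (x y : L2W w) :
    (x - y).rep =ᵐ[halfLine] fun ξ => x.rep ξ - y.rep ξ := AEEqFun.coeFn_sub x.toAE y.toAE

/-- The first order operator with diagonal coefficients and a dissipative boundary condition
is maximal dissipative. -/
theorem diag_surjective {m : ℕ} {M : ℝ} (hM : ∀ i ξ, 0 ≤ ξ → ρ i ξ ≤ M) {p : Fin n → ℝ}
    (hp : ∀ i, p i ≠ 0) {V : Matrix (Fin m) (Fin n) ℂ}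
    (hdiss : ∀ q ∈ phGraph (diagWeight ρ hc hpos) (Matrix.diagonal fun i => (p i : ℂ)) 0 V,
      (inner ℂ q.1 q.2).re ≤ 0)
    (hV : ∀ a : Fin n → ℂ, ∃ c, (∀ i, 0 < p i → c i = a i) ∧ V *ᵥ c = 0) {l : ℝ} (hl : 0 < l)
    (f : L2W (diagWeight ρ hc hpos)) :
    ∃ q ∈ phGraph (diagWeight ρ hc hpos) (Matrix.diagonal fun i => (p i : ℂ)) 0 V,
      (l : ℂ) • q.1 - q.2 = f := by
  set Γ := phGraph (diagWeight ρ hc hpos) (Matrix.diagonal fun i => (p i : ℂ)) 0 V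
  obtain ⟨F, hFf, hF0⟩ := f.exists_truncation
  -- For truncated right sides the positive coordinates at 0 are forced, and `hV` supplies the
  -- remaining ones so that the boundary condition holds.
  have hF : ∀ k, ∃ g, (g, (l : ℂ) • g - F k) ∈ Γ := by
    intro k
    obtain ⟨a, -, ha⟩ := exists_solution hM hp hl (F k) (Nat.cast_nonneg k) (hF0 k)
    obtain ⟨c, hca, hVc⟩ := hV a
    obtain ⟨g, y, d, hy, hy0, heq⟩ := ha c hca
    refine ⟨g, y, d, hy, by rw [hy0, hVc], ?_⟩
    filter_upwards [L2W.rep_sub ((l : ℂ) • g) (F k), L2W.rep_smul (l : ℂ) g, heq] with ξ h1 h2 h3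
    simp only [h1, h2, zero_mulVec, add_zero]
    funext i
    rw [mulVec_diagonal, h3 i]
    rfl
  choose g hg using hF
  -- Dissipativity turns convergence of the truncations into convergence of the solutions; the limit
  -- stays in the graph because the graph is closed.
  have hbd : ∀ j k, l * ‖g j - g k‖ ≤ ‖F j - F k‖ := by
    intro j k
    have h1 := Γ.sub_mem (hg j) (hg k)
    have h2 := norm_le_of_dissipative (w := 0) ((hdiss _ h1).trans_eq (zero_mul _).symm) l
    simp only [Prod.fst_sub, Prod.snd_sub, sub_zero] at h2
    refine h2.trans_eq ?_
    congr 1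
    rw [smul_sub]
    abel
  have hgc : CauchySeq g := by
    have hFc : CauchySeq F := hFf.cauchySeq
    rw [Metric.cauchySeq_iff] at hFc ⊢
    intro ε hε
    obtain ⟨N, hN⟩ := hFc (l * ε) (by positivity)
    refine ⟨N, fun j hj k hk => ?_⟩
    have h1 := hN j hj k hk
    rw [dist_eq_norm] at h1 ⊢
    exact lt_of_mul_lt_mul_left ((hbd j k).trans_lt h1) hl.le
  obtain ⟨g', hg'⟩ := cauchySeq_tendsto_of_complete hgc
  have hclosed : IsClosed (Γ : Set (L2W (diagWeight ρ hc hpos) × L2W (diagWeight ρ hc hpos))) := by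
    refine isClosed_phGraph _ ?_ V
    rw [isUnit_iff_isUnit_det, det_diagonal]
    exact IsUnit.mk0 _ (Finset.prod_ne_zero_iff.2 fun i _ => by exact_mod_cast hp i)
  refine ⟨(g', (l : ℂ) • g' - f), ?_, by simp⟩
  exact hclosed.mem_of_tendsto (hg'.prodMk_nhds ((hg'.const_smul (l : ℂ)).sub hFf))
    (Eventually.of_forall hg)

end Vector

/-! ### Continuously differentiable matrix functions -/

theorem contDiffOn_det {M : ℝ → Matrix (Fin n) (Fin n) ℂ} (hM : MatC1 M) :
    ContDiffOn ℝ 1 (fun ξ => (M ξ).det) (Ici 0) := by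
  simp only [det_apply']
  exact ContDiffOn.sum fun σ _ => contDiffOn_const.mul (contDiffOn_prod fun i _ => hM _ _)

theorem MatC1.inv {S : ℝ → Matrix (Fin n) (Fin n) ℂ} (hSC : MatC1 S)
    (hS : ∀ ξ, 0 ≤ ξ → IsUnit (S ξ)) : MatC1 fun ξ => (S ξ)⁻¹ := by
  intro i j
  have h1 : ContDiffOn ℝ 1 (fun ξ => (S ξ).adjugate i j) (Ici 0) := by
    simp only [adjugate_apply]
    refine contDiffOn_det fun k l => ?_
    by_cases hk : k = j
    · subst hk
      simp only [updateRow_self]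
      exact contDiffOn_const
    · simp only [updateRow_ne hk]
      exact hSC k l
  have h2 : ContDiffOn ℝ 1 (fun ξ => (S ξ).det⁻¹ * (S ξ).adjugate i j) (Ici 0) :=
    ((contDiffOn_det hSC).inv fun ξ hξ =>
      ((isUnit_iff_isUnit_det _).1 (hS ξ hξ)).ne_zero).mul h1
  refine h2.congr fun ξ _ => ?_
  change (S ξ)⁻¹ i j = _
  rw [Matrix.inv_def, Ring.inverse_eq_inv', Matrix.smul_apply, smul_eq_mul]

/-- Differentiate S⁻¹ S = 1; derivatives within [0, ∞) are unique, also at the endpoint. -/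
theorem matDeriv_inv {S : ℝ → Matrix (Fin n) (Fin n) ℂ} (hSC : MatC1 S)
    (hS : ∀ ξ, 0 ≤ ξ → IsUnit (S ξ)) {ξ : ℝ} (hξ : 0 ≤ ξ) :
    matDeriv (fun ζ => (S ζ)⁻¹) ξ * S ξ = -((S ξ)⁻¹ * matDeriv S ξ) := by
  have hI := hSC.inv hS
  have hd : ∀ {M : ℝ → Matrix (Fin n) (Fin n) ℂ}, MatC1 M → ∀ i j,
      HasDerivWithinAt (fun ζ => M ζ i j) (matDeriv M ξ i j) (Ici 0) ξ := fun hM i j =>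
    ((hM i j).differentiableOn one_ne_zero ξ hξ).hasDerivWithinAt
  rw [← add_eq_zero_iff_eq_neg]
  ext i j
  have h1 : HasDerivWithinAt (fun ζ => ((S ζ)⁻¹ * S ζ) i j)
      ((matDeriv (fun ζ => (S ζ)⁻¹) ξ * S ξ + (S ξ)⁻¹ * matDeriv S ξ) i j) (Ici 0) ξ := by
    simp only [Matrix.add_apply, Matrix.mul_apply, ← Finset.sum_add_distrib]
    exact HasDerivWithinAt.fun_sum fun k _ => (hd hI i k).mul (hd hSC k j)
  have h2 : HasDerivWithinAt (fun ζ => ((S ζ)⁻¹ * S ζ) i j) 0 (Ici 0) ξ := by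
    refine (hasDerivWithinAt_const ξ (Ici 0) ((1 : Matrix (Fin n) (Fin n) ℂ) i j)).congr_of_mem
      (fun ζ hζ => ?_) hξ
    rw [nonsing_inv_mul _ ((isUnit_iff_isUnit_det _).1 (hS ζ hζ))]
  exact (uniqueDiffOn_Ici 0 ξ hξ).eq_deriv _ h1 h2

/-! ### Reality and constant sign of the eigenvalues -/

theorem mulVec_eq_of_similar {A D S : Matrix (Fin n) (Fin n) ℂ} (hS : IsUnit S) (hD : D.IsDiag)
    (h : A = S⁻¹ * D * S) (i : Fin n) :
    A *ᵥ (S⁻¹ *ᵥ Pi.single i 1) = D i i • (S⁻¹ *ᵥ Pi.single i 1) := by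
  have h1 : D *ᵥ Pi.single i 1 = D i i • Pi.single i 1 := by
    rw [← (isDiag_iff_diagonal_diag D).1 hD]
    ext j
    by_cases hj : j = i
    · subst hj; simp
    · simp [hj]
  rw [h, mulVec_mulVec, Matrix.mul_assoc, mul_nonsing_inv _ ((isUnit_iff_isUnit_det _).1 hS),
    Matrix.mul_one, ← mulVec_mulVec, h1, mulVec_smul]

theorem inv_mulVec_single_ne_zero {S : Matrix (Fin n) (Fin n) ℂ} (hS : IsUnit S) (i : Fin n) :
    S⁻¹ *ᵥ Pi.single i 1 ≠ 0 := by
  intro h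
  have h1 := congrArg (S *ᵥ ·) h
  simp only [mulVec_mulVec, mul_nonsing_inv _ ((isUnit_iff_isUnit_det _).1 hS), one_mulVec,
    mulVec_zero] at h1
  simpa using congrFun h1 i

/-- Pairing the eigenvalue equation with W v gives (W v)^⋆ P (W v) = c · v^⋆ W v. The left side is
real because P is Hermitian, and the factor of c is positive. -/
theorem im_eq_zero_of_eigen {P W : Matrix (Fin n) (Fin n) ℂ} (hP : P.IsHermitian) (hW : W.PosDef)
    {v : Fin n → ℂ} (hv : v ≠ 0) {c : ℂ} (h : (P * W) *ᵥ v = c • v) : c.im = 0 := by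
  have h1 : star (W *ᵥ v) ⬝ᵥ (P *ᵥ (W *ᵥ v)) = c * (star v ⬝ᵥ (W *ᵥ v)) := by
    rw [mulVec_mulVec _ P, h, dotProduct_smul, smul_eq_mul, star_mulVec, hW.isHermitian.eq,
      ← dotProduct_mulVec]
  have h2 : (star (W *ᵥ v) ⬝ᵥ (P *ᵥ (W *ᵥ v))).im = 0 := by
    rw [← Complex.conj_eq_iff_im]
    change star _ = _
    rw [← star_dotProduct_star, star_star, star_mulVec, hP.eq, ← dotProduct_mulVec]
  have h3 := Complex.lt_def.1 (hW.dotProduct_mulVec_pos hv)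
  rw [h1, Complex.mul_im, ← h3.2, Complex.zero_im, mul_zero, zero_add] at h2
  exact (mul_eq_zero.1 h2).resolve_right h3.1.ne'

theorem pos_iff_of_continuousOn {f : ℝ → ℝ} (hf : ContinuousOn f (Ici 0))
    (h0 : ∀ ξ, 0 ≤ ξ → f ξ ≠ 0) {ξ : ℝ} (hξ : 0 ≤ ξ) : 0 < f ξ ↔ 0 < f 0 := by
  have hI := intermediate_value_uIcc (hf.mono (by
    rw [uIcc_of_le hξ]; exact Icc_subset_Ici_self : uIcc 0 ξ ⊆ Ici 0))
  have key : (0 : ℝ) ∉ uIcc (f 0) (f ξ) := by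
    intro hmem
    obtain ⟨ζ, hζ, hζ0⟩ := hI hmem
    rw [uIcc_of_le hξ] at hζ
    exact h0 ζ hζ.1 hζ0
  rw [mem_uIcc] at key
  have h1 := h0 ξ hξ
  have h2 := h0 0 le_rfl
  constructor
  · intro h
    by_contra hcon
    exact key (Or.inl ⟨not_lt.1 hcon, h.le⟩)
  · intro h
    by_contra hcon
    exact key (Or.inr ⟨not_lt.1 hcon, h.le⟩)

/-- The sign of a nonzero real number. -/
def sgn (t : ℝ) : ℝ := if 0 < t then 1 else -1

theorem sgn_mul_self (t : ℝ) : sgn t * sgn t = 1 := by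
  unfold sgn; split_ifs <;> norm_num

theorem eq_sgn_mul_norm {c : ℂ} {t : ℝ} (hc : c.im = 0) (ht : 0 < c.re ↔ 0 < t) :
    c = (sgn t : ℂ) * (‖c‖ : ℂ) := by
  have h1 : c = (c.re : ℂ) := Complex.ext rfl (by simp [hc])
  have h2 : ‖c‖ = |c.re| := by
    conv_lhs => rw [h1]
    simp
  rw [h2]
  nth_rw 1 [h1]
  rw [← Complex.ofReal_mul]
  congr 1
  unfold sgn
  split_ifs with h
  · rw [one_mul, abs_of_pos (ht.2 h)]
  · rw [abs_of_nonpos (not_lt.1 fun h' => h (ht.1 h'))]; ring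

/-! ### Multiplication operators -/

theorem MulIsBounded.comp {F G : ℝ → Matrix (Fin n) (Fin n) ℂ} {w v u : Weight n}
    (hG : MulIsBounded G v u) (hF : MulIsBounded F w v) :
    MulIsBounded (fun ξ => G ξ * F ξ) w u := by
  obtain ⟨T, hT⟩ := hF
  obtain ⟨U, hU⟩ := hG
  refine ⟨U.comp T, fun x => ?_⟩
  filter_upwards [hT x, hU (T x)] with ξ h1 h2
  rw [ContinuousLinearMap.comp_apply, h2, h1, mulVec_mulVec]

/-- Boundedness of the identity in both directions says that the two weights are equivalent. This
permits rescaling |Δ| coordinate by coordinate without losing the isomorphism. -/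
theorem MulIsIso.trans_of_bounded {F : ℝ → Matrix (Fin n) (Fin n) ℂ} {w v u : Weight n}
    (hF : MulIsIso F w v) (h1 : MulIsBounded (fun _ => 1) v u)
    (h2 : MulIsBounded (fun _ => 1) u v) : MulIsIso F w u := by
  obtain ⟨T, hT⟩ := hF
  obtain ⟨U, hU⟩ := h1
  obtain ⟨V, hV⟩ := h2
  let e : L2W v ≃L[ℂ] L2W u := ContinuousLinearEquiv.equivOfInverse U V
    (fun x => L2W.ext_ae (by
      filter_upwards [hV (U x), hU x] with ξ h3 h4
      rw [h3, h4, one_mulVec, one_mulVec]))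
    (fun x => L2W.ext_ae (by
      filter_upwards [hU (V x), hV x] with ξ h3 h4
      rw [h3, h4, one_mulVec, one_mulVec]))
  refine ⟨T.trans e, fun x => ?_⟩
  filter_upwards [hT x, hU (T x)] with ξ h3 h4
  change (U (T x)).rep ξ = _
  rw [h4, h3, one_mulVec]

/-! ### Diagonalization of the operator -/

/-- The coordinate change `x ↦ S x` turns the operator into a bounded perturbation of one with
diagonal coefficients. -/
theorem mem_phGraph_iff_diag {m : ℕ} {w : Weight n} {P₁ P₀ : Matrix (Fin n) (Fin n) ℂ}
    (hP₁ : IsUnit P₁) {Δ S : ℝ → Matrix (Fin n) (Fin n) ℂ} (hSC : MatC1 S)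
    (hS : ∀ ξ, 0 ≤ ξ → IsUnit (S ξ))
    (hdiag : ∀ ξ, 0 ≤ ξ → P₁ * w.toFun ξ = (S ξ)⁻¹ * Δ ξ * S ξ)
    {v : Weight n} {p : Fin n → ℂ} (hp : ∀ i, p i ≠ 0)
    (hv : ∀ ξ, 0 ≤ ξ → Matrix.diagonal p * v.toFun ξ = Δ ξ)
    (WB : Matrix (Fin m) (Fin n) ℂ)
    (Φ : L2W w ≃L[ℂ] L2W v) (hΦ : ∀ x, (Φ x).rep =ᵐ[halfLine] fun ξ => S ξ *ᵥ x.rep ξ)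
    (K : L2W v →L[ℂ] L2W v) (hK : ∀ g, (K g).rep =ᵐ[halfLine]
      fun ξ => (S ξ * matDeriv (fun ζ => (S ζ)⁻¹) ξ * Δ ξ) *ᵥ g.rep ξ)
    (B : L2W w →L[ℂ] L2W w)
    (hB : ∀ x, (B x).rep =ᵐ[halfLine] fun ξ => (P₀ * w.toFun ξ) *ᵥ x.rep ξ) (x z : L2W w) :
    (x, z) ∈ phGraph w P₁ P₀ WB ↔
      (Φ x, Φ z - (K (Φ x) + Φ (B x))) ∈ phGraph v (Matrix.diagonal p) 0
        (WB * P₁⁻¹ * (S 0)⁻¹ * Matrix.diagonal p) := by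
  have hPd : IsUnit P₁.det := (isUnit_iff_isUnit_det _).1 hP₁
  have hSd : ∀ ξ, 0 ≤ ξ → IsUnit (S ξ).det := fun ξ hξ => (isUnit_iff_isUnit_det _).1 (hS ξ hξ)
  have hpd : IsUnit (Matrix.diagonal p).det := by
    rw [det_diagonal]
    exact IsUnit.mk0 _ (Finset.prod_ne_zero_iff.2 fun i _ => hp i)
  set Q : Matrix (Fin n) (Fin n) ℂ := (Matrix.diagonal p)⁻¹
  have hpQ : Matrix.diagonal p * Q = 1 := mul_nonsing_inv _ hpd
  have hQp : Q * Matrix.diagonal p = 1 := nonsing_inv_mul _ hpd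
  have hSP : ∀ ξ, 0 ≤ ξ → S ξ * P₁ * w.toFun ξ = Δ ξ * S ξ := by
    intro ξ hξ
    rw [Matrix.mul_assoc, hdiag ξ hξ, ← Matrix.mul_assoc, ← Matrix.mul_assoc,
      mul_nonsing_inv _ (hSd ξ hξ), Matrix.one_mul]
  have hrep : (Φ z - (K (Φ x) + Φ (B x))).rep =ᵐ[halfLine] fun ξ => S ξ *ᵥ z.rep ξ -
      ((S ξ * matDeriv (fun ζ => (S ζ)⁻¹) ξ * Δ ξ) *ᵥ (S ξ *ᵥ x.rep ξ) +
        S ξ *ᵥ ((P₀ * w.toFun ξ) *ᵥ x.rep ξ)) := by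
    filter_upwards [L2W.rep_sub (Φ z) (K (Φ x) + Φ (B x)), L2W.rep_add (K (Φ x)) (Φ (B x)),
      hΦ z, hK (Φ x), hΦ (B x), hB x, hΦ x] with ξ h1 h2 h3 h4 h5 h6 h7
    rw [h1, h2, h3, h4, h5, h6, h7]
  constructor
  · rintro ⟨y, d, hy, hb, he⟩
    -- Since diag(p) v = Δ and Δ S x = S P₁ W x, the function v S x is represented by diag(p)⁻¹ S P₁
    -- y, absolutely continuous because S is continuously differentiable.
    have h1 := locAC_const_mulVec Q (locAC_mulVec hSC (locAC_const_mulVec P₁ hy.locAC))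
    refine ⟨_, _, IsACRep.of_locAC h1 ?_, ?_, ?_⟩
    · filter_upwards [hy.ae_eq, hΦ x, ae_halfLine_pos] with ξ h2 h3 hξ
      rw [h2, h3]
      simp only [mulVec_mulVec]
      congr 1
      have h4 : v.toFun ξ = Q * Δ ξ := by
        rw [← hv ξ hξ.le, ← Matrix.mul_assoc, hQp, Matrix.one_mul]
      rw [h4]
      have := hSP ξ hξ.le
      simp only [Matrix.mul_assoc] at this ⊢
      rw [this]
    · simp only [mulVec_mulVec]
      have h2 : WB * P₁⁻¹ * (S 0)⁻¹ * Matrix.diagonal p * (Q * (S 0 * P₁)) = WB := by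
        rw [← Matrix.mul_assoc _ Q, Matrix.mul_assoc _ _ Q, hpQ, Matrix.mul_one,
          ← Matrix.mul_assoc _ (S 0), Matrix.mul_assoc _ _ (S 0),
          nonsing_inv_mul _ (hSd 0 le_rfl), Matrix.mul_one, Matrix.mul_assoc,
          nonsing_inv_mul _ hPd, Matrix.mul_one]
      rw [h2, hb]
    · filter_upwards [hrep, he, hy.ae_eq, ae_halfLine_pos] with ξ h2 h3 h4 hξ
      rw [h2, h3, h4, zero_mulVec, add_zero, mulVec_mulVec _ (Matrix.diagonal p), hpQ, one_mulVec]
      have h5 := matDeriv_inv hSC hS hξ.le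
      -- The product rule for S P₁ y produces the extra term S' P₁ W x. Because (S⁻¹)' S = -S⁻¹ S',
      -- it is cancelled by the perturbation S (S⁻¹)' Δ.
      have h6 : (S ξ * matDeriv (fun ζ => (S ζ)⁻¹) ξ * Δ ξ) * S ξ =
          -(matDeriv S ξ * P₁ * w.toFun ξ) := by
        rw [Matrix.mul_assoc, ← hSP ξ hξ.le, Matrix.mul_assoc (S ξ), Matrix.mul_assoc (S ξ) P₁,
          ← Matrix.mul_assoc _ (S ξ), h5, Matrix.neg_mul, Matrix.mul_neg,
          ← Matrix.mul_assoc (S ξ), ← Matrix.mul_assoc (S ξ), mul_nonsing_inv _ (hSd ξ hξ.le),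
          Matrix.one_mul, Matrix.mul_assoc]
      rw [mulVec_mulVec _ _ (S ξ), h6, mulVec_add, neg_mulVec]
      simp only [mulVec_mulVec, Matrix.mul_assoc]
      abel
  · rintro ⟨y, d, hy, hb, he⟩
    -- The inverse substitution: W x = P₁⁻¹ S⁻¹ diag(p) y. The boundary matrix has been chosen so
    -- that it applies W_B to this vector at 0.
    have h1 := locAC_const_mulVec P₁⁻¹ (locAC_mulVec (hSC.inv hS)
      (locAC_const_mulVec (Matrix.diagonal p) hy.locAC))
    refine ⟨_, _, IsACRep.of_locAC h1 ?_, ?_, ?_⟩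
    · filter_upwards [hy.ae_eq, hΦ x, ae_halfLine_pos] with ξ h2 h3 hξ
      rw [h2, h3]
      simp only [mulVec_mulVec]
      congr 1
      have h4 : P₁⁻¹ * (P₁ * w.toFun ξ) = w.toFun ξ := by
        rw [← Matrix.mul_assoc, nonsing_inv_mul _ hPd, Matrix.one_mul]
      rw [← h4, hdiag ξ hξ.le, ← hv ξ hξ.le]
      simp only [Matrix.mul_assoc]
    · simp only [mulVec_mulVec] at hb ⊢
      rw [← hb]
      simp only [Matrix.mul_assoc]
    · filter_upwards [hrep, he, hy.ae_eq, hΦ x, ae_halfLine_pos] with ξ h2 h3 h4 h5 hξ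
      rw [h2, zero_mulVec, add_zero] at h3
      have h6 : Matrix.diagonal p *ᵥ y ξ = Δ ξ *ᵥ (S ξ *ᵥ x.rep ξ) := by
        rw [h4, h5, mulVec_mulVec, hv ξ hξ.le]
      rw [mulVec_mulVec _ P₁, mul_nonsing_inv _ hPd, one_mulVec, h6, ← h3]
      simp only [mulVec_sub, mulVec_add, mulVec_mulVec, ← Matrix.mul_assoc,
        nonsing_inv_mul _ (hSd ξ hξ.le), Matrix.one_mul, one_mulVec]
      abel

/-! ### Pointwise bounds from operator bounds -/

/-- If a(ξ₀) < 0, continuity makes the integral at most l a(ξ₀) / 2 for small l. This is linear in l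
and cannot stay above -K l². The quadratic slack is there for the tent functions. -/
theorem nonneg_of_integral {a : ℝ → ℝ} (ha : ContinuousOn a (Ici 0)) {ξ₀ : ℝ} (h0 : 0 ≤ ξ₀)
    {K : ℝ} (h : ∀ l, 0 < l → l ≤ 1 → -(K * l ^ 2) ≤ ∫ ξ in Ioc ξ₀ (ξ₀ + l), a ξ) :
    0 ≤ a ξ₀ := by
  by_contra hneg
  push Not at hneg
  have hev : ∀ᶠ ξ in 𝓝[Ici 0] ξ₀, a ξ < a ξ₀ / 2 :=
    (ha ξ₀ h0).eventually (gt_mem_nhds (by linarith))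
  obtain ⟨δ, hδ, hball⟩ := Metric.mem_nhdsWithin_iff.1 hev
  set l : ℝ := min (min (δ / 2) 1) (-a ξ₀ / (4 * (|K| + 1)))
  have hl0 : 0 < l := by
    refine lt_min (lt_min (by linarith) one_pos) (div_pos (by linarith) (by positivity))
  have hl1 : l ≤ 1 := (min_le_left _ _).trans (min_le_right _ _)
  have hlδ : l < δ := ((min_le_left _ _).trans (min_le_left _ _)).trans_lt (by linarith)
  have hlK : l ≤ -a ξ₀ / (4 * (|K| + 1)) := min_le_right _ _
  have h1 := h l hl0 hl1
  have h2 : ∫ ξ in Ioc ξ₀ (ξ₀ + l), a ξ ≤ ∫ _ in Ioc ξ₀ (ξ₀ + l), a ξ₀ / 2 := by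
    refine setIntegral_mono_on ?_ (integrableOn_const (by simp)) measurableSet_Ioc fun ξ hξ => ?_
    · exact ((ha.mono fun ξ hξ => h0.trans hξ.1).integrableOn_Icc).mono_set Ioc_subset_Icc_self
    · refine le_of_lt (hball ⟨?_, h0.trans hξ.1.le⟩)
      rw [Metric.mem_ball, Real.dist_eq, abs_of_nonneg (by linarith [hξ.1])]
      linarith [hξ.2]
  rw [setIntegral_const, measureReal_def, Real.volume_Ioc, add_sub_cancel_left,
    ENNReal.toReal_ofReal hl0.le, smul_eq_mul] at h2
  rw [le_div_iff₀ (by positivity)] at hlK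
  have h3 : K * l ^ 2 ≤ |K| * l * l := by nlinarith [le_abs_self K, sq_nonneg l]
  nlinarith [abs_nonneg K]

theorem L2W.norm_sq_of_indicator {w : Weight n} {x : L2W w} {a : ℝ → Fin n → ℂ} {b c : ℝ}
    (hb : 0 ≤ b) (hx : x.rep =ᵐ[halfLine] (Ioc b c).indicator a) :
    ‖x‖ ^ 2 = ∫ ξ in Ioc b c, w.q (a ξ) ξ := by
  have hr : halfLine.restrict (Ioc b c) = volume.restrict (Ioc b c) := by
    rw [Measure.restrict_restrict measurableSet_Ioc,
      inter_eq_left.2 fun ξ hξ => mem_Ioi.2 (hb.trans_lt hξ.1)]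
  rw [L2W.norm_sq_eq, ← hr, ← integral_indicator measurableSet_Ioc]
  refine integral_congr_ae ?_
  filter_upwards [hx] with ξ h
  rw [h]
  by_cases hm : ξ ∈ Ioc b c
  · rw [indicator_of_mem hm, indicator_of_mem hm]
  · rw [indicator_of_notMem hm, indicator_of_notMem hm, w.q_zero]

/-- Apply the operator to a constant vector cut off to (ξ₀, ξ₀ + l] and let the interval shrink;
continuity turns the integrated inequality into a pointwise one. -/
theorem MulIsBounded.exists_bound {F : ℝ → Matrix (Fin n) (Fin n) ℂ} {w v : Weight n}
    (h : MulIsBounded F w v) (hF : ∀ i j, ContinuousOn (fun ξ => F ξ i j) (Ici 0)) :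
    ∃ C : ℝ, 0 ≤ C ∧ ∀ ξ, 0 ≤ ξ → ∀ u, v.q (F ξ *ᵥ u) ξ ≤ C * w.q u ξ := by
  obtain ⟨T, hT⟩ := h
  refine ⟨‖T‖ ^ 2, by positivity, fun ξ₀ h0 u => ?_⟩
  have hFu : ContinuousOn (fun ξ => F ξ *ᵥ u) (Ici 0) := continuousOn_mulVec hF continuousOn_const
  have c1 : ContinuousOn (fun ξ => v.q (F ξ *ᵥ u) ξ) (Ici 0) := v.continuousOn_q Subset.rfl hFu
  have c2 : ContinuousOn (fun ξ => w.q u ξ) (Ici 0) :=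
    w.continuousOn_q Subset.rfl continuousOn_const
  have hint : ∀ {a : ℝ → ℝ}, ContinuousOn a (Ici 0) → ∀ l, IntegrableOn a (Ioc ξ₀ (ξ₀ + l)) :=
    fun ha l => ((ha.mono fun ξ hξ => h0.trans hξ.1).integrableOn_Icc).mono_set
      Ioc_subset_Icc_self
  have key := nonneg_of_integral (a := fun ξ => ‖T‖ ^ 2 * w.q u ξ - v.q (F ξ *ᵥ u) ξ)
    ((continuousOn_const.mul c2).sub c1) h0 (K := 0) ?_
  · linarith
  intro l hl _
  obtain ⟨x, hx⟩ := exists_indicator w (a := fun _ => u) ξ₀ (ξ₀ + l) h0 continuousOn_const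
  have h1 := L2W.norm_sq_of_indicator h0 hx
  have hTx : (T x).rep =ᵐ[halfLine] (Ioc ξ₀ (ξ₀ + l)).indicator fun ξ => F ξ *ᵥ u := by
    filter_upwards [hT x, hx] with ξ h2 h3
    rw [h2, h3]
    by_cases hm : ξ ∈ Ioc ξ₀ (ξ₀ + l)
    · rw [indicator_of_mem hm, indicator_of_mem hm]
    · rw [indicator_of_notMem hm, indicator_of_notMem hm, mulVec_zero]
  have h2 := L2W.norm_sq_of_indicator h0 hTx
  have h3 : ‖T x‖ ^ 2 ≤ ‖T‖ ^ 2 * ‖x‖ ^ 2 := by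
    rw [← mul_pow]
    exact pow_le_pow_left₀ (norm_nonneg _) (T.le_opNorm x) 2
  rw [integral_sub ((hint c2 l).const_mul _) (hint c1 l), integral_const_mul, ← h1, ← h2]
  linarith

/-- The squared Euclidean norm. -/
def nsq (v : Fin n → ℂ) : ℝ := ∑ i, ‖v i‖ ^ 2

theorem star_dotProduct_self (v : Fin n → ℂ) : star v ⬝ᵥ v = (nsq v : ℂ) := by
  simp only [dotProduct, nsq, Pi.star_apply, Complex.star_def, Complex.conj_mul']
  push_cast
  rfl

theorem exists_nsq_mulVec_le {m : ℕ} (A : Matrix (Fin m) (Fin n) ℂ) :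
    ∃ C : ℝ, 0 ≤ C ∧ ∀ v, nsq (A *ᵥ v) ≤ C * nsq v := by
  refine ⟨∑ i, ∑ j, ‖A i j‖ ^ 2, by positivity, fun v => ?_⟩
  unfold nsq
  rw [Finset.sum_mul]
  refine Finset.sum_le_sum fun i _ => ?_
  refine le_trans ?_ (Finset.sum_mul_sq_le_sq_mul_sq Finset.univ (fun j => ‖A i j‖) fun j => ‖v j‖)
  refine pow_le_pow_left₀ (norm_nonneg _) ?_ 2
  simp only [mulVec, dotProduct]
  refine (norm_sum_le _ _).trans_eq ?_
  simp only [norm_mul]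

theorem norm_star_dotProduct_le (u v : Fin n → ℂ) {K : ℝ} (hK : 0 < K) :
    ‖star u ⬝ᵥ v‖ ≤ K / 2 * nsq u + (2 * K)⁻¹ * nsq v := by
  unfold nsq
  rw [Finset.mul_sum, Finset.mul_sum, ← Finset.sum_add_distrib]
  simp only [dotProduct]
  refine (norm_sum_le _ _).trans (Finset.sum_le_sum fun i _ => ?_)
  rw [norm_mul, Pi.star_apply, norm_star]
  have h1 : 0 ≤ (2 * K)⁻¹ * (K * ‖u i‖ - ‖v i‖) ^ 2 := by positivity
  have h2 : (2 * K)⁻¹ * (K * ‖u i‖ - ‖v i‖) ^ 2 =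
      K / 2 * ‖u i‖ ^ 2 + (2 * K)⁻¹ * ‖v i‖ ^ 2 - ‖u i‖ * ‖v i‖ := by
    field_simp
    ring
  linarith

/-- If multiplication by the weight is bounded, so is its product with a constant matrix. -/
theorem mulIsBounded_const_mul_weight {w : Weight n} (h : MulIsBounded w.toFun w w)
    (P : Matrix (Fin n) (Fin n) ℂ) : MulIsBounded (fun ξ => P * w.toFun ξ) w w := by
  obtain ⟨C, hC0, hC⟩ := h.exists_bound w.continuousOn
  obtain ⟨c, hc0, hc⟩ := exists_nsq_mulVec_le P
  set K := 2 * (1 + C)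
  have hK : 0 < K := by positivity
  -- The Euclidean square |W u|² equals the form of u and W u, hence is at most 2 (q(u) + q(W u)) ≤
  -- 2 (1 + C) q(u).
  have h1 : ∀ ξ, 0 ≤ ξ → ∀ u, nsq (w.toFun ξ *ᵥ u) ≤ K * w.q u ξ := by
    intro ξ hξ u
    have e : (nsq (w.toFun ξ *ᵥ u) : ℂ) =
        w.form (fun _ => u) (fun _ => w.toFun ξ *ᵥ u) ξ := by
      rw [← star_dotProduct_self, Weight.form, star_mulVec, (w.posDef ξ hξ).isHermitian.eq,
        ← dotProduct_mulVec]
    have h2 := w.norm_form_le (fun _ => u) (fun _ => w.toFun ξ *ᵥ u) hξ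
    rw [← e, w.form_self _ hξ, w.form_self _ hξ, Complex.norm_real, Complex.norm_real,
      Complex.norm_real, Real.norm_eq_abs, Real.norm_eq_abs, Real.norm_eq_abs,
      abs_of_nonneg (w.q_nonneg _ hξ), abs_of_nonneg (w.q_nonneg _ hξ)] at h2
    have h3 := hC ξ hξ u
    have h4 := le_abs_self (nsq (w.toFun ξ *ᵥ u))
    simp only [K]
    linarith
  -- The Young inequality with parameter K is tuned so that the preceding bound absorbs half of
  -- q(v); thus the weight is bounded above by K.
  have h2 : ∀ ξ, 0 ≤ ξ → ∀ v, w.q v ξ ≤ K * nsq v := by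
    intro ξ hξ v
    have h3 : w.q v ξ ≤ K / 2 * nsq v + (2 * K)⁻¹ * nsq (w.toFun ξ *ᵥ v) :=
      (Complex.re_le_norm _).trans (norm_star_dotProduct_le _ _ hK)
    have h4 : (2 * K)⁻¹ * nsq (w.toFun ξ *ᵥ v) ≤ (2 * K)⁻¹ * (K * w.q v ξ) :=
      mul_le_mul_of_nonneg_left (h1 ξ hξ v) (by positivity)
    have h5 : (2 * K)⁻¹ * (K * w.q v ξ) = w.q v ξ / 2 := by field_simp
    linarith
  refine mulIsBounded_of_bound (C := K * (c * K)) (fun i j => ?_) ?_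
  · simp only [Matrix.mul_apply]
    have : ContinuousOn (fun ξ => ∑ k, P i k * w.toFun ξ k j) (Ioi 0) :=
      continuousOn_finsetSum _ fun k _ => continuousOn_const.mul
        ((w.continuousOn k j).mono Ioi_subset_Ici_self)
    exact this.aestronglyMeasurable measurableSet_Ioi
  · filter_upwards [ae_halfLine_pos] with ξ hξ u
    rw [← mulVec_mulVec]
    calc _ ≤ K * nsq (P *ᵥ (w.toFun ξ *ᵥ u)) := h2 ξ hξ.le _
      _ ≤ K * (c * nsq (w.toFun ξ *ᵥ u)) := mul_le_mul_of_nonneg_left (hc _) hK.le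
      _ ≤ K * (c * (K * w.q u ξ)) := by
          refine mul_le_mul_of_nonneg_left (mul_le_mul_of_nonneg_left (h1 ξ hξ.le u) hc0) hK.le
      _ = K * (c * K) * w.q u ξ := by ring

/-! ### The domain defined by the derivative -/

/-- The algebra of constant matrices acting on `L²_W`. -/
def multiplierAlgebra (w : Weight n) : Subalgebra ℂ (Matrix (Fin n) (Fin n) ℂ) where
  carrier := {F | MulMapsInto (fun _ => F) w w}
  mul_mem' := by
    intro F G hF hG x
    obtain ⟨y, hy⟩ := hG x
    obtain ⟨z, hz⟩ := hF y
    refine ⟨z, ?_⟩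
    filter_upwards [hy, hz] with ξ h1 h2
    rw [h2, h1, mulVec_mulVec]
  add_mem' := by
    intro F G hF hG x
    obtain ⟨y, hy⟩ := hF x
    obtain ⟨z, hz⟩ := hG x
    refine ⟨y + z, ?_⟩
    filter_upwards [hy, hz, y.rep_add z] with ξ h1 h2 h3
    rw [h3, h1, h2, add_mulVec]
  algebraMap_mem' := by
    intro c x
    refine ⟨c • x, ?_⟩
    filter_upwards [x.rep_smul c] with ξ h
    rw [h, Matrix.algebraMap_eq_diagonal]
    ext i
    simp [mulVec_diagonal]

/-- Left multiplication by P is injective on the subalgebra, hence surjective by finite dimension,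
and a preimage of 1 is the inverse. -/
theorem inv_mem_subalgebra {𝒜 : Subalgebra ℂ (Matrix (Fin n) (Fin n) ℂ)}
    {P : Matrix (Fin n) (Fin n) ℂ} (hP : P ∈ 𝒜) (hu : IsUnit P) : P⁻¹ ∈ 𝒜 := by
  have hdet : IsUnit P.det := (isUnit_iff_isUnit_det _).1 hu
  let f : 𝒜 →ₗ[ℂ] 𝒜 := LinearMap.mulLeft ℂ (⟨P, hP⟩ : 𝒜)
  have hinj : Function.Injective f := by
    intro a b hab
    have h1 : P * (a : Matrix (Fin n) (Fin n) ℂ) = P * b := congrArg Subtype.val hab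
    refine Subtype.ext ?_
    have h2 := congrArg (P⁻¹ * ·) h1
    simpa [← Matrix.mul_assoc, nonsing_inv_mul _ hdet] using h2
  obtain ⟨b, hb⟩ := (LinearMap.injective_iff_surjective.1 hinj) 1
  have h1 : P * (b : Matrix (Fin n) (Fin n) ℂ) = 1 := congrArg Subtype.val hb
  rw [inv_eq_right_inv h1]
  exact b.2

/-- The tent function on `(ξ₀, ξ₀ + l)`. -/
def tent (ξ₀ l ξ : ℝ) : ℝ := max 0 (l / 2 - |ξ - (ξ₀ + l / 2)|)

theorem tent_lipschitz (ξ₀ l : ℝ) : LipschitzWith 1 (tent ξ₀ l) := by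
  refine LipschitzWith.of_dist_le_mul fun x y => ?_
  simp only [tent, Real.dist_eq, NNReal.coe_one, one_mul]
  refine (abs_max_sub_max_le_max _ _ _ _).trans ?_
  rw [sub_self, abs_zero, max_eq_right (abs_nonneg _)]
  have : l / 2 - |x - (ξ₀ + l / 2)| - (l / 2 - |y - (ξ₀ + l / 2)|) =
      |y - (ξ₀ + l / 2)| - |x - (ξ₀ + l / 2)| := by ring
  rw [this]
  refine (abs_abs_sub_abs_le _ _).trans_eq ?_
  rw [abs_sub_comm]
  congr 1
  ring

theorem tent_eq_zero {ξ₀ l ξ : ℝ} (h : ξ ∉ Ioo ξ₀ (ξ₀ + l)) : tent ξ₀ l ξ = 0 := by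
  rw [tent, max_eq_left]
  by_contra hcon
  push Not at hcon
  have h1 : |ξ - (ξ₀ + l / 2)| < l / 2 := by linarith
  rw [abs_lt] at h1
  exact h ⟨by linarith, by linarith⟩

/-- The derivative of the tent function. -/
def tentDeriv (ξ₀ l ξ : ℝ) : ℝ :=
  if ξ ∈ Ioo ξ₀ (ξ₀ + l) then (if ξ < ξ₀ + l / 2 then 1 else -1) else 0

theorem hasDerivAt_tent {ξ₀ l ξ : ℝ} (h1 : ξ ≠ ξ₀) (h2 : ξ ≠ ξ₀ + l / 2)
    (h3 : ξ ≠ ξ₀ + l) : HasDerivAt (tent ξ₀ l) (tentDeriv ξ₀ l ξ) ξ := by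
  unfold tentDeriv
  split_ifs with hm hlt
  · have hev : tent ξ₀ l =ᶠ[𝓝 ξ] fun x => x - ξ₀ := by
      filter_upwards [Ioo_mem_nhds hm.1 hlt] with x hx
      rw [tent, abs_of_neg (by linarith [hx.2]), max_eq_right (by linarith [hx.1])]
      ring
    exact ((hasDerivAt_id ξ).sub_const ξ₀).congr_of_eventuallyEq hev
  · have hgt : ξ₀ + l / 2 < ξ := lt_of_le_of_ne (not_lt.1 hlt) (Ne.symm h2)
    have hev : tent ξ₀ l =ᶠ[𝓝 ξ] fun x => (ξ₀ + l) - x := by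
      filter_upwards [Ioo_mem_nhds hgt hm.2] with x hx
      rw [tent, abs_of_pos (by linarith [hx.1]), max_eq_right (by linarith [hx.2])]
      ring
    exact ((hasDerivAt_id ξ).const_sub (ξ₀ + l)).congr_of_eventuallyEq hev
  · have hev : tent ξ₀ l =ᶠ[𝓝 ξ] fun _ => 0 := by
      have hmem : (Icc ξ₀ (ξ₀ + l))ᶜ ∈ 𝓝 ξ := by
        refine isClosed_Icc.isOpen_compl.mem_nhds fun hmem => hm ⟨?_, ?_⟩
        · exact lt_of_le_of_ne hmem.1 (Ne.symm h1)
        · exact lt_of_le_of_ne hmem.2 h3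
      filter_upwards [hmem] with x hx
      exact tent_eq_zero fun hx' => hx (Ioo_subset_Icc_self hx')
    exact (hasDerivAt_const ξ (0 : ℝ)).congr_of_eventuallyEq hev

/-! ### The domain prescribed by the derivative -/

theorem IsACRep.deriv_unique {w : Weight n} {x : L2W w} {y d y' d' : ℝ → Fin n → ℂ}
    (h : IsACRep x y d) (h' : IsACRep x y' d') : d =ᵐ[halfLine] d' := by
  have h1 := h.add (h'.smul (-1))
  rw [neg_one_smul, add_neg_cancel] at h1
  filter_upwards [h1.deriv_eq_zero] with ξ h2
  simpa [← sub_eq_add_neg, sub_eq_zero] using h2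

/-- If `P (W x)'` is square integrable whenever `(W x)'` is, then it is bounded in terms of `x`
and `(W x)'`. -/
theorem exists_bound_mulVec_deriv {m : ℕ} {w : Weight n} [CompleteSpace (L2W w)]
    {WB : Matrix (Fin m) (Fin n) ℂ} {P : Matrix (Fin n) (Fin n) ℂ}
    (h : ∀ p ∈ phGraph w 1 0 WB, ∃ u : L2W w, u.rep =ᵐ[halfLine] fun ξ => P *ᵥ p.2.rep ξ) :
    ∃ C : ℝ, ∀ p ∈ phGraph w 1 0 WB, ∀ u : L2W w,
      (u.rep =ᵐ[halfLine] fun ξ => P *ᵥ p.2.rep ξ) → ‖u‖ ≤ C * ‖p‖ := by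
  -- With coefficients 1 and 0 the graph consists of the pairs (x, (W x)') satisfying the boundary
  -- condition. Being closed in a complete space, it is a Banach space, so the closed graph theorem
  -- is available.
  have hcl : IsClosed (phGraph w (1 : Matrix (Fin n) (Fin n) ℂ) 0 WB : Set (L2W w × L2W w)) :=
    isClosed_phGraph w isUnit_one WB
  have : CompleteSpace (phGraph w (1 : Matrix (Fin n) (Fin n) ℂ) 0 WB) := hcl.completeSpace_coe
  choose f hf using fun p : phGraph w (1 : Matrix (Fin n) (Fin n) ℂ) 0 WB => h p.1 p.2
  let Λ : phGraph w (1 : Matrix (Fin n) (Fin n) ℂ) 0 WB →ₗ[ℂ] L2W w :=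
    { toFun := f
      map_add' := by
        intro p q
        refine L2W.ext_ae ?_
        filter_upwards [hf (p + q), hf p, hf q, (f p).rep_add (f q), p.1.2.rep_add q.1.2]
          with ξ h1 h2 h3 h4 h5
        rw [h1, h4, h2, h3, ← mulVec_add, ← h5]; rfl
      map_smul' := by
        intro c p
        refine L2W.ext_ae ?_
        filter_upwards [hf (c • p), hf p, (f p).rep_smul c, p.1.2.rep_smul c] with ξ h1 h2 h3 h4
        rw [h1, RingHom.id_apply, h3, h2, ← mulVec_smul, ← h4]; rfl }
  have hcont : Continuous Λ := by
    refine LinearMap.continuous_of_seq_closed_graph Λ fun u p y hu hy => ?_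
    refine L2W.eq_of_integral_eq fun b hb i => ?_
    obtain ⟨ℓ, hℓ⟩ := exists_functional w (a := fun _ => Pi.single i 1) continuousOn_const b
    obtain ⟨k, hk⟩ := exists_functional w (a := fun _ => P i) continuousOn_const b
    -- The integral over (0, b] of a coordinate of P (W x)' can be read as a bounded functional of
    -- the image or of (W x)' itself. The second reading is continuous on the graph, and this
    -- identifies the limit.
    have hsame : ∀ q, ℓ (Λ q) = k q.1.2 := by
      intro q
      rw [(hℓ _).2, (hk _).2]
      refine integral_congr_ae ?_
      filter_upwards [ae_restrict_of_ae_halfLine (hf q) b] with ξ h1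
      change Pi.single i 1 ⬝ᵥ (f q).rep ξ = _
      rw [h1, single_one_dotProduct]; rfl
    have h1 : Tendsto (fun j => ℓ (Λ (u j))) atTop (𝓝 (ℓ y)) :=
      (ℓ.continuous.tendsto y).comp hy
    have h2 : Tendsto (fun j => ℓ (Λ (u j))) atTop (𝓝 (ℓ (Λ p))) := by
      simp only [hsame]
      exact ((k.continuous.comp (continuous_snd.comp continuous_subtype_val)).tendsto p).comp hu
    have h3 := tendsto_nhds_unique h1 h2
    rw [(hℓ _).2, (hℓ _).2] at h3
    simpa using h3
  let L : phGraph w (1 : Matrix (Fin n) (Fin n) ℂ) 0 WB →L[ℂ] L2W w := ⟨Λ, hcont⟩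
  refine ⟨‖L‖, fun p hp u hu => ?_⟩
  have : u = L ⟨p, hp⟩ := L2W.ext_ae (hu.trans (hf ⟨p, hp⟩).symm)
  rw [this]
  exact L.le_opNorm _

theorem Weight.q_smul (w : Weight n) (c : ℝ) (v : Fin n → ℂ) (ξ : ℝ) :
    w.q ((c : ℂ) • v) ξ = c ^ 2 * w.q v ξ := by
  unfold Weight.q
  simp only [star_smul, mulVec_smul, smul_dotProduct, dotProduct_smul, smul_eq_mul,
    Complex.star_def, Complex.conj_ofReal, Complex.re_ofReal_mul]
  ring

theorem tent_nonneg (ξ₀ l ξ : ℝ) : 0 ≤ tent ξ₀ l ξ := le_max_left _ _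

theorem tent_le {ξ₀ l : ℝ} (hl : 0 < l) (ξ : ℝ) : tent ξ₀ l ξ ≤ l :=
  max_le hl.le (by linarith [abs_nonneg (ξ - (ξ₀ + l / 2))])

/-- Tent functions belong to the domain. -/
theorem exists_tent {m : ℕ} (w : Weight n) (WB : Matrix (Fin m) (Fin n) ℂ) (v : Fin n → ℂ)
    {ξ₀ l : ℝ} (h0 : 0 ≤ ξ₀) (hl : 0 < l) :
    ∃ p ∈ phGraph w 1 0 WB, ‖p.1‖ ^ 2 ≤ l ^ 2 *
        ∫ ξ in Ioc ξ₀ (ξ₀ + l), w.q ((w.toFun ξ)⁻¹ *ᵥ v) ξ ∧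
      p.2.rep =ᵐ[halfLine] fun ξ => (tentDeriv ξ₀ l ξ : ℂ) • v := by
  let L : ℝ →L[ℝ] (Fin n → ℂ) := Complex.ofRealCLM.smulRight v
  have hL : ∀ t, L t = (t : ℂ) • v := fun t => rfl
  have hy : LipschitzWith _ (L ∘ tent ξ₀ l) := L.lipschitz.comp (tent_lipschitz ξ₀ l)
  have hsub : Icc ξ₀ (ξ₀ + l) ⊆ Ici 0 := fun ξ hξ => h0.trans hξ.1
  have hi : ContinuousOn (fun ξ => (w.toFun ξ)⁻¹ *ᵥ v) (Icc ξ₀ (ξ₀ + l)) :=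
    (continuousOn_mulVec w.continuousOn_inv continuousOn_const).mono hsub
  -- Here x is W⁻¹ times the tent in the direction v, so that W x is the tent; its derivative is v
  -- on the first half of the interval and -v on the second.
  obtain ⟨x, hx⟩ := exists_indicator w ξ₀ (ξ₀ + l) h0
    (a := fun ξ => (w.toFun ξ)⁻¹ *ᵥ (L ∘ tent ξ₀ l) ξ)
    ((continuousOn_mulVec w.continuousOn_inv hy.continuous.continuousOn).mono hsub)
  obtain ⟨u₁, hu₁⟩ := exists_indicator w ξ₀ (ξ₀ + l / 2) h0 (a := fun _ => v) continuousOn_const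
  obtain ⟨u₂, hu₂⟩ := exists_indicator w (ξ₀ + l / 2) (ξ₀ + l) (by linarith) (a := fun _ => v)
    continuousOn_const
  have hne : ∀ c : ℝ, ∀ᵐ ξ ∂halfLine, ξ ≠ c := fun c =>
    ae_restrict_of_ae (Measure.ae_ne volume c)
  have hz : (u₁ - u₂).rep =ᵐ[halfLine] fun ξ => (tentDeriv ξ₀ l ξ : ℂ) • v := by
    filter_upwards [L2W.rep_sub u₁ u₂, hu₁, hu₂, hne (ξ₀ + l / 2), hne (ξ₀ + l)]
      with ξ h1 h2 h3 h4 h5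
    rw [h1, h2, h3]
    unfold tentDeriv
    simp only [indicator_apply, mem_Ioc, mem_Ioo]
    rcases le_or_gt ξ ξ₀ with h | h
    · have e1 : ¬ ξ₀ < ξ := not_lt.2 h
      have e2 : ¬ ξ₀ + l / 2 < ξ := by linarith
      simp [e1, e2]
    rcases lt_or_gt_of_ne h4 with h' | h'
    · have e1 : ξ < ξ₀ + l := by linarith
      have e2 : ¬ ξ₀ + l / 2 < ξ := by linarith
      simp [h, h'.le, e1, e2, h']
    · have e2 : ¬ ξ < ξ₀ + l / 2 := by linarith
      have e3 : ¬ ξ ≤ ξ₀ + l / 2 := by linarith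
      rcases lt_or_gt_of_ne h5 with h'' | h''
      · simp [h, h', e2, e3, h'', h''.le]
      · have e4 : ¬ ξ < ξ₀ + l := by linarith
        have e5 : ¬ ξ ≤ ξ₀ + l := by linarith
        simp [e3, e4, e5]
  have hnn : ∀ ξ ∈ Ioc ξ₀ (ξ₀ + l), w.q ((w.toFun ξ)⁻¹ *ᵥ (L ∘ tent ξ₀ l) ξ) ξ ≤
      l ^ 2 * w.q ((w.toFun ξ)⁻¹ *ᵥ v) ξ := by
    intro ξ hξ
    rw [Function.comp_apply, hL, mulVec_smul, w.q_smul]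
    refine mul_le_mul_of_nonneg_right ?_ (w.q_nonneg _ (h0.trans hξ.1.le))
    exact pow_le_pow_left₀ (tent_nonneg _ _ _) (tent_le hl ξ) 2
  refine ⟨(x, u₁ - u₂), ⟨L ∘ tent ξ₀ l, fun ξ => (tentDeriv ξ₀ l ξ : ℂ) • v,
    ⟨fun b _ => (hy.lipschitzOnWith).absolutelyContinuousOnInterval, ?_, ?_⟩, ?_, ?_⟩, ?_, hz⟩
  · filter_upwards [hx, ae_halfLine_pos] with ξ h1 hξ
    rw [h1]
    by_cases hm : ξ ∈ Ioc ξ₀ (ξ₀ + l)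
    · rw [indicator_of_mem hm, mulVec_mulVec, mul_nonsing_inv _ (w.isUnit_det hξ.le), one_mulVec]
    · rw [indicator_of_notMem hm, mulVec_zero, Function.comp_apply, hL,
        tent_eq_zero fun h => hm (Ioo_subset_Ioc_self h)]
      simp
  · filter_upwards [hne ξ₀, hne (ξ₀ + l / 2), hne (ξ₀ + l)] with ξ h1 h2 h3
    exact L.hasFDerivAt.comp_hasDerivAt ξ (hasDerivAt_tent h1 h2 h3)
  · have : (L ∘ tent ξ₀ l) 0 = 0 := by
      rw [Function.comp_apply, hL, tent_eq_zero fun h => absurd h.1 (not_lt.2 h0)]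
      simp
    rw [this, mulVec_zero]
  · filter_upwards [hz] with ξ h1
    simp [h1]
  · change ‖x‖ ^ 2 ≤ _
    rw [L2W.norm_sq_of_indicator h0 hx, ← integral_const_mul]
    refine setIntegral_mono_on ?_ ?_ measurableSet_Ioc hnn
    · exact ((w.continuousOn_q hsub ((continuousOn_mulVec w.continuousOn_inv
        hy.continuous.continuousOn).mono hsub)).integrableOn_Icc).mono_set Ioc_subset_Icc_self
    · exact (((w.continuousOn_q hsub hi).integrableOn_Icc).mono_set Ioc_subset_Icc_self).const_mul _

/-- Testing the bound on the derivatives of tent functions shows that multiplication by `P` is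
bounded pointwise. -/
theorem q_mulVec_le_of_bound {m : ℕ} {w : Weight n} {WB : Matrix (Fin m) (Fin n) ℂ}
    {P : Matrix (Fin n) (Fin n) ℂ} {C : ℝ}
    (hu : ∀ p ∈ phGraph w 1 0 WB, ∃ u : L2W w, u.rep =ᵐ[halfLine] fun ξ => P *ᵥ p.2.rep ξ)
    (h : ∀ p ∈ phGraph w 1 0 WB, ∀ u : L2W w,
      (u.rep =ᵐ[halfLine] fun ξ => P *ᵥ p.2.rep ξ) → ‖u‖ ≤ C * ‖p‖) {ξ₀ : ℝ} (h0 : 0 ≤ ξ₀)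
    (v : Fin n → ℂ) : w.q (P *ᵥ v) ξ₀ ≤ C ^ 2 * w.q v ξ₀ := by
  have hc : ∀ a : Fin n → ℂ, ContinuousOn (fun ξ => w.q a ξ) (Ici 0) := fun a =>
    w.continuousOn_q subset_rfl continuousOn_const
  have hci : ContinuousOn (fun ξ => w.q ((w.toFun ξ)⁻¹ *ᵥ v) ξ) (Ici 0) :=
    w.continuousOn_q subset_rfl (continuousOn_mulVec w.continuousOn_inv continuousOn_const)
  have hint : ∀ {f : ℝ → ℝ}, ContinuousOn f (Ici 0) → ∀ l, IntegrableOn f (Ioc ξ₀ (ξ₀ + l)) :=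
    fun hf l => ((hf.mono fun ξ (hξ : ξ ∈ Icc _ _) => h0.trans hξ.1).integrableOn_Icc).mono_set
      Ioc_subset_Icc_self
  -- A tent on an interval of length l has height at most l, while its derivative has modulus one
  -- almost everywhere there. The contribution of x to the bound is therefore O(l²), which gives the
  -- quadratic slack K l².
  have key := nonneg_of_integral (a := fun ξ => C ^ 2 * w.q v ξ - w.q (P *ᵥ v) ξ)
    (K := C ^ 2 * ∫ ξ in Ioc ξ₀ (ξ₀ + 1), w.q ((w.toFun ξ)⁻¹ *ᵥ v) ξ)
    ((continuousOn_const.mul (hc v)).sub (hc _)) h0 fun l hl hl1 => ?_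
  · linarith
  obtain ⟨p, hp, hp1, hp2⟩ := exists_tent w WB v h0 hl
  obtain ⟨u, hur⟩ := hu p hp
  have hb := h p hp u hur
  -- The right endpoint is excluded because the derivative is set to 0 there, whereas the half-open
  -- interval contains it.
  have hsq : ∀ ξ, 0 ≤ ξ → ∀ a : Fin n → ℂ, ξ ≠ ξ₀ + l →
      w.q ((tentDeriv ξ₀ l ξ : ℂ) • a) ξ = (Ioc ξ₀ (ξ₀ + l)).indicator (fun ξ => w.q a ξ) ξ := by
    intro ξ _ a hne
    rw [w.q_smul]
    unfold tentDeriv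
    by_cases hm : ξ ∈ Ioo ξ₀ (ξ₀ + l)
    · rw [indicator_of_mem (Ioo_subset_Ioc_self hm), if_pos hm]
      split_ifs <;> ring
    · rw [if_neg hm, indicator_of_notMem fun hm' => hm ⟨hm'.1, lt_of_le_of_ne hm'.2 hne⟩]
      ring
  have hr : halfLine.restrict (Ioc ξ₀ (ξ₀ + l)) = volume.restrict (Ioc ξ₀ (ξ₀ + l)) := by
    rw [Measure.restrict_restrict measurableSet_Ioc, inter_eq_left.2 fun ξ hξ => mem_Ioi.2 (h0.trans_lt hξ.1)]
  have hnorm : ∀ (y : L2W w) (a : Fin n → ℂ),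
      (y.rep =ᵐ[halfLine] fun ξ => (tentDeriv ξ₀ l ξ : ℂ) • a) →
      ‖y‖ ^ 2 = ∫ ξ in Ioc ξ₀ (ξ₀ + l), w.q a ξ := by
    intro y a hy
    rw [L2W.norm_sq_eq, ← hr, ← integral_indicator measurableSet_Ioc]
    refine integral_congr_ae ?_
    filter_upwards [hy, ae_halfLine_pos, ae_restrict_of_ae (Measure.ae_ne volume (ξ₀ + l))]
      with ξ h1 hξ h2
    rw [h1, hsq ξ hξ.le a h2]
  have hz := hnorm p.2 v hp2
  have hPz := hnorm u (P *ᵥ v) (by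
    filter_upwards [hur, hp2] with ξ h1 h2
    rw [h1, h2, mulVec_smul])
  have hpn : ‖p‖ ^ 2 ≤ ‖p.1‖ ^ 2 + ‖p.2‖ ^ 2 := by
    rw [Prod.norm_def]
    rcases max_choice ‖p.1‖ ‖p.2‖ with h1 | h1 <;> rw [h1]
    · linarith [sq_nonneg ‖p.2‖]
    · linarith [sq_nonneg ‖p.1‖]
  have h1 : ‖u‖ ^ 2 ≤ C ^ 2 * (‖p.1‖ ^ 2 + ‖p.2‖ ^ 2) := by
    calc ‖u‖ ^ 2 ≤ (C * ‖p‖) ^ 2 := pow_le_pow_left₀ (norm_nonneg _) hb 2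
      _ = C ^ 2 * ‖p‖ ^ 2 := by ring
      _ ≤ _ := mul_le_mul_of_nonneg_left hpn (sq_nonneg _)
  have hmono : ∫ ξ in Ioc ξ₀ (ξ₀ + l), w.q ((w.toFun ξ)⁻¹ *ᵥ v) ξ ≤
      ∫ ξ in Ioc ξ₀ (ξ₀ + 1), w.q ((w.toFun ξ)⁻¹ *ᵥ v) ξ := by
    refine setIntegral_mono_set (hint hci 1) ?_ (Ioc_subset_Ioc_right (by linarith)).eventuallyLE
    filter_upwards [ae_restrict_mem measurableSet_Ioc] with ξ hξ
    exact w.q_nonneg _ (h0.trans hξ.1.le)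
  rw [integral_sub ((hint (hc v) l).const_mul _) (hint (hc _) l), integral_const_mul, ← hz, ← hPz]
  have h2 : ‖p.1‖ ^ 2 ≤ l ^ 2 * ∫ ξ in Ioc ξ₀ (ξ₀ + 1), w.q ((w.toFun ξ)⁻¹ *ᵥ v) ξ :=
    hp1.trans (mul_le_mul_of_nonneg_left hmono (sq_nonneg _))
  have h3 := mul_le_mul_of_nonneg_left h2 (sq_nonneg C)
  nlinarith

/-- If `P₁ (W x)' + P₀ W x` is square integrable whenever `(W x)'` is, then both domains
coincide. -/
theorem domain_eq_derivDomain {m : ℕ} {w : Weight n} [CompleteSpace (L2W w)]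
    {P₁ P₀ : Matrix (Fin n) (Fin n) ℂ} (hP₁ : IsUnit P₁) {WB : Matrix (Fin m) (Fin n) ℂ}
    {B : L2W w →L[ℂ] L2W w}
    (hB : ∀ x, (B x).rep =ᵐ[halfLine] fun ξ => (P₀ * w.toFun ξ) *ᵥ x.rep ξ)
    (h : derivDomain w WB ≤ (phOp w P₁ P₀ WB).domain) :
    derivDomain w WB = (phOp w P₁ P₀ WB).domain := by
  -- On the smaller domain P₁ (W x)' = A x - P₀ W x is a difference of two square integrable
  -- functions.
  have hu : ∀ p ∈ phGraph w 1 0 WB,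
      ∃ u : L2W w, u.rep =ᵐ[halfLine] fun ξ => P₁ *ᵥ p.2.rep ξ := by
    rintro p ⟨y, d, hy, hb, he⟩
    have he' : p.2.rep =ᵐ[halfLine] d := by
      filter_upwards [he] with ξ h1
      simpa using h1
    have hmem := h (show p.1 ∈ derivDomain w WB from ⟨y, d, p.2, hy, hb, he'⟩)
    rw [LinearPMap.mem_domain_iff] at hmem
    obtain ⟨z, hz⟩ := hmem
    rw [phOp_graph] at hz
    obtain ⟨y', d', hy', -, hz'⟩ := hz
    refine ⟨z - B p.1, ?_⟩
    filter_upwards [hz', L2W.rep_sub z (B p.1), hB p.1, hy.deriv_unique hy', he']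
      with ξ h1 h2 h3 h4 h5
    rw [h2, h3, h5, h4]
    change z.rep ξ = _ at h1
    rw [h1, mulVec_mulVec, add_sub_cancel_right]
  obtain ⟨C, hCb⟩ := exists_bound_mulVec_deriv hu
  have hmem : P₁ ∈ multiplierAlgebra w := by
    have hbd : MulIsBounded (fun _ => P₁) w w := by
      refine mulIsBounded_of_bound (C := C ^ 2) (fun i j => aestronglyMeasurable_const) ?_
      filter_upwards [ae_halfLine_pos] with ξ hξ v
      exact q_mulVec_le_of_bound hu hCb hξ.le v
    obtain ⟨T, hT⟩ := hbd
    exact fun x => ⟨T x, hT x⟩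
  -- With P₁⁻¹ a multiplier, (W x)' = P₁⁻¹ (A x - P₀ W x) is square integrable for every x in the
  -- maximal domain.
  have hinv := inv_mem_subalgebra hmem hP₁
  refine le_antisymm h fun x hx => ?_
  rw [LinearPMap.mem_domain_iff] at hx
  obtain ⟨z, hz⟩ := hx
  rw [phOp_graph] at hz
  obtain ⟨y, d, hy, hb, he⟩ := hz
  obtain ⟨u, hur⟩ := hinv (z - B x)
  refine ⟨y, d, u, hy, hb, ?_⟩
  filter_upwards [hur, he, L2W.rep_sub z (B x), hB x] with ξ h1 h2 h3 h4
  change z.rep ξ = _ at h2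
  rw [h1, h3, h4, h2]
  rw [mulVec_mulVec, add_sub_cancel_right, mulVec_mulVec,
    nonsing_inv_mul _ ((isUnit_iff_isUnit_det _).1 hP₁), one_mulVec]

theorem domRestrict_derivDomain {m : ℕ} {w : Weight n} [CompleteSpace (L2W w)]
    {P₁ P₀ : Matrix (Fin n) (Fin n) ℂ} (hP₁ : IsUnit P₁) {WB : Matrix (Fin m) (Fin n) ℂ}
    {B : L2W w →L[ℂ] L2W w}
    (hB : ∀ x, (B x).rep =ᵐ[halfLine] fun ξ => (P₀ * w.toFun ξ) *ᵥ x.rep ξ)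
    (h : derivDomain w WB ≤ (phOp w P₁ P₀ WB).domain) :
    (phOp w P₁ P₀ WB).domRestrict (derivDomain w WB) = phOp w P₁ P₀ WB := by
  refine LinearPMap.eq_of_le_of_domain_eq LinearPMap.domRestrict_le ?_
  rw [LinearPMap.domRestrict_domain, domain_eq_derivDomain hP₁ hB h, inf_idem]

/-! ### Generation for diagonal coefficients -/

section Diag

variable {ρ : Fin n → ℝ → ℝ} {hc : ∀ i, ContinuousOn (ρ i) (Ici 0)}
  {hpos : ∀ i ξ, 0 ≤ ξ → 0 < ρ i ξ}

/-- By the energy identity, dissipativity is the sign condition `hdiss` on the admissible boundary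
values; `hV` yields the range condition. -/
theorem exists_semigroup_diag {m : ℕ} {M : ℝ} (hM : ∀ i ξ, 0 ≤ ξ → ρ i ξ ≤ M) {p : Fin n → ℝ}
    (hp : ∀ i, p i ≠ 0) {V : Matrix (Fin m) (Fin n) ℂ}
    (hdiss : ∀ c, V *ᵥ c = 0 → 0 ≤ ∑ i, p i * ‖c i‖ ^ 2)
    (hV : ∀ a : Fin n → ℂ, ∃ c, (∀ i, 0 < p i → c i = a i) ∧ V *ᵥ c = 0)
    (B : L2W (diagWeight ρ hc hpos) →L[ℂ] L2W (diagWeight ρ hc hpos)) :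
    ∃ T : C0Semigroup (L2W (diagWeight ρ hc hpos)), ∀ x z,
      (x, z - B x) ∈ phGraph (diagWeight ρ hc hpos) (Matrix.diagonal fun i => (p i : ℂ)) 0 V ↔
      Tendsto (fun t : ℝ≥0 => (((t : ℝ) : ℂ))⁻¹ • (T.toFun t x - x)) (𝓝[>] 0) (𝓝 z) := by
  have hd : ∀ q ∈ phGraph (diagWeight ρ hc hpos) (Matrix.diagonal fun i => (p i : ℂ)) 0 V,
      (inner ℂ q.1 q.2).re ≤ 0 := by
    rintro q ⟨y, d, hy, hb, he⟩
    rw [energy_identity hM p hy (d := d) (by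
      filter_upwards [he] with ξ h1
      rw [h1, zero_mulVec, add_zero]
      funext i
      rw [mulVec_diagonal])]
    linarith [hdiss _ hb]
  refine exists_semigroup_of_dissipative ?_ hd (fun l hl f => diag_surjective hM hp hd hV hl f) B
  intro z hz
  rw [← phOp_graph] at hz
  exact LinearPMap.graph_fst_eq_zero_snd _ hz rfl

/-- The resolvent equation is solved with f = 0 and R = 0, where the forced positive values are 0.
The result consists of decaying exponentials in the negative coordinates, and it is nonzero because
its boundary value is c. -/
theorem exists_eigenvector {m : ℕ} {M : ℝ} (hM : ∀ i ξ, 0 ≤ ξ → ρ i ξ ≤ M) {p : Fin n → ℝ}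
    (hp : ∀ i, p i ≠ 0) {V : Matrix (Fin m) (Fin n) ℂ} {c : Fin n → ℂ} (hc0 : c ≠ 0)
    (hcp : ∀ i, 0 < p i → c i = 0) (hVc : V *ᵥ c = 0) {l : ℝ} (hl : 0 < l) :
    ∃ g, g ≠ 0 ∧ (g, (l : ℂ) • g) ∈
      phGraph (diagWeight ρ hc hpos) (Matrix.diagonal fun i => (p i : ℂ)) 0 V := by
  have h0 := L2W.rep_zero (diagWeight ρ hc hpos)
  obtain ⟨a, ha0, ha⟩ := exists_solution hM hp hl 0 le_rfl (h0.mono fun ξ h _ => h)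
  obtain ⟨g, y, d, hy, hy0, he⟩ := ha c fun i hi => by rw [hcp i hi, ha0 rfl]; rfl
  refine ⟨g, ?_, y, d, hy, by rw [hy0, hVc], ?_⟩
  · rintro rfl
    refine hc0 (funext fun i => ?_)
    have hd : (fun ξ => d ξ i) =ᵐ[halfLine] fun _ => 0 :=
      hy.deriv_eq_zero.mono fun ξ h => congrFun h i
    have hyi := (hy.locAC i).congr_deriv hd
    have hconst : ∀ b, 0 ≤ b → y b i = c i := by
      intro b hb
      have h1 := hyi.integral_eq hb
      rw [intervalIntegral.integral_zero, hy0] at h1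
      exact (sub_eq_zero.1 h1.symm)
    have hz : ∀ᵐ ξ ∂halfLine, c i = 0 := by
      filter_upwards [hy.ae_eq, h0, ae_halfLine_pos] with ξ h1 h2 hξ
      rw [← hconst ξ hξ.le, h1, h2, mulVec_zero]; rfl
    have : (ae halfLine).NeBot := by
      rw [ae_neBot]
      intro h
      have := Measure.restrict_eq_zero.1 h
      simp at this
    exact hz.exists.choose_spec
  · filter_upwards [he, L2W.rep_smul (l : ℂ) g, h0] with ξ h1 h2 h3
    rw [h2, zero_mulVec, add_zero]
    funext i
    rw [mulVec_diagonal, h1 i, h3]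
    simp

end Diag

/-- A semigroup generator has no approximate eigenvectors for large real numbers. -/
theorem C0Semigroup.IsGenerator.false_of_approx {X : Type*} [NormedAddCommGroup X]
    [NormedSpace ℂ X] [CompleteSpace X] {T : C0Semigroup X} {A : X →ₗ.[ℂ] X}
    (hT : T.IsGenerator A) {C : ℝ}
    (h : ∀ l : ℝ, 0 < l → ∃ x z, x ≠ 0 ∧ (x, z) ∈ A.graph ∧ ‖(l : ℂ) • x - z‖ ≤ C * ‖x‖) :
    False := by
  obtain ⟨M, hM1, hM⟩ := T.exists_bound
  have h1 : Tendsto (fun l : ℝ => 1 - M * Real.exp (-l)) atTop (𝓝 (1 - M * 0)) :=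
    tendsto_const_nhds.sub ((Real.tendsto_exp_neg_atTop_nhds_zero).const_mul M)
  have h2 : Tendsto (fun l : ℝ => M * C * l⁻¹) atTop (𝓝 (M * C * 0)) :=
    tendsto_inv_atTop_zero.const_mul _
  -- As l grows the left side tends to 0 and the right side to 1, whereas the lower bound applied to
  -- an approximate eigenvector gives the opposite inequality.
  have h3 : ∀ᶠ l : ℝ in atTop, M * C * l⁻¹ < 1 - M * Real.exp (-l) :=
    h2.eventually_lt h1 (by norm_num)
  obtain ⟨l, hlt, hl⟩ := (h3.and (eventually_gt_atTop 0)).exists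
  obtain ⟨x, z, hx, hxz, hb⟩ := h l hl
  have h4 := T.lower_bound hM ((hT x z).1 hxz) hl
  have h5 : M / l * ‖(l : ℂ) • x - z‖ ≤ M / l * (C * ‖x‖) :=
    mul_le_mul_of_nonneg_left hb (by positivity)
  have hx0 : 0 < ‖x‖ := norm_pos_iff.2 hx
  have h6 : ‖x‖ * (1 - M * Real.exp (-l)) ≤ ‖x‖ * (M * C * l⁻¹) := by
    refine (h4.trans h5).trans_eq ?_
    rw [div_eq_mul_inv]; ring
  exact absurd (le_of_mul_le_mul_left h6 hx0) (not_le.2 hlt)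

theorem mulIsBounded_one_diagWeight {ρ σ : Fin n → ℝ → ℝ}
    {hc : ∀ i, ContinuousOn (ρ i) (Ici 0)} {hpos : ∀ i ξ, 0 ≤ ξ → 0 < ρ i ξ}
    {hc' : ∀ i, ContinuousOn (σ i) (Ici 0)} {hpos' : ∀ i ξ, 0 ≤ ξ → 0 < σ i ξ} {C : ℝ}
    (h : ∀ i ξ, 0 ≤ ξ → σ i ξ ≤ C * ρ i ξ) :
    MulIsBounded (fun _ => 1) (diagWeight ρ hc hpos) (diagWeight σ hc' hpos') := by
  refine mulIsBounded_of_bound (C := C) (fun i j => aestronglyMeasurable_const) ?_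
  filter_upwards [ae_halfLine_pos] with ξ hξ u
  rw [one_mulVec, diagWeight_q, diagWeight_q, Finset.mul_sum]
  refine Finset.sum_le_sum fun i _ => ?_
  rw [← mul_assoc]
  exact mul_le_mul_of_nonneg_right (h i ξ hξ.le) (sq_nonneg _)

theorem MulIsIso.completeSpace {F : ℝ → Matrix (Fin n) (Fin n) ℂ} {w v : Weight n}
    (h : MulIsIso F w v) [CompleteSpace (L2W v)] : CompleteSpace (L2W w) := by
  obtain ⟨T, -⟩ := h
  exact (completeSpace_congr (e := T.toEquiv) T.isUniformEmbedding).2 inferInstance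

/-- The operator is, up to an isomorphism and a bounded perturbation, one with diagonal
coefficients. The scaling `κ` of the coordinates is arbitrary. -/
theorem exists_diagonal_model {m : ℕ} {w : Weight n} {P₁ P₀ : Matrix (Fin n) (Fin n) ℂ}
    (hP₁ : IsUnit P₁) {Δ S : ℝ → Matrix (Fin n) (Fin n) ℂ} (hΔC : MatC1 Δ) (hSC : MatC1 S)
    (hΔ : ∀ ξ, 0 ≤ ξ → (Δ ξ).IsDiag) (hS : ∀ ξ, 0 ≤ ξ → IsUnit (S ξ))
    (hdiag : ∀ ξ, 0 ≤ ξ → P₁ * w.toFun ξ = (S ξ)⁻¹ * Δ ξ * S ξ)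
    (hne : ∀ ξ, 0 ≤ ξ → ∀ i, Δ ξ i i ≠ 0) {s : Fin n → ℝ}
    (hs : ∀ ξ, 0 ≤ ξ → ∀ i, Δ ξ i i = (sgn (s i) : ℂ) * (‖Δ ξ i i‖ : ℂ))
    (ha : ∃ M : ℝ, ∀ ξ, 0 ≤ ξ → ∀ i j, ‖Δ ξ i j‖ ≤ M)
    (hb : MulIsIso S w (absWeight Δ hΔC hne))
    (hK : MulIsBounded (fun ξ => S ξ * matDeriv (fun ζ => (S ζ)⁻¹) ξ * Δ ξ)
      (absWeight Δ hΔC hne) (absWeight Δ hΔC hne))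
    (hH : MulIsBounded w.toFun w w) (WB : Matrix (Fin m) (Fin n) ℂ)
    {κ : Fin n → ℝ} (hκ : ∀ i, 0 < κ i) :
    ∃ (ρ : Fin n → ℝ → ℝ) (hc : ∀ i, ContinuousOn (ρ i) (Ici 0))
      (hpos : ∀ i ξ, 0 ≤ ξ → 0 < ρ i ξ) (M : ℝ) (Φ : L2W w ≃L[ℂ] L2W (diagWeight ρ hc hpos))
      (B : L2W (diagWeight ρ hc hpos) →L[ℂ] L2W (diagWeight ρ hc hpos)),
      (∀ i ξ, 0 ≤ ξ → ρ i ξ ≤ M) ∧ ∀ x z, (x, z) ∈ phGraph w P₁ P₀ WB ↔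
        (Φ x, Φ z - B (Φ x)) ∈ phGraph (diagWeight ρ hc hpos)
          (Matrix.diagonal fun i => ((sgn (s i) / κ i : ℝ) : ℂ)) 0
          (WB * P₁⁻¹ * (S 0)⁻¹ * Matrix.diagonal fun i => ((sgn (s i) / κ i : ℝ) : ℂ)) := by
  obtain ⟨M, hM⟩ := ha
  let σ : Fin n → ℝ → ℝ := fun i ξ => ‖Δ ξ i i‖
  have hσc : ∀ i, ContinuousOn (σ i) (Ici 0) := fun i => (hΔC i i).continuousOn.norm
  have hσ : ∀ i ξ, 0 ≤ ξ → 0 < σ i ξ := fun i ξ hξ => norm_pos_iff.2 (hne ξ hξ i)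
  -- The weight is scaled by κ and the coefficient p by 1/κ. Their product is always Δ, so only the
  -- scalar product, and with it dissipativity, depends on κ.
  let ρ : Fin n → ℝ → ℝ := fun i ξ => κ i * σ i ξ
  have hρc : ∀ i, ContinuousOn (ρ i) (Ici 0) := fun i => continuousOn_const.mul (hσc i)
  have hρ : ∀ i ξ, 0 ≤ ξ → 0 < ρ i ξ := fun i ξ hξ => mul_pos (hκ i) (hσ i ξ hξ)
  have hκs : ∀ i, κ i ≤ ∑ j, κ j := fun i =>
    Finset.single_le_sum (f := κ) (fun j _ => (hκ j).le) (Finset.mem_univ i)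
  have hκs' : ∀ i, (κ i)⁻¹ ≤ ∑ j, (κ j)⁻¹ := fun i =>
    Finset.single_le_sum (f := fun j => (κ j)⁻¹) (fun j _ => (inv_pos.2 (hκ j)).le)
      (Finset.mem_univ i)
  have h1 : MulIsBounded (fun _ => 1) (absWeight Δ hΔC hne) (diagWeight ρ hρc hρ) :=
    mulIsBounded_one_diagWeight (hc := hσc) (hpos := hσ) fun i ξ hξ =>
      mul_le_mul_of_nonneg_right (hκs i) (hσ i ξ hξ).le
  have h2 : MulIsBounded (fun _ => 1) (diagWeight ρ hρc hρ) (absWeight Δ hΔC hne) := by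
    refine mulIsBounded_one_diagWeight (hc' := hσc) (hpos' := hσ)
      (C := ∑ j, (κ j)⁻¹) fun i ξ hξ => ?_
    refine le_trans (le_of_eq ?_) (mul_le_mul_of_nonneg_right (hκs' i) (hρ i ξ hξ).le)
    simp only [ρ]
    rw [← mul_assoc, inv_mul_cancel₀ (hκ i).ne', one_mul]
  obtain ⟨Φ, hΦ⟩ := hb.trans_of_bounded h1 h2
  obtain ⟨K, hK'⟩ := h1.comp (hK.comp h2)
  obtain ⟨B, hB⟩ := mulIsBounded_const_mul_weight hH P₀
  have hK'' : ∀ g, (K g).rep =ᵐ[halfLine]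
      fun ξ => (S ξ * matDeriv (fun ζ => (S ζ)⁻¹) ξ * Δ ξ) *ᵥ g.rep ξ := fun g => by
    filter_upwards [hK' g] with ξ h
    rw [h, Matrix.one_mul, Matrix.mul_one]
  refine ⟨ρ, hρc, hρ, (∑ j, κ j) * M, Φ,
    -- The two terms are S (S⁻¹)' Δ and the transported zero order part S P₀ W S⁻¹.
    K + (Φ : L2W w →L[ℂ] _).comp (B.comp (Φ.symm : _ →L[ℂ] L2W w)), fun i ξ hξ => ?_,
    fun x z => ?_⟩
  · exact mul_le_mul (hκs i) (hM ξ hξ i i) (norm_nonneg _) (Finset.sum_nonneg fun j _ => (hκ j).le)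
  · have hpn : ∀ i, ((sgn (s i) / κ i : ℝ) : ℂ) ≠ 0 := by
      intro i
      have : sgn (s i) ≠ 0 := fun h => by simpa [h] using sgn_mul_self (s i)
      exact_mod_cast div_ne_zero this (hκ i).ne'
    have hv : ∀ ξ, 0 ≤ ξ → (Matrix.diagonal fun i => ((sgn (s i) / κ i : ℝ) : ℂ)) *
        (diagWeight ρ hρc hρ).toFun ξ = Δ ξ := by
      intro ξ hξ
      rw [← (isDiag_iff_diagonal_diag (Δ ξ)).1 (hΔ ξ hξ)]
      change _ * Matrix.diagonal _ = _
      rw [diagonal_mul_diagonal]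
      congr 1
      funext i
      rw [diag_apply, hs ξ hξ i, ← Complex.ofReal_mul, ← Complex.ofReal_mul]
      congr 1
      have := (hκ i).ne'
      simp only [ρ, σ]
      field_simp
    rw [mem_phGraph_iff_diag hP₁ hSC hS hdiag hpn hv WB Φ hΦ K hK'' B hB x z]
    simp

/-! ### The boundary condition -/

theorem mulVec_eq_add_submatrix {m np nm : ℕ} (N : Matrix (Fin m) (Fin n) ℂ)
    (e : Fin np ⊕ Fin nm ≃ Fin n) (v : Fin n → ℂ) :
    N *ᵥ v = N.submatrix id (fun k => e (Sum.inl k)) *ᵥ (fun k => v (e (Sum.inl k))) +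
      N.submatrix id (fun j => e (Sum.inr j)) *ᵥ (fun j => v (e (Sum.inr j))) := by
  funext i
  simp only [mulVec, dotProduct, Pi.add_apply, submatrix_apply, id]
  rw [← e.sum_comp, Fintype.sum_sum_type]

theorem sum_eq_add_sum {np nm : ℕ} (e : Fin np ⊕ Fin nm ≃ Fin n) (f : Fin n → ℝ) :
    ∑ i, f i = ∑ k, f (e (Sum.inl k)) + ∑ j, f (e (Sum.inr j)) := by
  rw [← e.sum_comp, Fintype.sum_sum_type]

/-- If the columns of `N` outgoing at the boundary form an invertible matrix, the kernel of `N` is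
a graph over the incoming coordinates. -/
theorem exists_bound_of_isUnit {np nm : ℕ} {N : Matrix (Fin nm) (Fin n) ℂ}
    {e : Fin np ⊕ Fin nm ≃ Fin n} (hN : IsUnit (N.submatrix id fun j => e (Sum.inr j))) :
    ∃ C : ℝ, 0 < C ∧ (∀ a, N *ᵥ a = 0 →
        ∑ j, ‖a (e (Sum.inr j))‖ ^ 2 ≤ C * ∑ k, ‖a (e (Sum.inl k))‖ ^ 2) ∧
      ∀ b : Fin n → ℂ, ∃ a, (∀ k, a (e (Sum.inl k)) = b (e (Sum.inl k))) ∧ N *ᵥ a = 0 := by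
  set N₁ := N.submatrix id fun k => e (Sum.inl k)
  set N₂ := N.submatrix id fun j => e (Sum.inr j)
  have hdet : IsUnit N₂.det := (isUnit_iff_isUnit_det _).1 hN
  obtain ⟨C, hC0, hC⟩ := exists_nsq_mulVec_le (-(N₂⁻¹ * N₁))
  -- The constant will serve as a weight and must be positive; C itself may vanish.
  refine ⟨C + 1, by linarith, fun a h => ?_, fun b => ?_⟩
  · rw [mulVec_eq_add_submatrix N e] at h
    have h1 : (fun j => a (e (Sum.inr j))) = -(N₂⁻¹ * N₁) *ᵥ fun k => a (e (Sum.inl k)) := by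
      have h2 := congrArg (N₂⁻¹ *ᵥ ·) h
      simp only [mulVec_add, mulVec_mulVec, mulVec_zero] at h2
      rw [nonsing_inv_mul _ hdet, one_mulVec] at h2
      rw [neg_mulVec]
      exact eq_neg_of_add_eq_zero_right h2
    have h3 := hC fun k => a (e (Sum.inl k))
    rw [← h1] at h3
    refine h3.trans (mul_le_mul_of_nonneg_right (by linarith) ?_)
    exact Finset.sum_nonneg fun k _ => sq_nonneg _
  · let u := -(N₂⁻¹ * N₁) *ᵥ fun k => b (e (Sum.inl k))
    refine ⟨fun i => Sum.elim (fun k => b (e (Sum.inl k))) u (e.symm i), by simp, ?_⟩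
    rw [mulVec_eq_add_submatrix N e]
    simp only [Equiv.symm_apply_apply, Sum.elim_inl, Sum.elim_inr]
    change N₁ *ᵥ _ + N₂ *ᵥ u = 0
    simp only [u, mulVec_mulVec]
    rw [Matrix.mul_neg, ← Matrix.mul_assoc, mul_nonsing_inv _ hdet, Matrix.one_mul, neg_mulVec,
      add_neg_cancel]

/-- A diagonal factor on the right scales the columns, and on the selected ones by nonzero numbers.
-/
theorem isUnit_submatrix_mul_diagonal {np nm : ℕ} {N : Matrix (Fin nm) (Fin n) ℂ}
    {D : Matrix (Fin n) (Fin n) ℂ} (hD : D.IsDiag) (hne : ∀ i, D i i ≠ 0)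
    {e : Fin np ⊕ Fin nm ≃ Fin n} :
    IsUnit ((N * D).submatrix id fun j => e (Sum.inr j)) ↔
      IsUnit (N.submatrix id fun j => e (Sum.inr j)) := by
  have h1 : (N * D).submatrix id (fun j => e (Sum.inr j)) =
      N.submatrix id (fun j => e (Sum.inr j)) *
        Matrix.diagonal fun j => D (e (Sum.inr j)) (e (Sum.inr j)) := by
    ext i j
    rw [mul_diagonal]
    nth_rw 1 [← (isDiag_iff_diagonal_diag D).1 hD]
    simp [mul_diagonal]
  rw [h1, isUnit_iff_isUnit_det, isUnit_iff_isUnit_det, det_mul, det_diagonal]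
  have : IsUnit (∏ j, D (e (Sum.inr j)) (e (Sum.inr j))) :=
    IsUnit.mk0 _ (Finset.prod_ne_zero_iff.2 fun j _ => hne _)
  rw [IsUnit.mul_iff]
  exact and_iff_left this

/-! ### The span of the negative eigenvectors -/

/-- In the coordinates u = S v the eigenvalue equation with r < 0 forces u to vanish wherever the
diagonal entry is positive. Conversely, each negative column of S⁻¹ is an eigenvector, with a real
eigenvalue. -/
theorem negEigenspan_of_similar {np nm : ℕ} {A D S : Matrix (Fin n) (Fin n) ℂ} (hS : IsUnit S)
    (hD : D.IsDiag) (h : A = S⁻¹ * D * S) (him : ∀ i, (D i i).im = 0)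
    (e : Fin np ⊕ Fin nm ≃ Fin n) (hep : ∀ k, 0 < (D (e (Sum.inl k)) (e (Sum.inl k))).re)
    (hem : ∀ j, (D (e (Sum.inr j)) (e (Sum.inr j))).re < 0) :
    negEigenspan A =
      Submodule.span ℂ (range fun j => S⁻¹ *ᵥ Pi.single (e (Sum.inr j)) (1 : ℂ)) := by
  have hdet : IsUnit S.det := (isUnit_iff_isUnit_det _).1 hS
  refine le_antisymm (Submodule.span_le.2 ?_) (Submodule.span_mono ?_)
  · rintro v ⟨r, hr, hv⟩
    have h1 : A *ᵥ v = (r : ℂ) • v := by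
      have := hv.apply_eq_smul
      rwa [toLin'_apply] at this
    set u := S *ᵥ v
    have h2 : D *ᵥ u = (r : ℂ) • u := by
      have h3 := congrArg (S *ᵥ ·) h1
      simp only [h, mulVec_mulVec, mulVec_smul] at h3
      rw [Matrix.mul_assoc S⁻¹, ← Matrix.mul_assoc S, mul_nonsing_inv _ hdet, Matrix.one_mul,
        ← mulVec_mulVec] at h3
      exact h3
    have hu : ∀ k, u (e (Sum.inl k)) = 0 := by
      intro k
      rw [← (isDiag_iff_diagonal_diag D).1 hD] at h2
      have h3 := congrFun h2 (e (Sum.inl k))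
      rw [mulVec_diagonal, diag_apply, Pi.smul_apply, smul_eq_mul, ← sub_eq_zero, ← sub_mul] at h3
      refine (mul_eq_zero.1 h3).resolve_left fun h4 => ?_
      have h5 := congrArg Complex.re h4
      simp only [Complex.sub_re, Complex.ofReal_re, Complex.zero_re] at h5
      linarith [hep k]
    have hv' : v = ∑ j, u (e (Sum.inr j)) • (S⁻¹ *ᵥ Pi.single (e (Sum.inr j)) (1 : ℂ)) := by
      have h3 : v = S⁻¹ *ᵥ u := by
        simp only [u, mulVec_mulVec]
        rw [nonsing_inv_mul _ hdet, one_mulVec]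
      rw [h3, mulVec_eq_add_submatrix _ e]
      simp only [hu]
      funext i
      simp [mulVec, dotProduct, mul_comm]
    rw [hv']
    exact Submodule.sum_mem _ fun j _ =>
      Submodule.smul_mem _ _ (Submodule.subset_span (mem_range_self j))
  · rintro _ ⟨j, rfl⟩
    refine ⟨(D (e (Sum.inr j)) (e (Sum.inr j))).re, hem j, ?_⟩
    rw [Module.End.hasEigenvector_iff]
    refine ⟨?_, inv_mulVec_single_ne_zero hS _⟩
    rw [Module.End.mem_eigenspace_iff, toLin'_apply, mulVec_eq_of_similar hS hD h]
    congr 1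
    exact Complex.ext rfl (by simp [him])

/-- N sends the spanning eigenvectors to the columns of the square matrix on the right, and these
span exactly when that matrix is invertible. -/
theorem map_negEigenspan_eq_top_iff {np nm : ℕ} {A D S : Matrix (Fin n) (Fin n) ℂ} (hS : IsUnit S)
    (hD : D.IsDiag) (h : A = S⁻¹ * D * S) (him : ∀ i, (D i i).im = 0)
    (e : Fin np ⊕ Fin nm ≃ Fin n) (hep : ∀ k, 0 < (D (e (Sum.inl k)) (e (Sum.inl k))).re)
    (hem : ∀ j, (D (e (Sum.inr j)) (e (Sum.inr j))).re < 0) (N : Matrix (Fin nm) (Fin n) ℂ) :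
    (negEigenspan A).map (Matrix.toLin' N) = ⊤ ↔
      IsUnit ((N * S⁻¹).submatrix id fun j => e (Sum.inr j)) := by
  rw [negEigenspan_of_similar hS hD h him e hep hem, Submodule.map_span, ← range_comp]
  have h1 : (⇑(Matrix.toLin' N) ∘ fun j => S⁻¹ *ᵥ Pi.single (e (Sum.inr j)) (1 : ℂ)) =
      ((N * S⁻¹).submatrix id fun j => e (Sum.inr j)).col := by
    funext j i
    simp [mulVec, dotProduct, Matrix.mul_apply]
  rw [h1, ← range_mulVecLin, LinearMap.range_eq_top, ← mulVec_surjective_iff_isUnit]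
  rfl

/-! ### The characterization -/

/-- Generation on the maximal domain is equivalent to the invertibility of the columns of the
boundary matrix belonging to the negative coordinates. -/
theorem generates_phOp_iff {np nm : ℕ} {w : Weight n} [CompleteSpace (L2W w)]
    {P₁ P₀ : Matrix (Fin n) (Fin n) ℂ} (hP₁ : IsUnit P₁) {Δ S : ℝ → Matrix (Fin n) (Fin n) ℂ}
    (hΔC : MatC1 Δ) (hSC : MatC1 S) (hΔ : ∀ ξ, 0 ≤ ξ → (Δ ξ).IsDiag)
    (hS : ∀ ξ, 0 ≤ ξ → IsUnit (S ξ))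
    (hdiag : ∀ ξ, 0 ≤ ξ → P₁ * w.toFun ξ = (S ξ)⁻¹ * Δ ξ * S ξ)
    (hne : ∀ ξ, 0 ≤ ξ → ∀ i, Δ ξ i i ≠ 0) {s : Fin n → ℝ}
    (hs : ∀ ξ, 0 ≤ ξ → ∀ i, Δ ξ i i = (sgn (s i) : ℂ) * (‖Δ ξ i i‖ : ℂ))
    (e : Fin np ⊕ Fin nm ≃ Fin n) (hep : ∀ k, 0 < s (e (Sum.inl k)))
    (hem : ∀ j, s (e (Sum.inr j)) < 0)
    (ha : ∃ M : ℝ, ∀ ξ, 0 ≤ ξ → ∀ i j, ‖Δ ξ i j‖ ≤ M)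
    (hb : MulIsIso S w (absWeight Δ hΔC hne))
    (hK : MulIsBounded (fun ξ => S ξ * matDeriv (fun ζ => (S ζ)⁻¹) ξ * Δ ξ)
      (absWeight Δ hΔC hne) (absWeight Δ hΔC hne))
    (hH : MulIsBounded w.toFun w w) (WB : Matrix (Fin nm) (Fin n) ℂ) :
    GeneratesC0Semigroup (phOp w P₁ P₀ WB) ↔
      IsUnit ((WB * P₁⁻¹ * (S 0)⁻¹).submatrix id fun j => e (Sum.inr j)) := by
  set N := WB * P₁⁻¹ * (S 0)⁻¹
  have hsp : ∀ k, sgn (s (e (Sum.inl k))) = 1 := fun k => if_pos (hep k)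
  have hsm : ∀ j, sgn (s (e (Sum.inr j))) = -1 := fun j => if_neg (not_lt.2 (hem j).le)
  have hs0 : ∀ i, sgn (s i) ≠ 0 := fun i h => by simpa [h] using sgn_mul_self (s i)
  constructor
  · rintro ⟨T, hT⟩
    by_contra hN
    rw [isUnit_iff_isUnit_det, isUnit_iff_ne_zero, not_not] at hN
    obtain ⟨u, hu0, hu⟩ := exists_mulVec_eq_zero_iff.2 hN
    obtain ⟨ρ, hρc, hρ, M, Φ, B, hM, hgr⟩ := exists_diagonal_model hP₁ hΔC hSC hΔ hS hdiag hne hs ha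
      hb hK hH WB (P₀ := P₀) (κ := fun _ => 1) fun _ => one_pos
    simp only [div_one] at hgr
    -- The kernel vector of the negative block is extended by zero. The signs turn it into -c, so it
    -- satisfies the boundary condition of the diagonal model as well.
    let c : Fin n → ℂ := fun i => Sum.elim (fun _ => 0) u (e.symm i)
    have hcp : ∀ k, c (e (Sum.inl k)) = 0 := fun k => by simp [c]
    have hcm : ∀ j, c (e (Sum.inr j)) = u j := fun j => by simp [c]
    have hc0 : c ≠ 0 := fun h => hu0 (funext fun j => by rw [← hcm j, h]; rfl)
    have hcs : ∀ i, 0 < sgn (s i) → c i = 0 := by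
      intro i hi
      obtain ⟨k | j, rfl⟩ := e.surjective i
      · exact hcp k
      · rw [hsm] at hi
        norm_num at hi
    have hVc : (N * Matrix.diagonal fun i => ((sgn (s i) : ℝ) : ℂ)) *ᵥ c = 0 := by
      have h1 : (Matrix.diagonal fun i => ((sgn (s i) : ℝ) : ℂ)) *ᵥ c = -c := by
        funext i
        rw [mulVec_diagonal, Pi.neg_apply]
        obtain ⟨k | j, rfl⟩ := e.surjective i
        · rw [hcp]; simp
        · rw [hsm]; simp
      rw [← mulVec_mulVec, h1, mulVec_neg, mulVec_eq_add_submatrix N e]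
      simp only [hcp, hcm]
      rw [hu]
      simp [← Pi.zero_def]
    -- Carried back by Φ, an eigenvector of the model fails to be one of the full operator only by
    -- Φ⁻¹ B g, and this error bound is independent of l.
    refine hT.false_of_approx (C := ‖(Φ.symm : L2W (diagWeight ρ hρc hρ) →L[ℂ] L2W w)‖ *
      (‖B‖ * ‖(Φ : L2W w →L[ℂ] L2W (diagWeight ρ hρc hρ))‖)) fun l hl => ?_
    obtain ⟨g, hg0, hg⟩ := exists_eigenvector (hc := hρc) (hpos := hρ) hM hs0 hc0 hcs hVc hl
    refine ⟨Φ.symm g, Φ.symm ((l : ℂ) • g + B g), ?_, ?_, ?_⟩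
    · simpa using hg0
    · rw [phOp_graph, hgr]
      simpa using hg
    · rw [map_add, map_smul, sub_add_cancel_left, norm_neg]
      have h1 := (Φ.symm : L2W (diagWeight ρ hρc hρ) →L[ℂ] L2W w).le_opNorm (B g)
      have h2 := B.le_opNorm g
      have h3 := (Φ : L2W w →L[ℂ] L2W (diagWeight ρ hρc hρ)).le_opNorm (Φ.symm g)
      simp only [ContinuousLinearEquiv.coe_coe, ContinuousLinearEquiv.apply_symm_apply] at h1 h3
      calc _ ≤ _ := h1
        _ ≤ ‖(Φ.symm : L2W (diagWeight ρ hρc hρ) →L[ℂ] L2W w)‖ *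
            (‖B‖ * (‖(Φ : L2W w →L[ℂ] L2W (diagWeight ρ hρc hρ))‖ * ‖Φ.symm g‖)) := by gcongr; exact h2.trans (by gcongr)
        _ = _ := by ring
  · intro hN
    obtain ⟨C, hC, hker, hsol⟩ := exists_bound_of_isUnit hN
    -- With p = 1/C on the positive and p = -1 on the negative coordinates, the kernel estimate for
    -- a = diag(p) c reads ∑|c₋|² ≤ C · C⁻² ∑|c₊|² = C⁻¹ ∑|c₊|², which is exactly the required sign
    -- condition.
    let κ : Fin n → ℝ := fun i => if 0 < s i then C else 1
    have hκ : ∀ i, 0 < κ i := fun i => by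
      simp only [κ]; split_ifs <;> [exact hC; exact one_pos]
    have hκp : ∀ k, κ (e (Sum.inl k)) = C := fun k => if_pos (hep k)
    have hκm : ∀ j, κ (e (Sum.inr j)) = 1 := fun j => if_neg (not_lt.2 (hem j).le)
    obtain ⟨ρ, hρc, hρ, M, Φ, B, hM, hgr⟩ := exists_diagonal_model hP₁ hΔC hSC hΔ hS hdiag hne hs ha
      hb hK hH WB (P₀ := P₀) hκ
    have hp : ∀ i, sgn (s i) / κ i ≠ 0 := fun i => div_ne_zero (hs0 i) (hκ i).ne'
    have hpc : ∀ i, ((sgn (s i) / κ i : ℝ) : ℂ) ≠ 0 := fun i => by exact_mod_cast hp i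
    have hdv : ∀ c i, ((Matrix.diagonal fun i => ((sgn (s i) / κ i : ℝ) : ℂ)) *ᵥ c) i =
        ((sgn (s i) / κ i : ℝ) : ℂ) * c i := fun c i => mulVec_diagonal _ _ _
    obtain ⟨T, hT⟩ : ∃ T : C0Semigroup (L2W (diagWeight ρ hρc hρ)), ∀ x z, (x, z - B x) ∈
        phGraph (diagWeight ρ hρc hρ) (Matrix.diagonal fun i => ((sgn (s i) / κ i : ℝ) : ℂ)) 0
          (N * Matrix.diagonal fun i => ((sgn (s i) / κ i : ℝ) : ℂ)) ↔
        Tendsto (fun t : ℝ≥0 => (((t : ℝ) : ℂ))⁻¹ • (T.toFun t x - x)) (𝓝[>] 0) (𝓝 z) := by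
      refine exists_semigroup_diag hM hp ?_ ?_ B
      · intro c hc
        rw [← mulVec_mulVec] at hc
        have h1 := hker _ hc
        simp only [hdv, hsp, hsm, hκp, hκm, norm_mul, Complex.norm_real, Real.norm_eq_abs] at h1
        rw [sum_eq_add_sum e]
        simp only [hsp, hsm, hκp, hκm]
        simp only [abs_of_pos (one_div_pos.2 hC), mul_pow, ← Finset.mul_sum] at h1 ⊢
        have h2 : C * ((1 / C) ^ 2 * ∑ k, ‖c (e (Sum.inl k))‖ ^ 2) =
            1 / C * ∑ k, ‖c (e (Sum.inl k))‖ ^ 2 := by field_simp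
        rw [h2] at h1
        norm_num at h1 ⊢
        exact h1
      · intro b
        obtain ⟨a, hab, hNa⟩ := hsol fun i => ((sgn (s i) / κ i : ℝ) : ℂ) * b i
        refine ⟨fun i => ((sgn (s i) / κ i : ℝ) : ℂ)⁻¹ * a i, fun i hi => ?_, ?_⟩
        · obtain ⟨k | j, rfl⟩ := e.surjective i
          · simp only [hab]
            exact inv_mul_cancel_left₀ (hpc _) _
          · rw [hsm, hκm] at hi
            norm_num at hi
        · rw [← mulVec_mulVec]
          have h1 : (Matrix.diagonal fun i => ((sgn (s i) / κ i : ℝ) : ℂ)) *ᵥ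
              (fun i => ((sgn (s i) / κ i : ℝ) : ℂ)⁻¹ * a i) = a := by
            funext i
            rw [hdv, mul_inv_cancel_left₀ (hpc _)]
          rw [h1, hNa]
    refine generates_of_equiv Φ T fun x z => ?_
    rw [phOp_graph, hgr, hT]

end PortHam
end
-- The corollary
theorem corollary4p12
    {n np nm : ℕ} (hn : 1 ≤ n)
    (P₁ P₀ : Matrix (Fin n) (Fin n) ℂ) (hP₁ : P₁.IsHermitian) (hP₁u : IsUnit P₁)
    -- the Hamiltonian
    (H : ℝ → Matrix (Fin n) (Fin n) ℝ) (hHC : PortHam.MatC1 H)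
    (hHpos : ∀ ξ, 0 ≤ ξ → (H ξ).PosDef)
    -- the diagonalization `P₁ H = S⁻¹ Δ S`
    (Δ S : ℝ → Matrix (Fin n) (Fin n) ℂ) (hΔC : PortHam.MatC1 Δ) (hSC : PortHam.MatC1 S)
    (hΔ : ∀ ξ, 0 ≤ ξ → (Δ ξ).IsDiag) (hS : ∀ ξ, 0 ≤ ξ → IsUnit (S ξ))
    (hdiag : ∀ ξ, 0 ≤ ξ → P₁ * PortHam.cplx (H ξ) = (S ξ)⁻¹ * Δ ξ * S ξ)
    -- `nm` is the number of negative eigenvalues of `P₁`, counted with multiplicity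
    (hnm : nm = Fintype.card {i // hP₁.eigenvalues i < 0}) (hnm1 : 1 ≤ nm)
    -- any enumeration of the coordinates by the sign of the diagonal entries of `Δ`
    (e : Fin np ⊕ Fin nm ≃ Fin n)
    (hep : ∀ k, 0 < (Δ 0 (e (Sum.inl k)) (e (Sum.inl k))).re)
    (hem : ∀ j, (Δ 0 (e (Sum.inr j)) (e (Sum.inr j))).re < 0)
    (WB : Matrix (Fin nm) (Fin n) ℂ)
    -- the weights `H` and `|Δ|`
    (wH wΔ : PortHam.Weight n) (hwH : wH = PortHam.hamWeight H hHC hHpos)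
    (hwΔ : wΔ = PortHam.absWeight Δ hΔC fun ξ hξ =>
      PortHam.diag_ne_zero hP₁u (hHpos ξ hξ) (hΔ ξ hξ) (hdiag ξ hξ))
    -- (a)
    (ha : ∃ M : ℝ, ∀ ξ, 0 ≤ ξ → ∀ i j, ‖Δ ξ i j‖ ≤ M)
    -- (b)
    (hb : PortHam.MulIsIso S wH wΔ)
    -- (c)
    (hc : PortHam.MulIsBounded
      (fun ξ => S ξ * PortHam.matDeriv (fun ζ => (S ζ)⁻¹) ξ * Δ ξ) wΔ wΔ)
    -- (d)
    (hd : PortHam.MulMapsInto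
      (fun ξ => PortHam.matDeriv S ξ * P₁ * PortHam.cplx (H ξ)) wH wΔ)
    -- (e)
    (he : WB.rank = nm)
    -- multiplication by the Hamiltonian is bounded
    (hH : PortHam.MulIsBounded (fun ξ => PortHam.cplx (H ξ)) wH wH)
    -- `U₂` consists of the columns belonging to the negative entries of `Δ`
    (U₂ : Matrix (Fin nm) (Fin nm) ℂ)
    (hU₂ : U₂ = (WB * PortHam.cplx (H 0) * (S 0)⁻¹).submatrix id fun j => e (Sum.inr j)) :
    -- the operator on its maximal domain
    (PortHam.GeneratesC0Semigroup (PortHam.phOp wH P₁ P₀ WB) ↔ IsUnit U₂) ∧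
    -- the second form of the matrix condition
    (IsUnit U₂ ↔
      (PortHam.negEigenspan (P₁ * PortHam.cplx (H 0))).map
        (Matrix.toLin' (WB * PortHam.cplx (H 0))) = ⊤) ∧
    -- the operator on the domain prescribed by `(H x)' ∈ L²_H`, whenever it takes
    -- values in `L²_H` there
    (PortHam.derivDomain wH WB ≤ (PortHam.phOp wH P₁ P₀ WB).domain →
      (PortHam.GeneratesC0Semigroup
        ((PortHam.phOp wH P₁ P₀ WB).domRestrict (PortHam.derivDomain wH WB)) ↔ IsUnit U₂)) := by
  subst hwH hwΔ hU₂
  have hne : ∀ ξ, 0 ≤ ξ → ∀ i, Δ ξ i i ≠ 0 := fun ξ hξ =>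
    PortHam.diag_ne_zero hP₁u (hHpos ξ hξ) (hΔ ξ hξ) (hdiag ξ hξ)
  have him : ∀ ξ, 0 ≤ ξ → ∀ i, (Δ ξ i i).im = 0 := fun ξ hξ i =>
    PortHam.im_eq_zero_of_eigen hP₁ (PortHam.cplx_posDef (hHpos ξ hξ))
      (PortHam.inv_mulVec_single_ne_zero (hS ξ hξ) i)
      (PortHam.mulVec_eq_of_similar (hS ξ hξ) (hΔ ξ hξ) (hdiag ξ hξ) i)
  -- The entries are real, continuous and never zero, so their signs are those at ξ = 0.
  have hs : ∀ ξ, 0 ≤ ξ → ∀ i, Δ ξ i i = (PortHam.sgn (Δ 0 i i).re : ℂ) * (‖Δ ξ i i‖ : ℂ) :=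
    fun ξ hξ i => PortHam.eq_sgn_mul_norm (him ξ hξ i) <| PortHam.pos_iff_of_continuousOn
      (Complex.continuous_re.comp_continuousOn (hΔC i i).continuousOn)
      (fun ζ hζ h => hne ζ hζ i (Complex.ext h (him ζ hζ i))) hξ
  -- The weight |Δ| is the diagonal weight with densities ‖Δᵢᵢ‖; completeness passes to L²_H through
  -- the isomorphism (b).
  have hcomp : CompleteSpace (PortHam.L2W (PortHam.hamWeight H hHC hHpos)) := by
    have : CompleteSpace (PortHam.L2W (PortHam.absWeight Δ hΔC hne)) :=
      PortHam.completeSpace_diagWeight (ρ := fun i ξ => ‖Δ ξ i i‖)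
        (hc := fun i => (hΔC i i).continuousOn.norm)
        (hpos := fun i ξ hξ => norm_pos_iff.2 (hne ξ hξ i))
    exact hb.completeSpace
  have hPdet : IsUnit P₁.det := (isUnit_iff_isUnit_det _).1 hP₁u
  have hSdet : IsUnit (S 0).det := (isUnit_iff_isUnit_det _).1 (hS 0 le_rfl)
  -- From P₁ H = S⁻¹ Δ S one gets H S⁻¹ = P₁⁻¹ S⁻¹ Δ; the factor Δ(0) does not affect invertibility
  -- of the chosen columns.
  have hU : WB * PortHam.cplx (H 0) * (S 0)⁻¹ = WB * P₁⁻¹ * (S 0)⁻¹ * Δ 0 := by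
    have h1 : PortHam.cplx (H 0) = P₁⁻¹ * ((S 0)⁻¹ * Δ 0 * S 0) := by
      rw [← hdiag 0 le_rfl, ← Matrix.mul_assoc, nonsing_inv_mul _ hPdet, Matrix.one_mul]
    rw [h1]
    simp only [Matrix.mul_assoc]
    rw [mul_nonsing_inv _ hSdet, Matrix.mul_one]
  have key : PortHam.GeneratesC0Semigroup
      (PortHam.phOp (PortHam.hamWeight H hHC hHpos) P₁ P₀ WB) ↔
      IsUnit ((WB * PortHam.cplx (H 0) * (S 0)⁻¹).submatrix id fun j => e (Sum.inr j)) := by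
    rw [hU, PortHam.isUnit_submatrix_mul_diagonal (hΔ 0 le_rfl) (hne 0 le_rfl)]
    exact PortHam.generates_phOp_iff hP₁u hΔC hSC hΔ hS hdiag hne hs e hep hem ha hb hc hH WB
  refine ⟨key, ?_, fun hD => ?_⟩
  · exact (PortHam.map_negEigenspan_eq_top_iff (hS 0 le_rfl) (hΔ 0 le_rfl) (hdiag 0 le_rfl)
      (him 0 le_rfl) e hep hem _).symm
  · obtain ⟨B, hB⟩ := PortHam.mulIsBounded_const_mul_weight hH P₀
    rw [PortHam.domRestrict_derivDomain hP₁u hB hD]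
    exact key
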